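/- Let $\mathfrak g$ be a six-dimensional real Lie algebra with basis $X_1,\dots,X_6$ and structure constants $[X_i,X_j]=\sum_k C_{ij}^kX_k$. On functions of the coordinates $x_1,\dots,x_6$ of $\mathfrak g^*$ consider the operators $$\widehat X_i=-\sum_{j,k}C_{ij}^k\,x_k\,\frac{\partial}{\partial x_j},\qquad 1\le i\le 6 .$$ An *invariant* on an open set $U\subseteq\mathbb R^6$ is a $C^\infty$ function $F$ on $U$ with $\widehat X_iF=0$ on $U$ for $1\le i\le6$. Functions $I_1,\dots,I_r$ on $U$ are *functionally independent* if their differentials are linearly independent at the points of a dense subset of $U$. Invariants $I_1,\dots,I_r$ on a nonempty open set $U$ form a *fundamental set* if they are functionally independent and no invariant $F$ on any nonempty open $V\subseteq U$ is such that $F,I_1,\dots,I_r$ are functionally independent on $V$. Invariants are real-valued, except for $\mathfrak g_{6,12}$, where they are complex-valued and linear independence is over $\mathbb C$; powers and roots of positive reals are positive, and complex powers are principal values. (The functions $\left(\frac{u+iv}{u-iv}\right)^{ip}$ below are real, since the base has modulus one.) **Theorem.** Each entry of the list below, for all real values of its parameters that satisfy the stated conditions, gives the non-zero brackets of a six-dimensional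 real solvable Lie algebra whose nilradical is the span of $X_1,\dots,X_5$: the brackets among $X_1,\dots,X_5$ are those written in the heading, and the five vectors in parentheses are $[X_1,X_6],\dots,[X_5,X_6]$. The functions in the entry form a fundamental set of invariants of this algebra on the indicated open set (the set of $x\in\mathbb R^6$ where the stated inequalities hold). Where the entry says "None", every invariant on a connected open subset of $\mathbb R^6$ is constant. So the number of invariants is $4$ when the nilradical is abelian, $2$ when it is one of $\mathfrak g_{3,1}+2\mathfrak g_1$, $\mathfrak g_{4,1}+\mathfrak g_1$, $\mathfrak g_{5,1}$, $\mathfrak g_{5,2}$, $\mathfrak g_{5,3}$, and $0$ or $2$, as indicated, when it is $\mathfrak g_{5,4}$, $\mathfrak g_{5,5}$ or $\mathfrak g_{5,6}$. **Nilradical $5\mathfrak g_1$ (abelian).** - $\mathfrak g_{6,1}$ $(X_1,\ \alpha X_2,\ \beta X_3,\ \gamma X_4,\ \delta X_5)$. Parameters: $0 < |\delta |$, $|\delta | \le |\gamma |$, $|\gamma | \le |\beta |$, $|\beta | \le |\alpha |$, $|\alpha | \le 1$. $x_2 x_1^{-\alpha}$; $x_3 x_1^{-\beta}$; $x_4 x_1^{-\gamma}$;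 $x_5 x_1^{-\delta}$ on $x_1>0$. - $\mathfrak g_{6,2}$ $(\alpha X_1,\ X_1+\alpha X_2,\ X_3,\ \gamma X_4,\ \delta X_5)$. Parameters: $0 < |\delta |$, $|\delta | \le |\gamma |$, $|\gamma | \le 1$. $x_1 \exp\left(\frac{-\alpha x_2}{x_1}\right)$; $x_3 \exp\left(\frac{-x_2}{x_1}\right)$; $x_4 \exp\left(\frac{-\gamma x_2}{x_1}\right)$; $x_5 \exp\left(\frac{-\delta x_2}{x_1}\right)$ on $x_1\ne0$. - $\mathfrak g_{6,3}$ $(\alpha X_1,\ X_1+\alpha X_2,\ X_2+\alpha X_3,\ X_4,\ \delta X_5)$. Parameters: $0 < |\delta |$, $|\delta | \le 1$. $x_1 \exp\left(\frac{-\alpha x_2}{x_1}\right)$; $\frac{2 x_1 x_3-x_2^{2}}{x_1^{2}}$; $x_4 \exp\left(\frac{-x_2}{x_1}\right)$; $x_5 \exp\left(\frac{-\delta x_2}{x_1}\right)$ on $x_1\ne0$. - $\mathfrak g_{6,4}$ $(\alpha X_1,\ X_1+\alpha X_2,\ X_2+\alpha X_3,\ X_3+\alpha X_4,\ X_5)$.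 $x_1 \exp\left(\frac{-\alpha x_2}{x_1}\right)$; $\frac{2 x_1 x_3-x_2^{2}}{x_1^{2}}$; $\frac{3 x_1^{2} x_4+x_2^{3}-3 x_1 x_2 x_3}{x_1^{3}}$; $x_5 \exp\left(\frac{-x_2}{x_1}\right)$ on $x_1\ne0$. - $\mathfrak g_{6,5}$ $(X_1,\ X_1+X_2,\ X_2+X_3,\ X_3+X_4,\ X_4+X_5)$. $x_1 \exp\left(\frac{-x_2}{x_1}\right)$; $\frac{2 x_1 x_3-x_2^{2}}{x_1^{2}}$; $\frac{3 x_1^{2} x_4+x_2^{3}-3 x_1 x_2 x_3}{x_1^{3}}$; $\frac{x_2^{4}-8 x_1^{3} x_5-4 x_1 x_2^{2} x_3+8 x_1^{2} x_2 x_4}{x_1^{4}}$ on $x_1\ne0$. - $\mathfrak g_{6,6}$ $(X_1,\ \alpha X_2,\ X_2+\alpha X_3,\ \beta X_4,\ X_4+\beta X_5)$. Parameters: $\alpha \le \beta$. $x_2 x_1^{-\alpha}$; $x_1 \exp\left(\frac{-x_3}{x_2}\right)$; $x_4 x_1^{-\beta}$; $x_1 \exp\left(\frac{-x_5}{x_4}\right)$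 on $x_1>0$, $x_2\ne0$, $x_4\ne0$. - $\mathfrak g_{6,7}$ $(\alpha X_1,\ X_1+\alpha X_2,\ X_2+\alpha X_3,\ \beta X_4,\ X_4+\beta X_5)$. Parameters: $\alpha ^2 + \beta ^2 \ne 0$. $x_1 \exp\left(\frac{-\alpha x_2}{x_1}\right)$; $\frac{2 x_1 x_3-x_2^{2}}{x_1^{2}}$; $\frac{x_1 x_5-x_2 x_4}{x_1} \exp\left(\frac{-\beta x_2}{x_1}\right)$; $x_4 \exp\left(\frac{-\beta x_2}{x_1}\right)$ on $x_1\ne0$. - $\mathfrak g_{6,8}$ $(\alpha X_1,\ \beta X_2,\ \gamma X_3,\ p X_4-X_5,\ X_4+p X_5)$. Parameters: $0 < |\gamma |$, $|\gamma | \le |\beta |$, $|\beta | \le |\alpha |$. $\left(x_4^{2}+x_5^{2}\right) \left(\frac{x_4+ix_5}{x_4-ix_5}\right)^{i p}$; $x_1 \exp\left(\alpha \arctan\left(\frac{x_4}{x_5}\right)\right)$; $x_2 \exp\left(\beta \arctan\left(\frac{x_4}{x_5}\right)\right)$; $x_3 \exp\left(\gamma \arctan\left(\frac{x_4}{x_5}\right)\right)$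 on $x_4\ne0$, $x_5\ne0$. - $\mathfrak g_{6,9}$ $(\alpha X_1,\ \beta X_2,\ X_2+\beta X_3,\ p X_4-X_5,\ X_4+p X_5)$. Parameters: $\alpha \ne 0$. $\left(x_4^{2}+x_5^{2}\right) \left(\frac{x_4+ix_5}{x_4-ix_5}\right)^{i p}$; $x_1 \exp\left(\alpha \arctan\left(\frac{x_4}{x_5}\right)\right)$; $x_2 \exp\left(\beta \arctan\left(\frac{x_4}{x_5}\right)\right)$; $\left(x_3+x_2 \arctan\left(\frac{x_4}{x_5}\right)\right) \exp\left(\beta \arctan\left(\frac{x_4}{x_5}\right)\right)$ on $x_4\ne0$, $x_5\ne0$. - $\mathfrak g_{6,10}$ $(\alpha X_1,\ X_1+\alpha X_2,\ X_2+\alpha X_3,\ p X_4-X_5,\ X_4+p X_5)$. $\left(x_4^{2}+x_5^{2}\right) \left(\frac{x_4+ix_5}{x_4-ix_5}\right)^{i p}$; $x_1 \exp\left(\alpha \arctan\left(\frac{x_4}{x_5}\right)\right)$; $\left(x_2+x_1 \arctan\left(\frac{x_4}{x_5}\right)\right) \exp\left(\alpha \arctan\left(\frac{x_4}{x_5}\right)\right)$;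 $\frac{2 x_3 x_1-x_2^{2}}{x_1^{2}}$ on $x_1\ne0$, $x_4\ne0$, $x_5\ne0$. - $\mathfrak g_{6,11}$ $(\alpha X_1,\ p X_2-X_3,\ X_2+p X_3,\ q X_4-s X_5,\ s X_4+q X_5)$. If $\alpha s \ne 0$, $p q \ne 0$: $\left(x_2^{2}+x_3^{2}\right) \left(\frac{x_2+ix_3}{x_2-ix_3}\right)^{i p}$; $\left(x_4^{2}+x_5^{2}\right) \left(\frac{x_4+ix_5}{x_4-ix_5}\right)^{i \frac{q}{s}}$; $\left(x_2^{2}+x_3^{2}\right)^{\alpha} x_1^{-2 p}$; $\left(x_4^{2}+x_5^{2}\right)^{\alpha} x_1^{-2 q}$ on $x_1>0$, $x_2\ne0$, $x_4\ne0$. If $\alpha s \ne 0$, $p q = 0$: $\left(x_2^{2}+x_3^{2}\right) \left(\frac{x_2+ix_3}{x_2-ix_3}\right)^{i p}$; $\left(x_4^{2}+x_5^{2}\right) \left(\frac{x_4+ix_5}{x_4-ix_5}\right)^{i \frac{q}{s}}$; $x_1 \exp\left(\alpha \arctan\left(\frac{x_2}{x_3}\right)\right)$; $x_1 \exp\left(\frac{\alpha}{s}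 \arctan\left(\frac{x_4}{x_5}\right)\right)$ on $x_2\ne0$, $x_3\ne0$, $x_4\ne0$, $x_5\ne0$. - $\mathfrak g_{6,12}$ $(\alpha X_1,\ p X_2-X_3,\ X_2+p X_3,\ X_2+p X_4-X_5,\ X_3+X_4+p X_5)$. Parameters: $\alpha \ne 0$. $\left(x_3+i x_2\right)^{\alpha} x_1^{i-p}$; $\frac{\left(\left(i x_4+x_5\right) \alpha-\left(x_3+i x_2\right) \ln x_1\right)^{\alpha}}{x_1^{p-i}}$; $\frac{\left(x_3-i x_2\right)^{\alpha}}{x_1^{p+i}}$; $\frac{\left(\left(-i x_4+x_5\right) \alpha-\left(x_3-i x_2\right) \ln x_1\right)^{\alpha}}{x_1^{p+i}}$ on $x_1>0$, $x_3+i x_2\notin(-\infty,0]$, $\left(i x_4+x_5\right) \alpha-\left(x_3+i x_2\right) \ln x_1\notin(-\infty,0]$. **Nilradical $\mathfrak g_{3,1}+2\mathfrak g_1$: $[X_2,X_3]=X_1$.** - $\mathfrak g_{6,13}$ $(\left(\alpha+\beta\right) X_1,\ \alpha X_2,\ \beta X_3,\ X_4,\ h X_5)$. Parameters: $\alpha \ne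 0$. $\frac{x_4^{\alpha+\beta}}{x_1}$; $\frac{x_4^{h}}{x_5}$ on $x_1\ne0$, $x_4>0$, $x_5\ne0$. - $\mathfrak g_{6,14}$ $(\left(\alpha+\beta\right) X_1,\ \alpha X_2,\ \beta X_3,\ X_4,\ X_1+\left(\alpha+\beta\right) X_5)$. If $\alpha + \beta \ne 0$: $\frac{x_4^{\alpha+\beta}}{x_1}$; $x_1 \exp\left(\frac{-\left(\alpha+\beta\right) x_5}{x_1}\right)$ on $x_1\ne0$, $x_4>0$. If $\alpha + \beta = 0$: $x_1$; $x_4 \exp\left(\frac{-x_5}{x_1}\right)$ on $x_1\ne0$. - $\mathfrak g_{6,15}$ $(\left(1+h\right) X_1,\ X_2+X_4,\ h X_3+X_5,\ X_4,\ h X_5)$. $\frac{x_4^{1+h}}{x_1}$; $x_5 x_4^{-h}$ on $x_1\ne0$, $x_4>0$. - $\mathfrak g_{6,16}$ $(X_1,\ X_2+X_4,\ X_5,\ X_1+X_4,\ 0)$. $x_5$; $x_1 \exp\left(\frac{-x_4}{x_1}\right)$ on $x_1\ne0$. - $\mathfrak g_{6,17}$ $(\alpha X_1,\ \alpha X_2,\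 X_4,\ \varepsilon X_1,\ X_5)$. If $\alpha \varepsilon = 0$, $\alpha \ne 0$: $\frac{x_5^{\alpha}}{x_1}$; $\varepsilon x_1-\alpha x_4$ on $x_1\ne0$, $x_5>0$. If $\alpha = 0$, $\varepsilon \ne 0$: $\frac{x_5^{\alpha}}{x_1}$; $x_5 \exp\left(\frac{-x_4}{\varepsilon x_1}\right)$ on $x_1\ne0$, $x_5>0$. - $\mathfrak g_{6,18}$ $(\left(1+\alpha\right) X_1,\ \alpha X_2,\ X_3+X_4,\ X_4,\ \beta X_5)$. Parameters: $\beta \ne 0$. $\frac{x_4^{1+\alpha}}{x_1}$; $x_5 x_4^{-\beta}$ on $x_1\ne0$, $x_4>0$. - $\mathfrak g_{6,19}$ $(\left(1+\alpha\right) X_1,\ \alpha X_2,\ X_3+X_4,\ X_4,\ X_1+\left(\alpha+1\right) X_5)$. $\frac{x_4^{1+\alpha}}{x_1}$; $x_4 \exp\left(\frac{-x_5}{x_1}\right)$ on $x_1\ne0$, $x_4>0$. - $\mathfrak g_{6,20}$ $(X_1,\ 0,\ X_3+X_4,\ X_1+X_4,\ \beta X_5)$. Parameters: $\beta \ne 0$.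 $x_5 x_1^{-\beta}$; $x_1 \exp\left(\frac{-x_4}{x_1}\right)$ on $x_1>0$. - $\mathfrak g_{6,21}$ $(2 \alpha X_1,\ \alpha X_2+X_3,\ \alpha X_3,\ X_4,\ h X_5)$. Parameters: $h \ne 0$. $\frac{x_4^{2 \alpha}}{x_1}$; $x_5 x_4^{-h}$ on $x_1\ne0$, $x_4>0$. - $\mathfrak g_{6,22}$ $(2 \alpha X_1,\ \alpha X_2+X_3,\ \alpha X_3,\ X_4,\ X_1+2 \alpha X_5)$. $\frac{x_4^{2 \alpha}}{x_1}$; $x_4 \exp\left(\frac{-x_5}{x_1}\right)$ on $x_1\ne0$, $x_4>0$. - $\mathfrak g_{6,23}$ $(2 \alpha X_1,\ \alpha X_2+X_3,\ \alpha X_3+X_4,\ \alpha X_4,\ \varepsilon X_1+\left(2 \alpha+h\right) X_5)$. If $\varepsilon h = 0$, $h \ne 0$: $\frac{x_4^{2}}{x_1}$; $\frac{\left(h x_5+\varepsilon x_1\right)^{2 \alpha}}{x_1^{2 \alpha+h}}$ on $x_1>0$, $h x_5+\varepsilon x_1>0$. If $h = 0$, $\alpha \ne 0$: $\frac{x_4^{2}}{x_1}$;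 $\frac{2 \alpha x_5-\varepsilon x_1 \ln x_1}{x_1}$ on $x_1>0$. - $\mathfrak g_{6,24}$ $(0,\ X_3,\ X_4,\ h X_1,\ X_5)$. $x_1$; $x_5^{h} \exp\left(\frac{-x_4}{x_1}\right)$ on $x_1\ne0$, $x_5>0$. - $\mathfrak g_{6,25}$ $(\left(1+h\right) X_1,\ X_2,\ h X_3,\ \beta X_4+X_5,\ \beta X_5)$. If $h \ne -1$: $x_1^{-\beta} x_5^{1+h}$; $x_1 \exp\left(\frac{-\left(1+h\right) x_4}{x_5}\right)$ on $x_1>0$, $x_5>0$. If $h = -1$: $x_1$; $x_5 \exp\left(\frac{-\beta x_4}{x_5}\right)$ on $x_5\ne0$. - $\mathfrak g_{6,26}$ $(\left(1+h\right) X_1,\ X_2,\ h X_3,\ \left(1+h\right) X_4+X_5,\ X_1+\left(1+h\right) X_5)$. $\frac{2 x_1 x_4-x_5^{2}}{x_1^{2}}$; $x_1 \exp\left(\frac{-\left(1+h\right) x_5}{x_1}\right)$ on $x_1\ne0$. - $\mathfrak g_{6,27}$, $\mathfrak g_{6,29}$ $(\left(\alpha+\beta\right) X_1,\ \alpha X_2,\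 \beta X_3+X_4,\ \beta X_4+X_5,\ \varepsilon X_1+\beta X_5)$. If $\alpha \ne 0$, $\alpha + \beta \ne 0$: $\frac{\left(\alpha x_5-\varepsilon x_1\right)^{\alpha+\beta}}{x_1^{\beta}}$; $x_1^{\frac{-\alpha}{\alpha+\beta}} \exp\left(\frac{\alpha^{2} x_4-\varepsilon x_1}{\alpha x_5-\varepsilon x_1}\right)$ on $x_1>0$, $\alpha x_5-\varepsilon x_1>0$. If $\alpha \ne 0$, $\alpha + \beta = 0$: $x_1$; $\frac{\alpha x_5-\varepsilon x_1}{x_1} \exp\left(\frac{\alpha^{2} x_4-\varepsilon x_1}{\alpha x_5-\varepsilon x_1}\right)$ on $x_1\ne0$, $\alpha x_5-\varepsilon x_1\ne0$. If $\alpha = 0$, $\beta \ne 0$, $\varepsilon = 0$: $\frac{x_5}{x_1}$; $x_1 \exp\left(\frac{-\beta x_4}{x_5}\right)$ on $x_1\ne0$, $x_5\ne0$. If $\alpha = 0$, $\beta \ne 0$, $\varepsilon \ne 0$: $\frac{-2 \varepsilon x_1 x_4+x_5^{2}}{x_1^{2}}$; $x_1 \exp\left(\frac{-\beta x_5}{\varepsilon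 x_1}\right)$ on $x_1\ne0$. - $\mathfrak g_{6,28}$ $(2 X_1,\ X_2+X_3,\ X_3,\ \beta X_4+X_5,\ \beta X_5)$. $x_5^{2} x_1^{-\beta}$; $x_1 \exp\left(\frac{-2 x_4}{x_5}\right)$ on $x_1>0$, $x_5\ne0$. - $\mathfrak g_{6,30}$ $(0,\ X_3,\ 0,\ X_4+X_5,\ X_5)$. $x_1$; $x_5 \exp\left(\frac{-x_4}{x_5}\right)$ on $x_5\ne0$. - $\mathfrak g_{6,31}$ $(2 X_1,\ X_2+X_3,\ X_3+X_4,\ X_4+X_5,\ X_5)$. $\frac{x_5^{2}}{x_1}$; $x_1 \exp\left(\frac{-2 x_4}{x_5}\right)$ on $x_1\ne0$, $x_5\ne0$. - $\mathfrak g_{6,32}$ $(2 \alpha X_1,\ \alpha X_2+X_3,\ -X_2+\alpha X_3,\ \varepsilon X_1+\left(2 \alpha+h\right) X_4,\ \gamma X_5)$. If $\gamma < 2 \alpha + h$, $\varepsilon h = 0$, $h \ne 0$, $\gamma \ne 0$: $x_5^{2 \alpha} x_1^{-\gamma}$; $\left(h x_4+\varepsilon x_1\right)^{\gamma} x_5^{-\left(2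 \alpha+h\right)}$ on $x_1>0$, $x_5>0$, $h x_4+\varepsilon x_1>0$. If $\gamma < 2 \alpha + h$, $\varepsilon h = 0$, $h \ne 0$, $\gamma = 0$: $x_5$; $\left(h x_4+\varepsilon x_1\right)^{2 \alpha} x_1^{-\left(2 \alpha+h\right)}$ on $x_1>0$, $h x_4+\varepsilon x_1>0$. If $\gamma < 2 \alpha + h$, $h = 0$, $\gamma \ne 0$: $x_5^{2 \alpha} x_1^{-\gamma}$; $\frac{\gamma x_4-\varepsilon x_1 \ln x_5}{x_1}$ on $x_1>0$, $x_5>0$. If $\gamma < 2 \alpha + h$, $h = 0$, $\gamma = 0$: $x_5$; $\frac{2 \alpha x_4-\varepsilon x_1 \ln x_1}{x_1}$ on $x_1>0$. - $\mathfrak g_{6,33}$ $(2 \alpha X_1,\ \alpha X_2+X_3,\ -X_2+\alpha X_3,\ \beta X_4,\ X_1+2 \alpha X_5)$. If $\beta \le 2 \alpha$, $\alpha \ne 0$: $x_4^{2 \alpha} x_1^{-\beta}$; $x_1 \exp\left(\frac{-2 \alpha x_5}{x_1}\right)$ on $x_1>0$, $x_4>0$. If $\beta \le 2 \alpha$, $\alpha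 = 0$: $x_1$; $x_4 \exp\left(\frac{-\beta x_5}{x_1}\right)$ on $x_1\ne0$. - $\mathfrak g_{6,34}$ $(2 \alpha X_1,\ \alpha X_2+X_3,\ -X_2+\alpha X_3,\ \left(2 \alpha+h\right) X_4+X_5,\ \left(2 \alpha+h\right) X_5+\varepsilon X_1)$. If $\varepsilon = 0$, $\alpha \ne 0$: $x_5^{2 \alpha} x_1^{-\left(2 \alpha+h\right)}$; $x_1 \exp\left(\frac{-2 \alpha x_4}{x_5}\right)$ on $x_1>0$, $x_5>0$. If $\varepsilon = 0$, $\alpha = 0$: $x_1$; $x_5 \exp\left(\frac{-h x_4}{x_5}\right)$ on $x_5\ne0$. If $\varepsilon \ne 0$, $h = 0$: $\frac{-2 \varepsilon x_1 x_4+x_5^{2}}{x_1^{2}}$; $x_1 \exp\left(\frac{-2 \alpha x_5}{\varepsilon x_1}\right)$ on $x_1\ne0$. - $\mathfrak g_{6,35}$ $(\left(\alpha+\beta\right) X_1,\ \alpha X_2,\ \beta X_3,\ \gamma X_4+X_5,\ -X_4+\gamma X_5)$. Parameters: $\alpha ^2 + \beta ^2 \ne 0$. $\left(x_4^{2}+x_5^{2}\right)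 \left(\frac{x_4-ix_5}{x_4+ix_5}\right)^{i \gamma}$; $x_1 \exp\left(-\left(\alpha+\beta\right) \arctan\left(\frac{x_4}{x_5}\right)\right)$ on $x_4\ne0$, $x_5\ne0$. - $\mathfrak g_{6,36}$ $(2 \alpha X_1,\ \alpha X_2+X_3,\ \alpha X_3,\ \gamma X_4+X_5,\ -X_4+\gamma X_5)$. $\left(x_4^{2}+x_5^{2}\right) \left(\frac{x_4-ix_5}{x_4+ix_5}\right)^{i \gamma}$; $x_1 \exp\left(-2 \alpha \arctan\left(\frac{x_4}{x_5}\right)\right)$ on $x_4\ne0$, $x_5\ne0$. - $\mathfrak g_{6,37}$ $(2 \alpha X_1,\ \alpha X_2+X_3,\ -X_2+\alpha X_3,\ \beta X_4+s X_5,\ -s X_4+\beta X_5)$. Parameters: $s \ne 0$. $\left(x_4^{2}+x_5^{2}\right) \left(\frac{x_4-ix_5}{x_4+ix_5}\right)^{i \frac{\beta}{s}}$; $x_1 \exp\left(\frac{-2}{s} \alpha \arctan\left(\frac{x_4}{x_5}\right)\right)$ on $x_4\ne0$, $x_5\ne0$. - $\mathfrak g_{6,38}$ $(2 \alpha X_1,\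 \alpha X_2+X_3+X_4,\ -X_2+\alpha X_3+X_5,\ \alpha X_4+X_5,\ -X_4+\alpha X_5)$. $\left(x_4^{2}+x_5^{2}\right) \left(\frac{x_4-ix_5}{x_4+ix_5}\right)^{i \alpha}$; $x_1 \exp\left(-2 \alpha \arctan\left(\frac{x_4}{x_5}\right)\right)$ on $x_4\ne0$, $x_5\ne0$. **Nilradical $\mathfrak g_{4,1}+\mathfrak g_1$: $[X_1,X_5]=X_2$, $[X_4,X_5]=X_1$.** - $\mathfrak g_{6,39}$ $(\left(1+h\right) X_1,\ \left(2+h\right) X_2,\ \gamma X_3,\ h X_4,\ X_5)$. Parameters: $\gamma \ne 0$. $x_3^{2+h} x_2^{-\gamma}$; $\frac{x_1^{2}-2 x_2 x_4}{x_2 x_3^{\frac{h}{\gamma}}}$ on $x_2>0$, $x_3>0$. - $\mathfrak g_{6,40}$ $(\left(1+h\right) X_1,\ \left(2+h\right) X_2,\ X_2+\left(2+h\right) X_3,\ h X_4,\ X_5)$. $x_2 \exp\left(\frac{-\left(2+h\right) x_3}{x_2}\right)$; $\frac{x_1^{2}-2 x_2 x_4}{x_2} \exp\left(\frac{-h x_3}{x_2}\right)$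 on $x_2\ne0$. - $\mathfrak g_{6,41}$ $(\left(1+h\right) X_1,\ \left(2+h\right) X_2,\ h X_3,\ X_3+h X_4,\ X_5)$. If $h \ne -1$: $x_3^{2+h} x_2^{-h}$; $\frac{1}{x_2 x_3} \exp\left(\frac{\left(1+h\right) \left(2 x_2 x_4-x_1^{2}\right)}{x_2 x_3}\right)$ on $x_2>0$, $x_3>0$. If $h = -1$: $x_2 x_3$; $\frac{x_2}{x_3} \exp\left(\frac{-\left(2 x_2 x_4-x_1^{2}\right)}{x_2 x_3}\right)$ on $x_2\ne0$, $x_3\ne0$. - $\mathfrak g_{6,42}$ $(\left(1+h\right) X_1,\ \left(2+h\right) X_2,\ X_3,\ h X_4,\ X_3+X_5)$. $\frac{x_3^{2+h}}{x_2}$; $\frac{2 x_2 x_4-x_1^{2}}{x_2 x_3^{h}}$ on $x_2\ne0$, $x_3>0$. - $\mathfrak g_{6,43}$ $(0,\ X_2,\ X_2+X_3,\ -X_4,\ X_3+X_5)$. $x_1^{2}-2 x_2 x_4$; $x_2 \exp\left(\frac{-x_3}{x_2}\right)$ on $x_2\ne0$. - $\mathfrak g_{6,44}$ $(2 X_1,\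 3 X_2,\ \gamma X_3,\ X_4,\ X_4+X_5)$. $x_3^{3} x_2^{-\gamma}$; $\frac{\left(2 x_2 x_4-x_1^{2}\right)^{3}}{x_2^{4}}$ on $x_2>0$. - $\mathfrak g_{6,45}$ $(2 X_1,\ 3 X_2,\ X_2+3 X_3,\ X_4,\ X_4+X_5)$. $x_2 \exp\left(\frac{-3 x_3}{x_2}\right)$; $\frac{\left(2 x_2 x_4-x_1^{2}\right)^{3}}{x_2^{4}}$ on $x_2\ne0$. - $\mathfrak g_{6,46}$ $(2 X_1,\ 3 X_2,\ X_3,\ X_3+X_4,\ X_4+X_5)$. $x_3 \exp\left(\frac{x_1^{2}-2 x_2 x_4}{2 x_2 x_3}\right)$; $\frac{x_3^{3}}{x_2}$ on $x_2\ne0$, $x_3\ne0$. - $\mathfrak g_{6,47}$ $(X_1,\ X_2,\ \gamma X_3,\ \varepsilon X_2+X_4,\ 0)$. Parameters: $\gamma \ne 0$. $x_3 x_2^{-\gamma}$; $x_2^{\varepsilon} \exp\left(\frac{x_1^{2}-2 x_2 x_4}{2 x_2^{2}}\right)$ on $x_2>0$. - $\mathfrak g_{6,48}$ $(X_1,\ X_2,\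 X_2+X_3,\ X_4,\ 0)$. $x_2 \exp\left(\frac{-x_3}{x_2}\right)$; $\frac{2 x_2 x_4-x_1^{2}}{x_2^{2}}$ on $x_2\ne0$. - $\mathfrak g_{6,49}$ $(X_1,\ X_2,\ 0,\ \varepsilon X_2+X_4,\ X_3)$. $x_3$; $x_2^{\varepsilon} \exp\left(\frac{-2 x_2 x_4+x_1^{2}}{2 x_2^{2}}\right)$ on $x_2>0$. - $\mathfrak g_{6,50}$ $(X_1,\ X_2,\ \varepsilon X_2+X_3,\ X_3+X_4,\ 0)$. If $\varepsilon \ne 0$: $x_2^{\varepsilon} \exp\left(\frac{-x_3}{x_2}\right)$; $\frac{\varepsilon \left(x_1^{2}-2 x_2 x_4\right)+x_3^{2}}{x_2^{2}}$ on $x_2>0$. If $\varepsilon = 0$: $\frac{x_3}{x_2}$; $\frac{x_3}{x_2} \ln x_2+\frac{x_1^{2}-2 x_2 x_4}{2 x_2^{2}}$ on $x_2>0$. - $\mathfrak g_{6,51}$ $(0,\ 0,\ X_3,\ \varepsilon X_2,\ 0)$. $x_2$; $x_3^{\varepsilon} \exp\left(\frac{x_1^{2}-2 x_2 x_4}{2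 x_2^{2}}\right)$ on $x_2\ne0$, $x_3>0$. - $\mathfrak g_{6,52}$ $(0,\ 0,\ X_3,\ \varepsilon X_2,\ X_4)$. $x_2$; $x_3^{\varepsilon} \exp\left(\frac{x_1^{2}-2 x_2 x_4}{2 x_2^{2}}\right)$ on $x_2\ne0$, $x_3>0$. **Nilradical $\mathfrak g_{5,1}$: $[X_3,X_5]=X_1$, $[X_4,X_5]=X_2$.** - $\mathfrak g_{6,53}$ $(0,\ 0,\ X_3,\ X_4,\ -X_5)$. $x_1$; $x_2$ on $\mathbb R^6$. - $\mathfrak g_{6,54}$ $(X_1,\ \lambda X_2,\ \left(1-\gamma\right) X_3,\ \left(\lambda-\gamma\right) X_4,\ \gamma X_5)$. $x_2 x_1^{-\lambda}$; $\left(x_1 x_4-x_2 x_3\right) x_1^{-\left(\lambda+1-\gamma\right)}$ on $x_1>0$. - $\mathfrak g_{6,55}$ $(X_1,\ \left(1+\gamma\right) X_2,\ \left(1-\gamma\right) X_3,\ X_1+X_4,\ \gamma X_5)$. $x_2 x_1^{-\left(1+\gamma\right)}$; $x_1 \exp\left(\frac{x_2 x_3-x_1 x_4}{x_1^{2}}\right)$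 on $x_1>0$. - $\mathfrak g_{6,56}$ $(X_1,\ \left(1-\gamma\right) X_2,\ X_2+\left(1-\gamma\right) X_3,\ \left(1-2 \gamma\right) X_4,\ \gamma X_5)$. If $\gamma \ne 1$: $x_2 x_1^{-\left(1-\gamma\right)}$; $x_1^{\gamma-1} \exp\left(\frac{\left(1-\gamma\right) \left(x_2 x_3-x_1 x_4\right)}{x_2^{2}}\right)$ on $x_1>0$, $x_2\ne0$. If $\gamma = 1$: $x_2$; $\frac{1}{x_1} \exp\left(\frac{x_2 x_3-x_1 x_4}{x_2^{2}}\right)$ on $x_1\ne0$, $x_2\ne0$. - $\mathfrak g_{6,57}$ $(X_1,\ 2 \gamma X_2,\ \left(1-\gamma\right) X_3,\ \gamma X_4,\ X_4+\gamma X_5)$. $x_2 x_1^{-2 \gamma}$; $\frac{x_1 x_4-x_2 x_3}{x_1^{\gamma+1}}$ on $x_1>0$. - $\mathfrak g_{6,58}$ $(3 X_1,\ 2 X_2,\ X_2+2 X_3,\ X_4,\ \omega X_4+X_5)$. Parameters: $\omega\in\{0,1\}$. $\frac{x_2^{3}}{x_1^{2}}$; $\frac{\left(x_1 x_4-x_2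 x_3+\frac{1}{3} x_2^{2} \ln x_1\right)^{3}}{x_1^{4}}$ on $x_1>0$. - $\mathfrak g_{6,59}$ $(X_1,\ 0,\ X_3,\ X_2,\ h X_4)$. $x_2$; $x_1 \exp\left(\frac{-x_1 x_4+x_2 x_3}{x_1 x_2}\right)$ on $x_1\ne0$, $x_2\ne0$. - $\mathfrak g_{6,60}$ $(X_1,\ 2 X_2,\ 0,\ X_1+X_4,\ \omega X_4+X_5)$. Parameters: $\omega\in\{0,1\}$. $\frac{x_2}{x_1^{2}}$; $x_1 \exp\left(\frac{-x_1 x_4+x_2 x_3}{x_1^{2}}\right)$ on $x_1\ne0$. - $\mathfrak g_{6,61}$ $(2 X_1,\ 2 \lambda X_2,\ X_3,\ \left(2 \lambda-1\right) X_4,\ X_3+X_5)$. $x_2 x_1^{-\lambda}$; $\frac{x_1 x_4-x_2 x_3}{x_2 \sqrt{x_1}}$ on $x_1>0$, $x_2\ne0$. - $\mathfrak g_{6,62}$ $(2 X_1,\ X_2,\ X_2+X_3,\ 0,\ \omega X_3+X_5)$. Parameters: $\omega\in\{0,1\}$. $\frac{x_2^{2}}{x_1}$; $x_1 \exp\left(\frac{2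 \left(x_1 x_4-x_2 x_3\right)}{x_2^{2}}\right)$ on $x_1\ne0$, $x_2\ne0$. - $\mathfrak g_{6,63}$ $(X_1,\ \lambda X_2,\ X_3,\ X_2+\lambda X_4,\ 0)$. $x_2 x_1^{-\lambda}$; $x_1 \exp\left(\frac{-x_1 x_4+x_2 x_3}{x_1 x_2}\right)$ on $x_1>0$, $x_2\ne0$. - $\mathfrak g_{6,64}$ $(X_1,\ X_2,\ h X_2+X_3,\ X_1+X_4,\ 0)$. $\frac{x_2}{x_1}$; $\frac{x_2 x_3-x_1 x_4+\left(x_1^{2}-h x_2^{2}\right) \ln x_1}{x_1^{2}}$ on $x_1>0$. - $\mathfrak g_{6,65}$ $(\lambda X_1+X_2,\ \lambda X_2,\ \left(\lambda-\gamma\right) X_3+X_4,\ \left(\lambda-\gamma\right) X_4,\ \gamma X_5)$. Parameters: $\lambda \ne 0 $ or $ \gamma \ne 0$. $x_2 \exp\left(\frac{-\lambda x_1}{x_2}\right)$; $\left(x_1 x_4-x_2 x_3\right) \exp\left(\frac{\left(\gamma-2 \lambda\right) x_1}{x_2}\right)$ on $x_2\ne0$. - $\mathfrak g_{6,66}$ $(2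 X_1+X_2,\ 2 X_2,\ X_3+X_4,\ X_4,\ X_3+X_5)$. $x_2 \exp\left(\frac{-2 x_1}{x_2}\right)$; $\left(x_1 x_4-x_2 x_3\right) \exp\left(\frac{-3 x_1}{x_2}\right)$ on $x_2\ne0$. - $\mathfrak g_{6,67}$ $(2 X_1+X_2,\ 2 X_2,\ X_3+X_4,\ X_4,\ h X_4+X_5)$. $x_2 \exp\left(\frac{-2 x_1}{x_2}\right)$; $\left(x_1 x_4-x_2 x_3\right) \exp\left(\frac{-3 x_1}{x_2}\right)$ on $x_2\ne0$. - $\mathfrak g_{6,68}$ $(X_1+X_2,\ X_2,\ X_3+X_4,\ \gamma X_1+X_4,\ 0)$. $x_2 \exp\left(\frac{-x_1}{x_2}\right)$; $\frac{3 \left(x_1 x_4-x_2 x_3\right) x_2-\gamma x_1^{3}}{x_2^{3}}$ on $x_2\ne0$. - $\mathfrak g_{6,69}$ $(X_1+X_2,\ X_2,\ X_3+X_4,\ X_2+X_4,\ 0)$. $x_2 \exp\left(\frac{-x_1}{x_2}\right)$; $\frac{2 x_1 x_4-2 x_2 x_3-x_1^{2}-x_2^{2}}{2} \exp\left(\frac{-2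 x_1}{x_2}\right)$ on $x_2\ne0$. - $\mathfrak g_{6,70}$ $(p X_1+X_2,\ -X_1+p X_2,\ \left(p-\gamma\right) X_3+X_4,\ -X_3+\left(p-\gamma\right) X_4,\ \gamma X_5)$. $\left(x_1^{2}+x_2^{2}\right) \left(\frac{x_2+ix_1}{x_2-ix_1}\right)^{i p}$; $\frac{x_1 x_4-x_2 x_3}{2} \exp\left(\left(\gamma-2 p\right) \arctan\left(\frac{x_1}{x_2}\right)\right)$ on $x_2\ne0$. **Nilradical $\mathfrak g_{5,2}$: $[X_2,X_5]=X_1$, $[X_3,X_5]=X_2$, $[X_4,X_5]=X_3$.** - $\mathfrak g_{6,71}$ $(\left(h+3\right) X_1,\ \left(h+2\right) X_2,\ \left(h+1\right) X_3,\ h X_4,\ X_5)$. If $h \ne -1$: $\frac{\left(3 x_1^{2} x_4+x_2^{3}-3 x_1 x_2 x_3\right)^{h+1}}{x_1^{h+2} \left(2 x_1 x_3-x_2^{2}\right)^{h}}$; $\left(2 x_3-\frac{x_2^{2}}{x_1}\right)^{h+3} x_1^{-\left(h+1\right)}$ on $x_1>0$, $2 x_1 x_3-x_2^{2}>0$, $3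 x_1^{2} x_4+x_2^{3}-3 x_1 x_2 x_3>0$. If $h = -1$: $\frac{\left(3 x_1^{2} x_4+x_2^{3}-3 x_1 x_2 x_3\right)^{2}}{x_1^{3}}$; $2 x_3-\frac{x_2^{2}}{x_1}$ on $x_1\ne0$. - $\mathfrak g_{6,72}$ $(4 X_1,\ 3 X_2,\ 2 X_3,\ X_4,\ X_4+X_5)$. $\frac{\left(3 x_1^{2} x_4+x_2^{3}-3 x_1 x_2 x_3\right)^{4}}{x_1^{9}}$; $\frac{\left(-2 x_1 x_3+x_2^{2}\right)^{2}}{x_1^{3}}$ on $x_1\ne0$. - $\mathfrak g_{6,73}$ $(X_1,\ X_2,\ \varepsilon X_1+X_3,\ \varepsilon X_2+X_4,\ 0)$. Parameters: $\varepsilon=\pm1$. $\frac{3 x_1^{2} x_4+x_2^{3}-3 x_1 x_2 x_3}{x_1^{3}}$; $x_1^{\varepsilon} \exp\left(\frac{-2 x_1 x_3+x_2^{2}}{2 x_1^{2}}\right)$ on $x_1>0$. - $\mathfrak g_{6,74}$ $(X_1,\ X_2,\ X_3,\ X_4,\ 0)$. $\frac{3 x_1^{2} x_4+x_2^{3}-3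 x_1 x_2 x_3}{x_1^{3}}$; $\frac{2 x_1 x_3-x_2^{2}}{x_1^{2}}$ on $x_1\ne0$. - $\mathfrak g_{6,75}$ $(X_1,\ X_2,\ X_3,\ X_1+X_4,\ 0)$. $x_1 \exp\left(\frac{-3 x_1^{2} x_4-x_2^{3}+3 x_1 x_2 x_3}{3 x_1^{3}}\right)$; $\frac{2 x_1 x_3-x_2^{2}}{x_1^{2}}$ on $x_1\ne0$. **Nilradical $\mathfrak g_{5,3}$: $[X_2,X_4]=X_3$, $[X_2,X_5]=X_1$, $[X_4,X_5]=X_2$.** - $\mathfrak g_{6,76}$ $(\left(2 h+1\right) X_1,\ \left(h+1\right) X_2,\ \left(h+2\right) X_3,\ X_4,\ h X_5)$. If $2 h + 1 \ne 0$: $x_3^{2 h+1} x_1^{-\left(h+2\right)}$; $\frac{2 x_3 x_5+x_2^{2}-2 x_1 x_4}{x_3 x_1^{\frac{h}{2 h+1}}}$ on $x_1>0$, $x_3>0$. If $2 h + 1 = 0$: $x_1$; $\frac{\left(2 x_3 x_5+x_2^{2}-2 x_1 x_4\right)^{3}}{x_3^{2}}$ on $x_3\ne0$. - $\mathfrak g_{6,77}$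 $(X_1,\ X_2,\ 2 X_3,\ \varepsilon X_1+X_4,\ 0)$. Parameters: $\varepsilon=\pm1$. $x_1^{\varepsilon} \exp\left(\frac{2 x_3 x_5+x_2^{2}-2 x_1 x_4}{2 x_1^{2}}\right)$; $\frac{x_3}{x_1^{2}}$ on $x_1>0$. - $\mathfrak g_{6,78}$ $(-X_1,\ 0,\ X_3,\ X_3+X_4,\ -X_5)$. $x_1 \exp\left(\frac{2 \left(x_1 x_4-x_3 x_5\right)-x_2^{2}}{2 x_1 x_3}\right)$; $x_1 x_3$ on $x_1\ne0$, $x_3\ne0$. - $\mathfrak g_{6,79}$ $(3 X_1,\ 2 X_2,\ X_1+3 X_3,\ X_4+X_5,\ X_5)$. $x_1 \exp\left(\frac{-3 x_3}{x_1}\right)$; $\frac{\left(2 \left(x_1 x_4-x_3 x_5\right)-x_2^{2}\right)^{3}}{x_1^{4}}$ on $x_1\ne0$. - $\mathfrak g_{6,80}$ $(2 X_1,\ X_2,\ X_3,\ 0,\ X_5)$. $\frac{x_3^{2}}{x_1}$; $\frac{2 x_3 x_5+x_2^{2}-2 x_1 x_4}{x_1}$ on $x_1\ne0$. - $\mathfrak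 g_{6,81}$ $(2 X_1,\ X_2,\ X_3,\ 0,\ \varepsilon X_3+X_5)$. Parameters: $\varepsilon=\pm1$. $\frac{x_3^{2}}{x_1}$; $x_1^{\varepsilon} \exp\left(\frac{2 x_1 x_4-2 x_3 x_5-x_2^{2}}{x_3^{2}}\right)$ on $x_1>0$, $x_3\ne0$. **Nilradical $\mathfrak g_{5,4}$: $[X_2,X_4]=X_1$, $[X_3,X_5]=X_1$ (for $\mathfrak g_{6,92}^*$ in another numbering of the basis: $[X_2,X_4]=X_5$, $[X_1,X_3]=X_5$).** - $\mathfrak g_{6,82}$ $(2 X_1,\ \left(\lambda+1\right) X_2,\ \left(\lambda_1+1\right) X_3,\ \left(-\lambda+1\right) X_4,\ \left(-\lambda_1+1\right) X_5)$. None. - $\mathfrak g_{6,82}$ $(0,\ \lambda X_2,\ \lambda_1 X_3,\ -\lambda X_4,\ -\lambda_1 X_5)$. Parameters: $\lambda \ne 0 $ or $ \lambda_1 \ne 0$. $x_1$; $\lambda x_2 x_4+\lambda_1 x_3 x_5-x_1 x_6$ on $\mathbb R^6$. - $\mathfrak g_{6,83}$ $(\alpha X_1,\ \left(\frac{\alpha}{2}+\lambda\right)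 X_2+X_3,\ \left(\frac{\alpha}{2}+\lambda\right) X_3,\ \left(\frac{\alpha}{2}-\lambda\right) X_4,\ -X_4+\left(\frac{\alpha}{2}-\lambda\right) X_5)$. Parameters: $\alpha \ne 0$. None. - $\mathfrak g_{6,83}$ $(0,\ \lambda X_2+X_3,\ \lambda X_3,\ -\lambda X_4,\ -X_4-\lambda X_5)$. Parameters: $\lambda \ne 0$. $x_1$; $\lambda \left(x_2 x_4+x_3 x_5\right)+x_3 x_4-x_1 x_6$ on $\mathbb R^6$. - $\mathfrak g_{6,84}$ $(0,\ X_2,\ 0,\ -X_4,\ X_3)$. $x_1$; $2 x_1 x_6+x_3^{2}-2 x_2 x_4$ on $\mathbb R^6$. - $\mathfrak g_{6,85}$ $(2 X_1,\ \left(1+\lambda\right) X_2,\ X_3,\ \left(1-\lambda\right) X_4,\ X_3+X_5)$. None. - $\mathfrak g_{6,86}$ $(2 X_1,\ X_2+X_3,\ X_3,\ X_4,\ -X_4+X_5)$. None. - $\mathfrak g_{6,87}$ $(2 X_1,\ X_2+X_5,\ X_3+X_4,\ X_4,\ X_3+X_5)$. None. - $\mathfrak g_{6,88}$ $(\alpha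 X_1,\ \left(\frac{\alpha}{2}+\mu_0\right) X_2+\nu_0 X_3,\ -\nu_0 X_2+\left(\frac{\alpha}{2}+\mu_0\right) X_3,\ \left(\frac{\alpha}{2}-\mu_0\right) X_4+\nu_0 X_5,\ -\nu_0 X_4+\left(\frac{\alpha}{2}-\mu_0\right) X_5)$. Parameters: $\alpha \ne 0$. None. - $\mathfrak g_{6,88}$ $(0,\ \mu_0 X_2+\nu_0 X_3,\ -\nu_0 X_2+\mu_0 X_3,\ -\mu_0 X_4+\nu_0 X_5,\ -\nu_0 X_4-\mu_0 X_5)$. Parameters: $\mu_0 \ne 0 $ or $ \nu_0 \ne 0$. $x_1$; $\mu_0 \left(x_2 x_4+x_3 x_5\right)+\nu_0 \left(x_3 x_4-x_2 x_5\right)-x_1 x_6$ on $\mathbb R^6$. - $\mathfrak g_{6,89}$ $(\alpha X_1,\ \left(\frac{\alpha}{2}+s\right) X_2,\ \nu_0 X_5+\frac{\alpha}{2} X_3,\ \left(\frac{\alpha}{2}-s\right) X_4,\ -\nu_0 X_3+\frac{\alpha}{2} X_5)$. Parameters: $\alpha \ne 0$. None. - $\mathfrak g_{6,89}$ $(0,\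 s X_2,\ \nu_0 X_5,\ -s X_4,\ -\nu_0 X_3)$. Parameters: $\nu_0 \ne 0 $ or $ s \ne 0$. $x_1$; $\frac{2 x_1 x_6-2 s x_2 x_4-\nu_0 \left(x_3^{2}+x_5^{2}\right)}{2}$ on $\mathbb R^6$. - $\mathfrak g_{6,90}$ $(\alpha X_1,\ \frac{\alpha}{2} X_2+X_4,\ \frac{\alpha}{2} X_3+\nu_0 X_5,\ X_2+\frac{\alpha}{2} X_4,\ -\nu_0 X_3+\frac{\alpha}{2} X_5)$. Parameters: $\alpha \ne 0$. None. - $\mathfrak g_{6,90}$ $(0,\ X_4,\ \nu_0 X_5,\ X_2,\ -\nu_0 X_3)$. Parameters: $\nu_0 \ne 1$. $x_1$; $\frac{2 x_1 x_6+x_2^{2}-x_4^{2}-\nu_0 \left(x_3^{2}+x_5^{2}\right)}{2}$ on $\mathbb R^6$. - $\mathfrak g_{6,91}$ $(0,\ X_4,\ X_5,\ X_2,\ -X_3)$. $x_1$; $\frac{2 x_1 x_6+x_2^{2}-x_4^{2}-\left(x_3^{2}+x_5^{2}\right)}{2}$ on $\mathbb R^6$. - $\mathfrak g_{6,92}$ $(\alpha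 X_1,\ \frac{\alpha}{2} X_2+\nu_0 X_3,\ -\mu_0 X_2+\frac{\alpha}{2} X_3,\ \mu_0 X_5+\frac{\alpha}{2} X_4,\ -\nu_0 X_4+\frac{\alpha}{2} X_5)$. Parameters: $\alpha \ne 0$. None. - $\mathfrak g_{6,92}$ $(0,\ \nu_0 X_3,\ -\mu_0 X_2,\ \mu_0 X_5,\ -\nu_0 X_4)$. Parameters: $\mu_0 \nu_0 \ne 0$. $x_1$; $-x_1 x_6-\mu_0 x_2 x_5+\nu_0 x_3 x_4$ on $\mathbb R^6$. - $\mathfrak g_{6,92}^*$ $(p X_1+X_3,\ p X_2+X_4,\ -X_1+p X_3,\ -X_2+p X_4,\ 2 p X_5)$. Parameters: $p \ne 0$. None. - $\mathfrak g_{6,92}^*$ $(X_3,\ X_4,\ -X_1,\ -X_2,\ 0)$. $x_5$; $x_1^{2}+x_2^{2}+x_3^{2}+x_4^{2}-2 x_5 x_6$ on $\mathbb R^6$. - $\mathfrak g_{6,93}$ $(\alpha X_1,\ \frac{\alpha}{2} X_2+X_4+\nu_0 X_5,\ \nu_0 X_4+\frac{\alpha}{2} X_3,\ X_2-\nu_0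 X_3+\frac{\alpha}{2} X_4,\ -\nu_0 X_2+\frac{\alpha}{2} X_5)$. Parameters: $\alpha \ne 0$. None. - $\mathfrak g_{6,93}$ $(0,\ X_4+\nu_0 X_5,\ \nu_0 X_4,\ X_2-\nu_0 X_3,\ -\nu_0 X_2)$. $x_1$; $\frac{-2 x_1 x_6+2 \nu_0 \left(x_2 x_3+x_4 x_5\right)-x_2^{2}+x_4^{2}}{2}$ on $\mathbb R^6$. **Nilradical $\mathfrak g_{5,5}$: $[X_3,X_4]=X_1$, $[X_2,X_5]=X_1$, $[X_3,X_5]=X_2$.** - $\mathfrak g_{6,94}$ $(\left(\lambda+2\right) X_1,\ \left(\lambda+1\right) X_2,\ \lambda X_3,\ 2 X_4,\ X_5)$. Parameters: $\lambda + 2 \ne 0$. None. - $\mathfrak g_{6,94}$ $(0,\ -X_2,\ -2 X_3,\ 2 X_4,\ X_5)$. $x_1$; $\frac{x_1^{2} x_6+x_1 x_2 x_5+2 x_1 x_3 x_4-x_2^{2} x_4}{2}$ on $\mathbb R^6$. - $\mathfrak g_{6,95}$ $(2 X_1,\ X_2,\ 0,\ X_1+2 X_4,\ X_5)$. None. - $\mathfrak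 g_{6,96}$ $(3 X_1,\ 2 X_2,\ X_3,\ X_2+2 X_4,\ X_3+X_5)$. None. - $\mathfrak g_{6,97}$ $(4 X_1,\ 3 X_2,\ 2 X_3+X_4,\ 2 X_4,\ X_5)$. None. - $\mathfrak g_{6,98}$ $(X_1,\ h X_1+X_2,\ X_3,\ 0,\ h X_4)$. None. **Nilradical $\mathfrak g_{5,6}$: $[X_3,X_4]=X_1$, $[X_2,X_5]=X_1$, $[X_3,X_5]=X_2$, $[X_4,X_5]=X_3$.** - $\mathfrak g_{6,99}$ $(5 X_1,\ 4 X_2,\ 3 X_3,\ 2 X_4,\ X_5)$. None. -/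

import Mathlib

set_option linter.unusedVariables false

namespace Coadjoint

section

open scoped ContDiff

/-! ### Brackets, the operators of the coadjoint representation, fundamental sets -/

/-- The entry `(i, j, v)` records the bracket `[X_i, X_j] = v`, with `i` and `j` counted from `1`
and `v` the coordinate vector of the right-hand side in the basis `X_1, ..., X_6`. -/
abbrev Bracket := ℕ × ℕ × (Fin 6 → ℝ)

/-- `structConst b i j k` is the coefficient of `X_(k+1)` in `[X_(i+1), X_(j+1)]` for the
skew-symmetric multiplication whose non-zero brackets are those listed in `b`. -/
def structConst (b : List Bracket) (i j : Fin 6) : Fin 6 → ℝ :=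
  (b.map fun t =>
    if t.1 = i.val + 1 ∧ t.2.1 = j.val + 1 then t.2.2
    else if t.1 = j.val + 1 ∧ t.2.1 = i.val + 1 then -t.2.2
    else 0).sum

/-- The ideal `N` is the largest nilpotent ideal of `L`. -/
def IsNilradical {L : Type*} [LieRing L] [LieAlgebra ℝ L] (N : LieIdeal ℝ L) : Prop :=
  LieRing.IsNilpotent N ∧ ∀ J : LieIdeal ℝ L, LieRing.IsNilpotent J → J ≤ N

/-- The brackets `b` define a Lie algebra (that is, they satisfy the Jacobi identity), which is
solvable and has the span of `X_1, ..., X_5` as its nilradical. -/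
def IsSolvableWithNilradical (b : List Bracket) : Prop :=
  ∃ (L : Type) (_ : LieRing L) (_ : LieAlgebra ℝ L) (X : Module.Basis (Fin 6) ℝ L),
    (∀ i j, ⁅X i, X j⁆ = ∑ k, structConst b i j k • X k) ∧
    LieAlgebra.IsSolvable L ∧
    ∃ N : LieIdeal ℝ L, IsNilradical N ∧
      N.toSubmodule = Submodule.span ℝ (Set.range fun i : Fin 5 => X i.castSucc)

variable {𝕜 : Type} [RCLike 𝕜]

/-- The operator `X̂_i = - ∑_{j,k} C_{ij}^k x_k ∂/∂x_j` on functions of `x_1, ..., x_6`. -/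
noncomputable def coadjointOp (c : Fin 6 → Fin 6 → Fin 6 → ℝ) (i : Fin 6)
    (F : (Fin 6 → ℝ) → 𝕜) (x : Fin 6 → ℝ) : 𝕜 :=
  -∑ j, (∑ k, c i j k * x k) • fderiv ℝ F x (Pi.single j 1)

/-- `F` is smooth on `U` and solves there the system `X̂_i F = 0`, `1 ≤ i ≤ 6`. -/
def IsInvariantOn (c : Fin 6 → Fin 6 → Fin 6 → ℝ) (U : Set (Fin 6 → ℝ))
    (F : (Fin 6 → ℝ) → 𝕜) : Prop :=
  ContDiffOn ℝ ∞ F U ∧ ∀ x ∈ U, ∀ i, coadjointOp c i F x = 0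

/-- Functional independence on the open set `U`: the differentials are linearly independent at the
points of a dense subset of `U`. -/
def FunctionallyIndependentOn {r : ℕ} (U : Set (Fin 6 → ℝ))
    (I : Fin r → (Fin 6 → ℝ) → 𝕜) : Prop :=
  U ⊆ closure {x | x ∈ U ∧ LinearIndependent 𝕜 fun n => fderiv ℝ (I n) x}

/-- `I_1, ..., I_r` is a maximal set of functionally independent invariants on the nonempty open
set `U`: no invariant, on any nonempty open subset of `U`, is functionally independent of them. -/
def IsFundamentalSetOn {r : ℕ} (c : Fin 6 → Fin 6 → Fin 6 → ℝ) (U : Set (Fin 6 → ℝ))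
    (I : Fin r → (Fin 6 → ℝ) → 𝕜) : Prop :=
  IsOpen U ∧ U.Nonempty ∧ (∀ n, IsInvariantOn c U (I n)) ∧ FunctionallyIndependentOn U I ∧
    ∀ V ⊆ U, IsOpen V → V.Nonempty → ∀ F : (Fin 6 → ℝ) → 𝕜, IsInvariantOn c V F →
      ¬ FunctionallyIndependentOn V (Fin.cons F I : Fin (r + 1) → (Fin 6 → ℝ) → 𝕜)

/-- A list of `r` functions of `x_1, ..., x_6`, preceded by the condition on `x_1, ..., x_6` that
describes their domain. -/
abbrev Functions (𝕜 : Type) (r : ℕ) :=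
  ℝ → ℝ → ℝ → ℝ → ℝ → ℝ → Prop × (Fin r → 𝕜)

/-- The domain of a list of functions. -/
def Functions.dom {r : ℕ} (f : Functions 𝕜 r) : Set (Fin 6 → ℝ) :=
  {x | (f (x 0) (x 1) (x 2) (x 3) (x 4) (x 5)).1}

/-- The members of a list of functions. -/
def Functions.fn {r : ℕ} (f : Functions 𝕜 r) (n : Fin r) (x : Fin 6 → ℝ) : 𝕜 :=
  (f (x 0) (x 1) (x 2) (x 3) (x 4) (x 5)).2 n

end

section

open Real (exp log arctan)

/-! ### The nilradicals -/

abbrev X₁ : Fin 6 → ℝ := ![1, 0, 0, 0, 0, 0]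
abbrev X₂ : Fin 6 → ℝ := ![0, 1, 0, 0, 0, 0]
abbrev X₃ : Fin 6 → ℝ := ![0, 0, 1, 0, 0, 0]
abbrev X₄ : Fin 6 → ℝ := ![0, 0, 0, 1, 0, 0]
abbrev X₅ : Fin 6 → ℝ := ![0, 0, 0, 0, 1, 0]

/-- The abelian algebra `5g_1`. -/
def n5g1 : List Bracket := []
/-- `g_{3,1} + 2g_1`. -/
def n31 : List Bracket := [(2, 3, X₁)]
/-- `g_{4,1} + g_1`. -/
def n41 : List Bracket := [(1, 5, X₂), (4, 5, X₁)]
/-- `g_{5,1}`. -/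
def n51 : List Bracket := [(3, 5, X₁), (4, 5, X₂)]
/-- `g_{5,2}`. -/
def n52 : List Bracket := [(2, 5, X₁), (3, 5, X₂), (4, 5, X₃)]
/-- `g_{5,3}`. -/
def n53 : List Bracket := [(2, 4, X₃), (2, 5, X₁), (4, 5, X₂)]
/-- `g_{5,4}`. -/
def n54 : List Bracket := [(2, 4, X₁), (3, 5, X₁)]
/-- `g_{5,4}` with its basis numbered in another way. -/
def n54' : List Bracket := [(2, 4, X₅), (1, 3, X₅)]
/-- `g_{5,5}`. -/
def n55 : List Bracket := [(3, 4, X₁), (2, 5, X₁), (3, 5, X₂)]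
/-- `g_{5,6}`. -/
def n56 : List Bracket := [(3, 4, X₁), (2, 5, X₁), (3, 5, X₂), (4, 5, X₃)]

/-- The brackets `[X_i, X_6] = a_i` for `1 ≤ i ≤ 5`. -/
def act (a₁ a₂ a₃ a₄ a₅ : Fin 6 → ℝ) : List Bracket :=
  [(1, 6, a₁), (2, 6, a₂), (3, 6, a₃), (4, 6, a₄), (5, 6, a₅)]

/-- `((u + i v) / (u - i v)) ^ (i p)`. The base has modulus one, so this power is a real number. -/
noncomputable def unitPow (u v p : ℝ) : ℝ :=
  ((((u : ℂ) + Complex.I * v) / ((u : ℂ) - Complex.I * v)) ^ (Complex.I * (p : ℂ))).re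

/-! ### The tables -/

/-- `Row b r f` holds if the algebra with brackets `b` is one of the algebras `g_{6,1}`, ...,
`g_{6,99}`, other than `g_{6,12}`, and `f` lists its `r` invariants together with their domain.
The name of a constructor gives the number of the algebra; a letter after it distinguishes ranges
of the parameters. -/
inductive Row : List Bracket → (r : ℕ) → Functions ℝ r → Prop
  -- nilradical 5g_1
  | g1 (α β γ δ : ℝ)
      (hyp : 0 < |δ| ∧ |δ| ≤ |γ| ∧ |γ| ≤ |β| ∧ |β| ≤ |α| ∧ |α| ≤ 1) :
      Row (n5g1 ++ act X₁ (α • X₂) (β • X₃) (γ • X₄) (δ • X₅)) 4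
        fun x₁ x₂ x₃ x₄ x₅ x₆ => (0 < x₁,
          ![x₂ * x₁ ^ (-α), x₃ * x₁ ^ (-β), x₄ * x₁ ^ (-γ), x₅ * x₁ ^ (-δ)])
  | g2 (α γ δ : ℝ) (hyp : 0 < |δ| ∧ |δ| ≤ |γ| ∧ |γ| ≤ 1) :
      Row (n5g1 ++ act (α • X₁) (X₁ + α • X₂) X₃ (γ • X₄) (δ • X₅)) 4
        fun x₁ x₂ x₃ x₄ x₅ x₆ => (x₁ ≠ 0,
          ![x₁ * exp (-α * x₂ / x₁), x₃ * exp (-x₂ / x₁),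
            x₄ * exp (-γ * x₂ / x₁), x₅ * exp (-δ * x₂ / x₁)])
  | g3 (α δ : ℝ) (hyp : 0 < |δ| ∧ |δ| ≤ 1) :
      Row (n5g1 ++ act (α • X₁) (X₁ + α • X₂) (X₂ + α • X₃) X₄ (δ • X₅)) 4
        fun x₁ x₂ x₃ x₄ x₅ x₆ => (x₁ ≠ 0,
          ![x₁ * exp (-α * x₂ / x₁), (2 * x₁ * x₃ - x₂ ^ 2) / x₁ ^ 2,
            x₄ * exp (-x₂ / x₁), x₅ * exp (-δ * x₂ / x₁)])
  | g4 (α : ℝ) :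
      Row (n5g1 ++ act (α • X₁) (X₁ + α • X₂) (X₂ + α • X₃) (X₃ + α • X₄) X₅) 4
        fun x₁ x₂ x₃ x₄ x₅ x₆ => (x₁ ≠ 0,
          ![x₁ * exp (-α * x₂ / x₁), (2 * x₁ * x₃ - x₂ ^ 2) / x₁ ^ 2,
            (3 * x₁ ^ 2 * x₄ + x₂ ^ 3 - 3 * x₁ * x₂ * x₃) / x₁ ^ 3, x₅ * exp (-x₂ / x₁)])
  | g5 :
      Row (n5g1 ++ act X₁ (X₁ + X₂) (X₂ + X₃) (X₃ + X₄) (X₄ + X₅)) 4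
        fun x₁ x₂ x₃ x₄ x₅ x₆ => (x₁ ≠ 0,
          ![x₁ * exp (-x₂ / x₁), (2 * x₁ * x₃ - x₂ ^ 2) / x₁ ^ 2,
            (3 * x₁ ^ 2 * x₄ + x₂ ^ 3 - 3 * x₁ * x₂ * x₃) / x₁ ^ 3,
            (x₂ ^ 4 - 8 * x₁ ^ 3 * x₅ - 4 * x₁ * x₂ ^ 2 * x₃ + 8 * x₁ ^ 2 * x₂ * x₄) / x₁ ^ 4])
  | g6 (α β : ℝ) (hyp : α ≤ β) :
      Row (n5g1 ++ act X₁ (α • X₂) (X₂ + α • X₃) (β • X₄) (X₄ + β • X₅)) 4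
        fun x₁ x₂ x₃ x₄ x₅ x₆ => (0 < x₁ ∧ x₂ ≠ 0 ∧ x₄ ≠ 0,
          ![x₂ * x₁ ^ (-α), x₁ * exp (-x₃ / x₂), x₄ * x₁ ^ (-β), x₁ * exp (-x₅ / x₄)])
  | g7 (α β : ℝ) (hyp : α ^ 2 + β ^ 2 ≠ 0) :
      Row (n5g1 ++ act (α • X₁) (X₁ + α • X₂) (X₂ + α • X₃) (β • X₄) (X₄ + β • X₅)) 4
        fun x₁ x₂ x₃ x₄ x₅ x₆ => (x₁ ≠ 0,
          ![x₁ * exp (-α * x₂ / x₁), (2 * x₁ * x₃ - x₂ ^ 2) / x₁ ^ 2,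
            (x₁ * x₅ - x₂ * x₄) / x₁ * exp (-β * x₂ / x₁), x₄ * exp (-β * x₂ / x₁)])
  | g8 (α β γ p : ℝ) (hyp : 0 < |γ| ∧ |γ| ≤ |β| ∧ |β| ≤ |α|) :
      Row (n5g1 ++ act (α • X₁) (β • X₂) (γ • X₃) (p • X₄ - X₅) (X₄ + p • X₅)) 4
        fun x₁ x₂ x₃ x₄ x₅ x₆ => (x₄ ≠ 0 ∧ x₅ ≠ 0,
          ![(x₄ ^ 2 + x₅ ^ 2) * unitPow x₄ x₅ p, x₁ * exp (α * arctan (x₄ / x₅)),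
            x₂ * exp (β * arctan (x₄ / x₅)), x₃ * exp (γ * arctan (x₄ / x₅))])
  | g9 (α β p : ℝ) (hyp : α ≠ 0) :
      Row (n5g1 ++ act (α • X₁) (β • X₂) (X₂ + β • X₃) (p • X₄ - X₅) (X₄ + p • X₅)) 4
        fun x₁ x₂ x₃ x₄ x₅ x₆ => (x₄ ≠ 0 ∧ x₅ ≠ 0,
          ![(x₄ ^ 2 + x₅ ^ 2) * unitPow x₄ x₅ p, x₁ * exp (α * arctan (x₄ / x₅)),
            x₂ * exp (β * arctan (x₄ / x₅)),
            (x₃ + x₂ * arctan (x₄ / x₅)) * exp (β * arctan (x₄ / x₅))])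
  | g10 (α p : ℝ) :
      Row (n5g1 ++ act (α • X₁) (X₁ + α • X₂) (X₂ + α • X₃) (p • X₄ - X₅) (X₄ + p • X₅)) 4
        fun x₁ x₂ x₃ x₄ x₅ x₆ => (x₁ ≠ 0 ∧ x₄ ≠ 0 ∧ x₅ ≠ 0,
          ![(x₄ ^ 2 + x₅ ^ 2) * unitPow x₄ x₅ p, x₁ * exp (α * arctan (x₄ / x₅)),
            (x₂ + x₁ * arctan (x₄ / x₅)) * exp (α * arctan (x₄ / x₅)),
            (2 * x₃ * x₁ - x₂ ^ 2) / x₁ ^ 2])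
  | g11a (α p q s : ℝ) (hyp : α * s ≠ 0 ∧ p * q ≠ 0) :
      Row (n5g1 ++ act (α • X₁) (p • X₂ - X₃) (X₂ + p • X₃) (q • X₄ - s • X₅)
          (s • X₄ + q • X₅)) 4
        fun x₁ x₂ x₃ x₄ x₅ x₆ => (0 < x₁ ∧ x₂ ≠ 0 ∧ x₄ ≠ 0,
          ![(x₂ ^ 2 + x₃ ^ 2) * unitPow x₂ x₃ p, (x₄ ^ 2 + x₅ ^ 2) * unitPow x₄ x₅ (q / s),
            (x₂ ^ 2 + x₃ ^ 2) ^ α * x₁ ^ (-2 * p), (x₄ ^ 2 + x₅ ^ 2) ^ α * x₁ ^ (-2 * q)])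
  | g11b (α p q s : ℝ) (hyp : α * s ≠ 0 ∧ p * q = 0) :
      Row (n5g1 ++ act (α • X₁) (p • X₂ - X₃) (X₂ + p • X₃) (q • X₄ - s • X₅)
          (s • X₄ + q • X₅)) 4
        fun x₁ x₂ x₃ x₄ x₅ x₆ => (x₂ ≠ 0 ∧ x₃ ≠ 0 ∧ x₄ ≠ 0 ∧ x₅ ≠ 0,
          ![(x₂ ^ 2 + x₃ ^ 2) * unitPow x₂ x₃ p, (x₄ ^ 2 + x₅ ^ 2) * unitPow x₄ x₅ (q / s),
            x₁ * exp (α * arctan (x₂ / x₃)), x₁ * exp (α / s * arctan (x₄ / x₅))])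
  -- nilradical g_{3,1} + 2g_1
  | g13 (α β h : ℝ) (hyp : α ≠ 0) :
      Row (n31 ++ act ((α + β) • X₁) (α • X₂) (β • X₃) X₄ (h • X₅)) 2
        fun x₁ x₂ x₃ x₄ x₅ x₆ => (x₁ ≠ 0 ∧ 0 < x₄ ∧ x₅ ≠ 0,
          ![x₄ ^ (α + β) / x₁, x₄ ^ h / x₅])
  | g14a (α β : ℝ) (hyp : α + β ≠ 0) :
      Row (n31 ++ act ((α + β) • X₁) (α • X₂) (β • X₃) X₄ (X₁ + (α + β) • X₅)) 2
        fun x₁ x₂ x₃ x₄ x₅ x₆ => (x₁ ≠ 0 ∧ 0 < x₄,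
          ![x₄ ^ (α + β) / x₁, x₁ * exp (-(α + β) * x₅ / x₁)])
  | g14b (α β : ℝ) (hyp : α + β = 0) :
      Row (n31 ++ act ((α + β) • X₁) (α • X₂) (β • X₃) X₄ (X₁ + (α + β) • X₅)) 2
        fun x₁ x₂ x₃ x₄ x₅ x₆ => (x₁ ≠ 0, ![x₁, x₄ * exp (-x₅ / x₁)])
  | g15 (h : ℝ) :
      Row (n31 ++ act ((1 + h) • X₁) (X₂ + X₄) (h • X₃ + X₅) X₄ (h • X₅)) 2
        fun x₁ x₂ x₃ x₄ x₅ x₆ => (x₁ ≠ 0 ∧ 0 < x₄, ![x₄ ^ (1 + h) / x₁, x₅ * x₄ ^ (-h)])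
  | g16 :
      Row (n31 ++ act X₁ (X₂ + X₄) X₅ (X₁ + X₄) 0) 2
        fun x₁ x₂ x₃ x₄ x₅ x₆ => (x₁ ≠ 0, ![x₅, x₁ * exp (-x₄ / x₁)])
  | g17a (α ε : ℝ) (hyp : α * ε = 0 ∧ α ≠ 0) :
      Row (n31 ++ act (α • X₁) (α • X₂) X₄ (ε • X₁) X₅) 2
        fun x₁ x₂ x₃ x₄ x₅ x₆ => (x₁ ≠ 0 ∧ 0 < x₅, ![x₅ ^ α / x₁, ε * x₁ - α * x₄])
  | g17b (α ε : ℝ) (hyp : α = 0 ∧ ε ≠ 0) :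
      Row (n31 ++ act (α • X₁) (α • X₂) X₄ (ε • X₁) X₅) 2
        fun x₁ x₂ x₃ x₄ x₅ x₆ => (x₁ ≠ 0 ∧ 0 < x₅,
          ![x₅ ^ α / x₁, x₅ * exp (-x₄ / (ε * x₁))])
  | g18 (α β : ℝ) (hyp : β ≠ 0) :
      Row (n31 ++ act ((1 + α) • X₁) (α • X₂) (X₃ + X₄) X₄ (β • X₅)) 2
        fun x₁ x₂ x₃ x₄ x₅ x₆ => (x₁ ≠ 0 ∧ 0 < x₄, ![x₄ ^ (1 + α) / x₁, x₅ * x₄ ^ (-β)])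
  | g19 (α : ℝ) :
      Row (n31 ++ act ((1 + α) • X₁) (α • X₂) (X₃ + X₄) X₄ (X₁ + (α + 1) • X₅)) 2
        fun x₁ x₂ x₃ x₄ x₅ x₆ => (x₁ ≠ 0 ∧ 0 < x₄,
          ![x₄ ^ (1 + α) / x₁, x₄ * exp (-x₅ / x₁)])
  | g20 (β : ℝ) (hyp : β ≠ 0) :
      Row (n31 ++ act X₁ 0 (X₃ + X₄) (X₁ + X₄) (β • X₅)) 2
        fun x₁ x₂ x₃ x₄ x₅ x₆ => (0 < x₁, ![x₅ * x₁ ^ (-β), x₁ * exp (-x₄ / x₁)])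
  | g21 (α h : ℝ) (hyp : h ≠ 0) :
      Row (n31 ++ act ((2 * α) • X₁) (α • X₂ + X₃) (α • X₃) X₄ (h • X₅)) 2
        fun x₁ x₂ x₃ x₄ x₅ x₆ => (x₁ ≠ 0 ∧ 0 < x₄, ![x₄ ^ (2 * α) / x₁, x₅ * x₄ ^ (-h)])
  | g22 (α : ℝ) :
      Row (n31 ++ act ((2 * α) • X₁) (α • X₂ + X₃) (α • X₃) X₄ (X₁ + (2 * α) • X₅)) 2
        fun x₁ x₂ x₃ x₄ x₅ x₆ => (x₁ ≠ 0 ∧ 0 < x₄,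
          ![x₄ ^ (2 * α) / x₁, x₄ * exp (-x₅ / x₁)])
  | g23a (α ε h : ℝ) (hyp : ε * h = 0 ∧ h ≠ 0) :
      Row (n31 ++ act ((2 * α) • X₁) (α • X₂ + X₃) (α • X₃ + X₄) (α • X₄)
          (ε • X₁ + (2 * α + h) • X₅)) 2
        fun x₁ x₂ x₃ x₄ x₅ x₆ => (0 < x₁ ∧ 0 < h * x₅ + ε * x₁,
          ![x₄ ^ 2 / x₁, (h * x₅ + ε * x₁) ^ (2 * α) / x₁ ^ (2 * α + h)])
  | g23b (α ε h : ℝ) (hyp : h = 0 ∧ α ≠ 0) :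
      Row (n31 ++ act ((2 * α) • X₁) (α • X₂ + X₃) (α • X₃ + X₄) (α • X₄)
          (ε • X₁ + (2 * α + h) • X₅)) 2
        fun x₁ x₂ x₃ x₄ x₅ x₆ => (0 < x₁,
          ![x₄ ^ 2 / x₁, (2 * α * x₅ - ε * x₁ * log x₁) / x₁])
  | g24 (h : ℝ) :
      Row (n31 ++ act 0 X₃ X₄ (h • X₁) X₅) 2
        fun x₁ x₂ x₃ x₄ x₅ x₆ => (x₁ ≠ 0 ∧ 0 < x₅, ![x₁, x₅ ^ h * exp (-x₄ / x₁)])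
  | g25a (β h : ℝ) (hyp : h ≠ -1) :
      Row (n31 ++ act ((1 + h) • X₁) X₂ (h • X₃) (β • X₄ + X₅) (β • X₅)) 2
        fun x₁ x₂ x₃ x₄ x₅ x₆ => (0 < x₁ ∧ 0 < x₅,
          ![x₁ ^ (-β) * x₅ ^ (1 + h), x₁ * exp (-(1 + h) * x₄ / x₅)])
  | g25b (β h : ℝ) (hyp : h = -1) :
      Row (n31 ++ act ((1 + h) • X₁) X₂ (h • X₃) (β • X₄ + X₅) (β • X₅)) 2
        fun x₁ x₂ x₃ x₄ x₅ x₆ => (x₅ ≠ 0, ![x₁, x₅ * exp (-β * x₄ / x₅)])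
  | g26 (h : ℝ) :
      Row (n31 ++ act ((1 + h) • X₁) X₂ (h • X₃) ((1 + h) • X₄ + X₅)
          (X₁ + (1 + h) • X₅)) 2
        fun x₁ x₂ x₃ x₄ x₅ x₆ => (x₁ ≠ 0,
          ![(2 * x₁ * x₄ - x₅ ^ 2) / x₁ ^ 2, x₁ * exp (-(1 + h) * x₅ / x₁)])
  -- g_{6,27} and g_{6,29} have the same brackets
  | g27a (α β ε : ℝ) (hyp : α ≠ 0 ∧ α + β ≠ 0) :
      Row (n31 ++ act ((α + β) • X₁) (α • X₂) (β • X₃ + X₄) (β • X₄ + X₅)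
          (ε • X₁ + β • X₅)) 2
        fun x₁ x₂ x₃ x₄ x₅ x₆ => (0 < x₁ ∧ 0 < α * x₅ - ε * x₁,
          ![(α * x₅ - ε * x₁) ^ (α + β) / x₁ ^ β,
            x₁ ^ (-α / (α + β)) * exp ((α ^ 2 * x₄ - ε * x₁) / (α * x₅ - ε * x₁))])
  | g27b (α β ε : ℝ) (hyp : α ≠ 0 ∧ α + β = 0) :
      Row (n31 ++ act ((α + β) • X₁) (α • X₂) (β • X₃ + X₄) (β • X₄ + X₅)
          (ε • X₁ + β • X₅)) 2
        fun x₁ x₂ x₃ x₄ x₅ x₆ => (x₁ ≠ 0 ∧ α * x₅ - ε * x₁ ≠ 0,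
          ![x₁, (α * x₅ - ε * x₁) / x₁ * exp ((α ^ 2 * x₄ - ε * x₁) / (α * x₅ - ε * x₁))])
  | g27c (α β ε : ℝ) (hyp : α = 0 ∧ β ≠ 0 ∧ ε = 0) :
      Row (n31 ++ act ((α + β) • X₁) (α • X₂) (β • X₃ + X₄) (β • X₄ + X₅)
          (ε • X₁ + β • X₅)) 2
        fun x₁ x₂ x₃ x₄ x₅ x₆ => (x₁ ≠ 0 ∧ x₅ ≠ 0, ![x₅ / x₁, x₁ * exp (-β * x₄ / x₅)])
  | g29 (α β ε : ℝ) (hyp : α = 0 ∧ β ≠ 0 ∧ ε ≠ 0) :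
      Row (n31 ++ act ((α + β) • X₁) (α • X₂) (β • X₃ + X₄) (β • X₄ + X₅)
          (ε • X₁ + β • X₅)) 2
        fun x₁ x₂ x₃ x₄ x₅ x₆ => (x₁ ≠ 0,
          ![(-2 * ε * x₁ * x₄ + x₅ ^ 2) / x₁ ^ 2, x₁ * exp (-β * x₅ / (ε * x₁))])
  | g28 (β : ℝ) :
      Row (n31 ++ act ((2 : ℝ) • X₁) (X₂ + X₃) X₃ (β • X₄ + X₅) (β • X₅)) 2
        fun x₁ x₂ x₃ x₄ x₅ x₆ => (0 < x₁ ∧ x₅ ≠ 0,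
          ![x₅ ^ 2 * x₁ ^ (-β), x₁ * exp (-2 * x₄ / x₅)])
  | g30 :
      Row (n31 ++ act 0 X₃ 0 (X₄ + X₅) X₅) 2
        fun x₁ x₂ x₃ x₄ x₅ x₆ => (x₅ ≠ 0, ![x₁, x₅ * exp (-x₄ / x₅)])
  | g31 :
      Row (n31 ++ act ((2 : ℝ) • X₁) (X₂ + X₃) (X₃ + X₄) (X₄ + X₅) X₅) 2
        fun x₁ x₂ x₃ x₄ x₅ x₆ => (x₁ ≠ 0 ∧ x₅ ≠ 0,
          ![x₅ ^ 2 / x₁, x₁ * exp (-2 * x₄ / x₅)])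
  | g32a (α γ ε h : ℝ) (hyp : γ < 2 * α + h ∧ ε * h = 0 ∧ h ≠ 0 ∧ γ ≠ 0) :
      Row (n31 ++ act ((2 * α) • X₁) (α • X₂ + X₃) (-X₂ + α • X₃)
          (ε • X₁ + (2 * α + h) • X₄) (γ • X₅)) 2
        fun x₁ x₂ x₃ x₄ x₅ x₆ => (0 < x₁ ∧ 0 < x₅ ∧ 0 < h * x₄ + ε * x₁,
          ![x₅ ^ (2 * α) * x₁ ^ (-γ), (h * x₄ + ε * x₁) ^ γ * x₅ ^ (-(2 * α + h))])
  | g32b (α γ ε h : ℝ) (hyp : γ < 2 * α + h ∧ ε * h = 0 ∧ h ≠ 0 ∧ γ = 0) :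
      Row (n31 ++ act ((2 * α) • X₁) (α • X₂ + X₃) (-X₂ + α • X₃)
          (ε • X₁ + (2 * α + h) • X₄) (γ • X₅)) 2
        fun x₁ x₂ x₃ x₄ x₅ x₆ => (0 < x₁ ∧ 0 < h * x₄ + ε * x₁,
          ![x₅, (h * x₄ + ε * x₁) ^ (2 * α) * x₁ ^ (-(2 * α + h))])
  | g32c (α γ ε h : ℝ) (hyp : γ < 2 * α + h ∧ h = 0 ∧ γ ≠ 0) :
      Row (n31 ++ act ((2 * α) • X₁) (α • X₂ + X₃) (-X₂ + α • X₃)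
          (ε • X₁ + (2 * α + h) • X₄) (γ • X₅)) 2
        fun x₁ x₂ x₃ x₄ x₅ x₆ => (0 < x₁ ∧ 0 < x₅,
          ![x₅ ^ (2 * α) * x₁ ^ (-γ), (γ * x₄ - ε * x₁ * log x₅) / x₁])
  | g32d (α γ ε h : ℝ) (hyp : γ < 2 * α + h ∧ h = 0 ∧ γ = 0) :
      Row (n31 ++ act ((2 * α) • X₁) (α • X₂ + X₃) (-X₂ + α • X₃)
          (ε • X₁ + (2 * α + h) • X₄) (γ • X₅)) 2
        fun x₁ x₂ x₃ x₄ x₅ x₆ => (0 < x₁, ![x₅, (2 * α * x₄ - ε * x₁ * log x₁) / x₁])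
  | g33a (α β : ℝ) (hyp : β ≤ 2 * α ∧ α ≠ 0) :
      Row (n31 ++ act ((2 * α) • X₁) (α • X₂ + X₃) (-X₂ + α • X₃) (β • X₄)
          (X₁ + (2 * α) • X₅)) 2
        fun x₁ x₂ x₃ x₄ x₅ x₆ => (0 < x₁ ∧ 0 < x₄,
          ![x₄ ^ (2 * α) * x₁ ^ (-β), x₁ * exp (-2 * α * x₅ / x₁)])
  | g33b (α β : ℝ) (hyp : β ≤ 2 * α ∧ α = 0) :
      Row (n31 ++ act ((2 * α) • X₁) (α • X₂ + X₃) (-X₂ + α • X₃) (β • X₄)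
          (X₁ + (2 * α) • X₅)) 2
        fun x₁ x₂ x₃ x₄ x₅ x₆ => (x₁ ≠ 0, ![x₁, x₄ * exp (-β * x₅ / x₁)])
  | g34a (α ε h : ℝ) (hyp : ε = 0 ∧ α ≠ 0) :
      Row (n31 ++ act ((2 * α) • X₁) (α • X₂ + X₃) (-X₂ + α • X₃) ((2 * α + h) • X₄ + X₅)
          ((2 * α + h) • X₅ + ε • X₁)) 2
        fun x₁ x₂ x₃ x₄ x₅ x₆ => (0 < x₁ ∧ 0 < x₅,
          ![x₅ ^ (2 * α) * x₁ ^ (-(2 * α + h)), x₁ * exp (-2 * α * x₄ / x₅)])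
  | g34b (α ε h : ℝ) (hyp : ε = 0 ∧ α = 0) :
      Row (n31 ++ act ((2 * α) • X₁) (α • X₂ + X₃) (-X₂ + α • X₃) ((2 * α + h) • X₄ + X₅)
          ((2 * α + h) • X₅ + ε • X₁)) 2
        fun x₁ x₂ x₃ x₄ x₅ x₆ => (x₅ ≠ 0, ![x₁, x₅ * exp (-h * x₄ / x₅)])
  | g34c (α ε h : ℝ) (hyp : ε ≠ 0 ∧ h = 0) :
      Row (n31 ++ act ((2 * α) • X₁) (α • X₂ + X₃) (-X₂ + α • X₃) ((2 * α + h) • X₄ + X₅)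
          ((2 * α + h) • X₅ + ε • X₁)) 2
        fun x₁ x₂ x₃ x₄ x₅ x₆ => (x₁ ≠ 0,
          ![(-2 * ε * x₁ * x₄ + x₅ ^ 2) / x₁ ^ 2, x₁ * exp (-2 * α * x₅ / (ε * x₁))])
  | g35 (α β γ : ℝ) (hyp : α ^ 2 + β ^ 2 ≠ 0) :
      Row (n31 ++ act ((α + β) • X₁) (α • X₂) (β • X₃) (γ • X₄ + X₅) (-X₄ + γ • X₅)) 2
        fun x₁ x₂ x₃ x₄ x₅ x₆ => (x₄ ≠ 0 ∧ x₅ ≠ 0,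
          ![(x₄ ^ 2 + x₅ ^ 2) * unitPow x₄ (-x₅) γ,
            x₁ * exp (-(α + β) * arctan (x₄ / x₅))])
  | g36 (α γ : ℝ) :
      Row (n31 ++ act ((2 * α) • X₁) (α • X₂ + X₃) (α • X₃) (γ • X₄ + X₅)
          (-X₄ + γ • X₅)) 2
        fun x₁ x₂ x₃ x₄ x₅ x₆ => (x₄ ≠ 0 ∧ x₅ ≠ 0,
          ![(x₄ ^ 2 + x₅ ^ 2) * unitPow x₄ (-x₅) γ, x₁ * exp (-2 * α * arctan (x₄ / x₅))])
  | g37 (α β s : ℝ) (hyp : s ≠ 0) :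
      Row (n31 ++ act ((2 * α) • X₁) (α • X₂ + X₃) (-X₂ + α • X₃) (β • X₄ + s • X₅)
          (-s • X₄ + β • X₅)) 2
        fun x₁ x₂ x₃ x₄ x₅ x₆ => (x₄ ≠ 0 ∧ x₅ ≠ 0,
          ![(x₄ ^ 2 + x₅ ^ 2) * unitPow x₄ (-x₅) (β / s),
            x₁ * exp (-2 / s * α * arctan (x₄ / x₅))])
  | g38 (α : ℝ) :
      Row (n31 ++ act ((2 * α) • X₁) (α • X₂ + X₃ + X₄) (-X₂ + α • X₃ + X₅) (α • X₄ + X₅)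
          (-X₄ + α • X₅)) 2
        fun x₁ x₂ x₃ x₄ x₅ x₆ => (x₄ ≠ 0 ∧ x₅ ≠ 0,
          ![(x₄ ^ 2 + x₅ ^ 2) * unitPow x₄ (-x₅) α, x₁ * exp (-2 * α * arctan (x₄ / x₅))])
  -- nilradical g_{4,1} + g_1
  | g39 (γ h : ℝ) (hyp : γ ≠ 0) :
      Row (n41 ++ act ((1 + h) • X₁) ((2 + h) • X₂) (γ • X₃) (h • X₄) X₅) 2
        fun x₁ x₂ x₃ x₄ x₅ x₆ => (0 < x₂ ∧ 0 < x₃,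
          ![x₃ ^ (2 + h) * x₂ ^ (-γ), (x₁ ^ 2 - 2 * x₂ * x₄) / (x₂ * x₃ ^ (h / γ))])
  | g40 (h : ℝ) :
      Row (n41 ++ act ((1 + h) • X₁) ((2 + h) • X₂) (X₂ + (2 + h) • X₃) (h • X₄) X₅) 2
        fun x₁ x₂ x₃ x₄ x₅ x₆ => (x₂ ≠ 0,
          ![x₂ * exp (-(2 + h) * x₃ / x₂),
            (x₁ ^ 2 - 2 * x₂ * x₄) / x₂ * exp (-h * x₃ / x₂)])
  | g41a (h : ℝ) (hyp : h ≠ -1) :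
      Row (n41 ++ act ((1 + h) • X₁) ((2 + h) • X₂) (h • X₃) (X₃ + h • X₄) X₅) 2
        fun x₁ x₂ x₃ x₄ x₅ x₆ => (0 < x₂ ∧ 0 < x₃,
          ![x₃ ^ (2 + h) * x₂ ^ (-h),
            (x₂ * x₃)⁻¹ * exp ((1 + h) * (2 * x₂ * x₄ - x₁ ^ 2) / (x₂ * x₃))])
  | g41b (h : ℝ) (hyp : h = -1) :
      Row (n41 ++ act ((1 + h) • X₁) ((2 + h) • X₂) (h • X₃) (X₃ + h • X₄) X₅) 2
        fun x₁ x₂ x₃ x₄ x₅ x₆ => (x₂ ≠ 0 ∧ x₃ ≠ 0,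
          ![x₂ * x₃, x₂ / x₃ * exp (-(2 * x₂ * x₄ - x₁ ^ 2) / (x₂ * x₃))])
  | g42 (h : ℝ) :
      Row (n41 ++ act ((1 + h) • X₁) ((2 + h) • X₂) X₃ (h • X₄) (X₃ + X₅)) 2
        fun x₁ x₂ x₃ x₄ x₅ x₆ => (x₂ ≠ 0 ∧ 0 < x₃,
          ![x₃ ^ (2 + h) / x₂, (2 * x₂ * x₄ - x₁ ^ 2) / (x₂ * x₃ ^ h)])
  | g43 :
      Row (n41 ++ act 0 X₂ (X₂ + X₃) (-X₄) (X₃ + X₅)) 2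
        fun x₁ x₂ x₃ x₄ x₅ x₆ => (x₂ ≠ 0, ![x₁ ^ 2 - 2 * x₂ * x₄, x₂ * exp (-x₃ / x₂)])
  | g44 (γ : ℝ) :
      Row (n41 ++ act ((2 : ℝ) • X₁) ((3 : ℝ) • X₂) (γ • X₃) X₄ (X₄ + X₅)) 2
        fun x₁ x₂ x₃ x₄ x₅ x₆ => (0 < x₂,
          ![x₃ ^ 3 * x₂ ^ (-γ), (2 * x₂ * x₄ - x₁ ^ 2) ^ 3 / x₂ ^ 4])
  | g45 :
      Row (n41 ++ act ((2 : ℝ) • X₁) ((3 : ℝ) • X₂) (X₂ + (3 : ℝ) • X₃) X₄ (X₄ + X₅)) 2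
        fun x₁ x₂ x₃ x₄ x₅ x₆ => (x₂ ≠ 0,
          ![x₂ * exp (-3 * x₃ / x₂), (2 * x₂ * x₄ - x₁ ^ 2) ^ 3 / x₂ ^ 4])
  | g46 :
      Row (n41 ++ act ((2 : ℝ) • X₁) ((3 : ℝ) • X₂) X₃ (X₃ + X₄) (X₄ + X₅)) 2
        fun x₁ x₂ x₃ x₄ x₅ x₆ => (x₂ ≠ 0 ∧ x₃ ≠ 0,
          ![x₃ * exp ((x₁ ^ 2 - 2 * x₂ * x₄) / (2 * x₂ * x₃)), x₃ ^ 3 / x₂])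
  | g47 (γ ε : ℝ) (hyp : γ ≠ 0) :
      Row (n41 ++ act X₁ X₂ (γ • X₃) (ε • X₂ + X₄) 0) 2
        fun x₁ x₂ x₃ x₄ x₅ x₆ => (0 < x₂,
          ![x₃ * x₂ ^ (-γ), x₂ ^ ε * exp ((x₁ ^ 2 - 2 * x₂ * x₄) / (2 * x₂ ^ 2))])
  | g48 :
      Row (n41 ++ act X₁ X₂ (X₂ + X₃) X₄ 0) 2
        fun x₁ x₂ x₃ x₄ x₅ x₆ => (x₂ ≠ 0,
          ![x₂ * exp (-x₃ / x₂), (2 * x₂ * x₄ - x₁ ^ 2) / x₂ ^ 2])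
  | g49 (ε : ℝ) :
      Row (n41 ++ act X₁ X₂ 0 (ε • X₂ + X₄) X₃) 2
        fun x₁ x₂ x₃ x₄ x₅ x₆ => (0 < x₂,
          ![x₃, x₂ ^ ε * exp ((-2 * x₂ * x₄ + x₁ ^ 2) / (2 * x₂ ^ 2))])
  | g50a (ε : ℝ) (hyp : ε ≠ 0) :
      Row (n41 ++ act X₁ X₂ (ε • X₂ + X₃) (X₃ + X₄) 0) 2
        fun x₁ x₂ x₃ x₄ x₅ x₆ => (0 < x₂,
          ![x₂ ^ ε * exp (-x₃ / x₂), (ε * (x₁ ^ 2 - 2 * x₂ * x₄) + x₃ ^ 2) / x₂ ^ 2])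
  | g50b (ε : ℝ) (hyp : ε = 0) :
      Row (n41 ++ act X₁ X₂ (ε • X₂ + X₃) (X₃ + X₄) 0) 2
        fun x₁ x₂ x₃ x₄ x₅ x₆ => (0 < x₂,
          ![x₃ / x₂, x₃ / x₂ * log x₂ + (x₁ ^ 2 - 2 * x₂ * x₄) / (2 * x₂ ^ 2)])
  | g51 (ε : ℝ) :
      Row (n41 ++ act 0 0 X₃ (ε • X₂) 0) 2
        fun x₁ x₂ x₃ x₄ x₅ x₆ => (x₂ ≠ 0 ∧ 0 < x₃,
          ![x₂, x₃ ^ ε * exp ((x₁ ^ 2 - 2 * x₂ * x₄) / (2 * x₂ ^ 2))])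
  | g52 (ε : ℝ) :
      Row (n41 ++ act 0 0 X₃ (ε • X₂) X₄) 2
        fun x₁ x₂ x₃ x₄ x₅ x₆ => (x₂ ≠ 0 ∧ 0 < x₃,
          ![x₂, x₃ ^ ε * exp ((x₁ ^ 2 - 2 * x₂ * x₄) / (2 * x₂ ^ 2))])
  -- nilradical g_{5,1}
  | g53 :
      Row (n51 ++ act 0 0 X₃ X₄ (-X₅)) 2
        fun x₁ x₂ x₃ x₄ x₅ x₆ => (True, ![x₁, x₂])
  | g54 (lam γ : ℝ) :
      Row (n51 ++ act X₁ (lam • X₂) ((1 - γ) • X₃) ((lam - γ) • X₄) (γ • X₅)) 2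
        fun x₁ x₂ x₃ x₄ x₅ x₆ => (0 < x₁,
          ![x₂ * x₁ ^ (-lam), (x₁ * x₄ - x₂ * x₃) * x₁ ^ (-(lam + 1 - γ))])
  | g55 (γ : ℝ) :
      Row (n51 ++ act X₁ ((1 + γ) • X₂) ((1 - γ) • X₃) (X₁ + X₄) (γ • X₅)) 2
        fun x₁ x₂ x₃ x₄ x₅ x₆ => (0 < x₁,
          ![x₂ * x₁ ^ (-(1 + γ)), x₁ * exp ((x₂ * x₃ - x₁ * x₄) / x₁ ^ 2)])
  | g56a (γ : ℝ) (hyp : γ ≠ 1) :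
      Row (n51 ++ act X₁ ((1 - γ) • X₂) (X₂ + (1 - γ) • X₃) ((1 - 2 * γ) • X₄) (γ • X₅)) 2
        fun x₁ x₂ x₃ x₄ x₅ x₆ => (0 < x₁ ∧ x₂ ≠ 0,
          ![x₂ * x₁ ^ (-(1 - γ)),
            x₁ ^ (γ - 1) * exp ((1 - γ) * (x₂ * x₃ - x₁ * x₄) / x₂ ^ 2)])
  | g56b (γ : ℝ) (hyp : γ = 1) :
      Row (n51 ++ act X₁ ((1 - γ) • X₂) (X₂ + (1 - γ) • X₃) ((1 - 2 * γ) • X₄) (γ • X₅)) 2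
        fun x₁ x₂ x₃ x₄ x₅ x₆ => (x₁ ≠ 0 ∧ x₂ ≠ 0,
          ![x₂, x₁⁻¹ * exp ((x₂ * x₃ - x₁ * x₄) / x₂ ^ 2)])
  | g57 (γ : ℝ) :
      Row (n51 ++ act X₁ ((2 * γ) • X₂) ((1 - γ) • X₃) (γ • X₄) (X₄ + γ • X₅)) 2
        fun x₁ x₂ x₃ x₄ x₅ x₆ => (0 < x₁,
          ![x₂ * x₁ ^ (-2 * γ), (x₁ * x₄ - x₂ * x₃) / x₁ ^ (γ + 1)])
  | g58 (ω : ℝ) (hyp : ω = 0 ∨ ω = 1) :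
      Row (n51 ++ act ((3 : ℝ) • X₁) ((2 : ℝ) • X₂) (X₂ + (2 : ℝ) • X₃) X₄ (ω • X₄ + X₅)) 2
        fun x₁ x₂ x₃ x₄ x₅ x₆ => (0 < x₁,
          ![x₂ ^ 3 / x₁ ^ 2, (x₁ * x₄ - x₂ * x₃ + 1 / 3 * x₂ ^ 2 * log x₁) ^ 3 / x₁ ^ 4])
  | g59 (h : ℝ) :
      Row (n51 ++ act X₁ 0 X₃ X₂ (h • X₄)) 2
        fun x₁ x₂ x₃ x₄ x₅ x₆ => (x₁ ≠ 0 ∧ x₂ ≠ 0,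
          ![x₂, x₁ * exp ((-x₁ * x₄ + x₂ * x₃) / (x₁ * x₂))])
  | g60 (ω : ℝ) (hyp : ω = 0 ∨ ω = 1) :
      Row (n51 ++ act X₁ ((2 : ℝ) • X₂) 0 (X₁ + X₄) (ω • X₄ + X₅)) 2
        fun x₁ x₂ x₃ x₄ x₅ x₆ => (x₁ ≠ 0,
          ![x₂ / x₁ ^ 2, x₁ * exp ((-x₁ * x₄ + x₂ * x₃) / x₁ ^ 2)])
  | g61 (lam : ℝ) :
      Row (n51 ++ act ((2 : ℝ) • X₁) ((2 * lam) • X₂) X₃ ((2 * lam - 1) • X₄) (X₃ + X₅)) 2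
        fun x₁ x₂ x₃ x₄ x₅ x₆ => (0 < x₁ ∧ x₂ ≠ 0,
          ![x₂ * x₁ ^ (-lam), (x₁ * x₄ - x₂ * x₃) / (x₂ * √x₁)])
  | g62 (ω : ℝ) (hyp : ω = 0 ∨ ω = 1) :
      Row (n51 ++ act ((2 : ℝ) • X₁) X₂ (X₂ + X₃) 0 (ω • X₃ + X₅)) 2
        fun x₁ x₂ x₃ x₄ x₅ x₆ => (x₁ ≠ 0 ∧ x₂ ≠ 0,
          ![x₂ ^ 2 / x₁, x₁ * exp (2 * (x₁ * x₄ - x₂ * x₃) / x₂ ^ 2)])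
  | g63 (lam : ℝ) :
      Row (n51 ++ act X₁ (lam • X₂) X₃ (X₂ + lam • X₄) 0) 2
        fun x₁ x₂ x₃ x₄ x₅ x₆ => (0 < x₁ ∧ x₂ ≠ 0,
          ![x₂ * x₁ ^ (-lam), x₁ * exp ((-x₁ * x₄ + x₂ * x₃) / (x₁ * x₂))])
  | g64 (h : ℝ) :
      Row (n51 ++ act X₁ X₂ (h • X₂ + X₃) (X₁ + X₄) 0) 2
        fun x₁ x₂ x₃ x₄ x₅ x₆ => (0 < x₁,
          ![x₂ / x₁, (x₂ * x₃ - x₁ * x₄ + (x₁ ^ 2 - h * x₂ ^ 2) * log x₁) / x₁ ^ 2])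
  | g65 (lam γ : ℝ) (hyp : lam ≠ 0 ∨ γ ≠ 0) :
      Row (n51 ++ act (lam • X₁ + X₂) (lam • X₂) ((lam - γ) • X₃ + X₄) ((lam - γ) • X₄)
          (γ • X₅)) 2
        fun x₁ x₂ x₃ x₄ x₅ x₆ => (x₂ ≠ 0,
          ![x₂ * exp (-lam * x₁ / x₂), (x₁ * x₄ - x₂ * x₃) * exp ((γ - 2 * lam) * x₁ / x₂)])
  | g66 :
      Row (n51 ++ act ((2 : ℝ) • X₁ + X₂) ((2 : ℝ) • X₂) (X₃ + X₄) X₄ (X₃ + X₅)) 2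
        fun x₁ x₂ x₃ x₄ x₅ x₆ => (x₂ ≠ 0,
          ![x₂ * exp (-2 * x₁ / x₂), (x₁ * x₄ - x₂ * x₃) * exp (-3 * x₁ / x₂)])
  | g67 (h : ℝ) :
      Row (n51 ++ act ((2 : ℝ) • X₁ + X₂) ((2 : ℝ) • X₂) (X₃ + X₄) X₄ (h • X₄ + X₅)) 2
        fun x₁ x₂ x₃ x₄ x₅ x₆ => (x₂ ≠ 0,
          ![x₂ * exp (-2 * x₁ / x₂), (x₁ * x₄ - x₂ * x₃) * exp (-3 * x₁ / x₂)])
  | g68 (γ : ℝ) :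
      Row (n51 ++ act (X₁ + X₂) X₂ (X₃ + X₄) (γ • X₁ + X₄) 0) 2
        fun x₁ x₂ x₃ x₄ x₅ x₆ => (x₂ ≠ 0,
          ![x₂ * exp (-x₁ / x₂),
            (3 * (x₁ * x₄ - x₂ * x₃) * x₂ - γ * x₁ ^ 3) / x₂ ^ 3])
  | g69 :
      Row (n51 ++ act (X₁ + X₂) X₂ (X₃ + X₄) (X₂ + X₄) 0) 2
        fun x₁ x₂ x₃ x₄ x₅ x₆ => (x₂ ≠ 0,
          ![x₂ * exp (-x₁ / x₂),
            (2 * x₁ * x₄ - 2 * x₂ * x₃ - x₁ ^ 2 - x₂ ^ 2) / 2 * exp (-2 * x₁ / x₂)])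
  | g70 (γ p : ℝ) :
      Row (n51 ++ act (p • X₁ + X₂) (-X₁ + p • X₂) ((p - γ) • X₃ + X₄)
          (-X₃ + (p - γ) • X₄) (γ • X₅)) 2
        fun x₁ x₂ x₃ x₄ x₅ x₆ => (x₂ ≠ 0,
          ![(x₁ ^ 2 + x₂ ^ 2) * unitPow x₂ x₁ p,
            (x₁ * x₄ - x₂ * x₃) / 2 * exp ((γ - 2 * p) * arctan (x₁ / x₂))])
  -- nilradical g_{5,2}
  | g71a (h : ℝ) (hyp : h ≠ -1) :
      Row (n52 ++ act ((h + 3) • X₁) ((h + 2) • X₂) ((h + 1) • X₃) (h • X₄) X₅) 2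
        fun x₁ x₂ x₃ x₄ x₅ x₆ => (0 < x₁ ∧ 0 < 2 * x₁ * x₃ - x₂ ^ 2 ∧
            0 < 3 * x₁ ^ 2 * x₄ + x₂ ^ 3 - 3 * x₁ * x₂ * x₃,
          ![(3 * x₁ ^ 2 * x₄ + x₂ ^ 3 - 3 * x₁ * x₂ * x₃) ^ (h + 1) /
              (x₁ ^ (h + 2) * (2 * x₁ * x₃ - x₂ ^ 2) ^ h),
            (2 * x₃ - x₂ ^ 2 / x₁) ^ (h + 3) * x₁ ^ (-(h + 1))])
  | g71b (h : ℝ) (hyp : h = -1) :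
      Row (n52 ++ act ((h + 3) • X₁) ((h + 2) • X₂) ((h + 1) • X₃) (h • X₄) X₅) 2
        fun x₁ x₂ x₃ x₄ x₅ x₆ => (x₁ ≠ 0,
          ![(3 * x₁ ^ 2 * x₄ + x₂ ^ 3 - 3 * x₁ * x₂ * x₃) ^ 2 / x₁ ^ 3,
            2 * x₃ - x₂ ^ 2 / x₁])
  | g72 :
      Row (n52 ++ act ((4 : ℝ) • X₁) ((3 : ℝ) • X₂) ((2 : ℝ) • X₃) X₄ (X₄ + X₅)) 2
        fun x₁ x₂ x₃ x₄ x₅ x₆ => (x₁ ≠ 0,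
          ![(3 * x₁ ^ 2 * x₄ + x₂ ^ 3 - 3 * x₁ * x₂ * x₃) ^ 4 / x₁ ^ 9,
            (-2 * x₁ * x₃ + x₂ ^ 2) ^ 2 / x₁ ^ 3])
  | g73 (ε : ℝ) (hyp : ε = 1 ∨ ε = -1) :
      Row (n52 ++ act X₁ X₂ (ε • X₁ + X₃) (ε • X₂ + X₄) 0) 2
        fun x₁ x₂ x₃ x₄ x₅ x₆ => (0 < x₁,
          ![(3 * x₁ ^ 2 * x₄ + x₂ ^ 3 - 3 * x₁ * x₂ * x₃) / x₁ ^ 3,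
            x₁ ^ ε * exp ((-2 * x₁ * x₃ + x₂ ^ 2) / (2 * x₁ ^ 2))])
  | g74 :
      Row (n52 ++ act X₁ X₂ X₃ X₄ 0) 2
        fun x₁ x₂ x₃ x₄ x₅ x₆ => (x₁ ≠ 0,
          ![(3 * x₁ ^ 2 * x₄ + x₂ ^ 3 - 3 * x₁ * x₂ * x₃) / x₁ ^ 3,
            (2 * x₁ * x₃ - x₂ ^ 2) / x₁ ^ 2])
  | g75 :
      Row (n52 ++ act X₁ X₂ X₃ (X₁ + X₄) 0) 2
        fun x₁ x₂ x₃ x₄ x₅ x₆ => (x₁ ≠ 0,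
          ![x₁ * exp ((-3 * x₁ ^ 2 * x₄ - x₂ ^ 3 + 3 * x₁ * x₂ * x₃) / (3 * x₁ ^ 3)),
            (2 * x₁ * x₃ - x₂ ^ 2) / x₁ ^ 2])
  -- nilradical g_{5,3}
  | g76a (h : ℝ) (hyp : 2 * h + 1 ≠ 0) :
      Row (n53 ++ act ((2 * h + 1) • X₁) ((h + 1) • X₂) ((h + 2) • X₃) X₄ (h • X₅)) 2
        fun x₁ x₂ x₃ x₄ x₅ x₆ => (0 < x₁ ∧ 0 < x₃,
          ![x₃ ^ (2 * h + 1) * x₁ ^ (-(h + 2)),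
            (2 * x₃ * x₅ + x₂ ^ 2 - 2 * x₁ * x₄) / (x₃ * x₁ ^ (h / (2 * h + 1)))])
  | g76b (h : ℝ) (hyp : 2 * h + 1 = 0) :
      Row (n53 ++ act ((2 * h + 1) • X₁) ((h + 1) • X₂) ((h + 2) • X₃) X₄ (h • X₅)) 2
        fun x₁ x₂ x₃ x₄ x₅ x₆ => (x₃ ≠ 0,
          ![x₁, (2 * x₃ * x₅ + x₂ ^ 2 - 2 * x₁ * x₄) ^ 3 / x₃ ^ 2])
  | g77 (ε : ℝ) (hyp : ε = 1 ∨ ε = -1) :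
      Row (n53 ++ act X₁ X₂ ((2 : ℝ) • X₃) (ε • X₁ + X₄) 0) 2
        fun x₁ x₂ x₃ x₄ x₅ x₆ => (0 < x₁,
          ![x₁ ^ ε * exp ((2 * x₃ * x₅ + x₂ ^ 2 - 2 * x₁ * x₄) / (2 * x₁ ^ 2)),
            x₃ / x₁ ^ 2])
  | g78 :
      Row (n53 ++ act (-X₁) 0 X₃ (X₃ + X₄) (-X₅)) 2
        fun x₁ x₂ x₃ x₄ x₅ x₆ => (x₁ ≠ 0 ∧ x₃ ≠ 0,
          ![x₁ * exp ((2 * (x₁ * x₄ - x₃ * x₅) - x₂ ^ 2) / (2 * x₁ * x₃)), x₁ * x₃])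
  | g79 :
      Row (n53 ++ act ((3 : ℝ) • X₁) ((2 : ℝ) • X₂) (X₁ + (3 : ℝ) • X₃) (X₄ + X₅) X₅) 2
        fun x₁ x₂ x₃ x₄ x₅ x₆ => (x₁ ≠ 0,
          ![x₁ * exp (-3 * x₃ / x₁), (2 * (x₁ * x₄ - x₃ * x₅) - x₂ ^ 2) ^ 3 / x₁ ^ 4])
  | g80 :
      Row (n53 ++ act ((2 : ℝ) • X₁) X₂ X₃ 0 X₅) 2
        fun x₁ x₂ x₃ x₄ x₅ x₆ => (x₁ ≠ 0,
          ![x₃ ^ 2 / x₁, (2 * x₃ * x₅ + x₂ ^ 2 - 2 * x₁ * x₄) / x₁])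
  | g81 (ε : ℝ) (hyp : ε = 1 ∨ ε = -1) :
      Row (n53 ++ act ((2 : ℝ) • X₁) X₂ X₃ 0 (ε • X₃ + X₅)) 2
        fun x₁ x₂ x₃ x₄ x₅ x₆ => (0 < x₁ ∧ x₃ ≠ 0,
          ![x₃ ^ 2 / x₁, x₁ ^ ε * exp ((2 * x₁ * x₄ - 2 * x₃ * x₅ - x₂ ^ 2) / x₃ ^ 2)])
  -- nilradical g_{5,4}
  | g82a (lam lam₁ : ℝ) :
      Row (n54 ++ act ((2 : ℝ) • X₁) ((lam + 1) • X₂) ((lam₁ + 1) • X₃) ((-lam + 1) • X₄)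
          ((-lam₁ + 1) • X₅)) 0
        fun x₁ x₂ x₃ x₄ x₅ x₆ => (True, ![])
  | g82b (lam lam₁ : ℝ) (hyp : lam ≠ 0 ∨ lam₁ ≠ 0) :
      Row (n54 ++ act 0 (lam • X₂) (lam₁ • X₃) (-lam • X₄) (-lam₁ • X₅)) 2
        fun x₁ x₂ x₃ x₄ x₅ x₆ => (True, ![x₁, lam * x₂ * x₄ + lam₁ * x₃ * x₅ - x₁ * x₆])
  | g83a (α lam : ℝ) (hyp : α ≠ 0) :
      Row (n54 ++ act (α • X₁) ((α / 2 + lam) • X₂ + X₃) ((α / 2 + lam) • X₃)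
          ((α / 2 - lam) • X₄) (-X₄ + (α / 2 - lam) • X₅)) 0
        fun x₁ x₂ x₃ x₄ x₅ x₆ => (True, ![])
  | g83b (lam : ℝ) (hyp : lam ≠ 0) :
      Row (n54 ++ act 0 (lam • X₂ + X₃) (lam • X₃) (-lam • X₄) (-X₄ - lam • X₅)) 2
        fun x₁ x₂ x₃ x₄ x₅ x₆ => (True,
          ![x₁, lam * (x₂ * x₄ + x₃ * x₅) + x₃ * x₄ - x₁ * x₆])
  | g84 :
      Row (n54 ++ act 0 X₂ 0 (-X₄) X₃) 2
        fun x₁ x₂ x₃ x₄ x₅ x₆ => (True, ![x₁, 2 * x₁ * x₆ + x₃ ^ 2 - 2 * x₂ * x₄])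
  | g85 (lam : ℝ) :
      Row (n54 ++ act ((2 : ℝ) • X₁) ((1 + lam) • X₂) X₃ ((1 - lam) • X₄) (X₃ + X₅)) 0
        fun x₁ x₂ x₃ x₄ x₅ x₆ => (True, ![])
  | g86 :
      Row (n54 ++ act ((2 : ℝ) • X₁) (X₂ + X₃) X₃ X₄ (-X₄ + X₅)) 0
        fun x₁ x₂ x₃ x₄ x₅ x₆ => (True, ![])
  | g87 :
      Row (n54 ++ act ((2 : ℝ) • X₁) (X₂ + X₅) (X₃ + X₄) X₄ (X₃ + X₅)) 0
        fun x₁ x₂ x₃ x₄ x₅ x₆ => (True, ![])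
  | g88a (α μ₀ ν₀ : ℝ) (hyp : α ≠ 0) :
      Row (n54 ++ act (α • X₁) ((α / 2 + μ₀) • X₂ + ν₀ • X₃) (-ν₀ • X₂ + (α / 2 + μ₀) • X₃)
          ((α / 2 - μ₀) • X₄ + ν₀ • X₅) (-ν₀ • X₄ + (α / 2 - μ₀) • X₅)) 0
        fun x₁ x₂ x₃ x₄ x₅ x₆ => (True, ![])
  | g88b (μ₀ ν₀ : ℝ) (hyp : μ₀ ≠ 0 ∨ ν₀ ≠ 0) :
      Row (n54 ++ act 0 (μ₀ • X₂ + ν₀ • X₃) (-ν₀ • X₂ + μ₀ • X₃) (-μ₀ • X₄ + ν₀ • X₅)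
          (-ν₀ • X₄ - μ₀ • X₅)) 2
        fun x₁ x₂ x₃ x₄ x₅ x₆ => (True,
          ![x₁, μ₀ * (x₂ * x₄ + x₃ * x₅) + ν₀ * (x₃ * x₄ - x₂ * x₅) - x₁ * x₆])
  | g89a (α ν₀ s : ℝ) (hyp : α ≠ 0) :
      Row (n54 ++ act (α • X₁) ((α / 2 + s) • X₂) (ν₀ • X₅ + (α / 2) • X₃)
          ((α / 2 - s) • X₄) (-ν₀ • X₃ + (α / 2) • X₅)) 0
        fun x₁ x₂ x₃ x₄ x₅ x₆ => (True, ![])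
  | g89b (ν₀ s : ℝ) (hyp : ν₀ ≠ 0 ∨ s ≠ 0) :
      Row (n54 ++ act 0 (s • X₂) (ν₀ • X₅) (-s • X₄) (-ν₀ • X₃)) 2
        fun x₁ x₂ x₃ x₄ x₅ x₆ => (True,
          ![x₁, (2 * x₁ * x₆ - 2 * s * x₂ * x₄ - ν₀ * (x₃ ^ 2 + x₅ ^ 2)) / 2])
  | g90a (α ν₀ : ℝ) (hyp : α ≠ 0) :
      Row (n54 ++ act (α • X₁) ((α / 2) • X₂ + X₄) ((α / 2) • X₃ + ν₀ • X₅)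
          (X₂ + (α / 2) • X₄) (-ν₀ • X₃ + (α / 2) • X₅)) 0
        fun x₁ x₂ x₃ x₄ x₅ x₆ => (True, ![])
  | g90b (ν₀ : ℝ) (hyp : ν₀ ≠ 1) :
      Row (n54 ++ act 0 X₄ (ν₀ • X₅) X₂ (-ν₀ • X₃)) 2
        fun x₁ x₂ x₃ x₄ x₅ x₆ => (True,
          ![x₁, (2 * x₁ * x₆ + x₂ ^ 2 - x₄ ^ 2 - ν₀ * (x₃ ^ 2 + x₅ ^ 2)) / 2])
  | g91 :
      Row (n54 ++ act 0 X₄ X₅ X₂ (-X₃)) 2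
        fun x₁ x₂ x₃ x₄ x₅ x₆ => (True,
          ![x₁, (2 * x₁ * x₆ + x₂ ^ 2 - x₄ ^ 2 - (x₃ ^ 2 + x₅ ^ 2)) / 2])
  | g92a (α μ₀ ν₀ : ℝ) (hyp : α ≠ 0) :
      Row (n54 ++ act (α • X₁) ((α / 2) • X₂ + ν₀ • X₃) (-μ₀ • X₂ + (α / 2) • X₃)
          (μ₀ • X₅ + (α / 2) • X₄) (-ν₀ • X₄ + (α / 2) • X₅)) 0
        fun x₁ x₂ x₃ x₄ x₅ x₆ => (True, ![])
  | g92b (μ₀ ν₀ : ℝ) (hyp : μ₀ * ν₀ ≠ 0) :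
      Row (n54 ++ act 0 (ν₀ • X₃) (-μ₀ • X₂) (μ₀ • X₅) (-ν₀ • X₄)) 2
        fun x₁ x₂ x₃ x₄ x₅ x₆ => (True,
          ![x₁, -x₁ * x₆ - μ₀ * x₂ * x₅ + ν₀ * x₃ * x₄])
  | g92star_a (p : ℝ) (hyp : p ≠ 0) :
      Row (n54' ++ act (p • X₁ + X₃) (p • X₂ + X₄) (-X₁ + p • X₃) (-X₂ + p • X₄)
          ((2 * p) • X₅)) 0
        fun x₁ x₂ x₃ x₄ x₅ x₆ => (True, ![])
  | g92star_b :
      Row (n54' ++ act X₃ X₄ (-X₁) (-X₂) 0) 2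
        fun x₁ x₂ x₃ x₄ x₅ x₆ => (True,
          ![x₅, x₁ ^ 2 + x₂ ^ 2 + x₃ ^ 2 + x₄ ^ 2 - 2 * x₅ * x₆])
  | g93a (α ν₀ : ℝ) (hyp : α ≠ 0) :
      Row (n54 ++ act (α • X₁) ((α / 2) • X₂ + X₄ + ν₀ • X₅) (ν₀ • X₄ + (α / 2) • X₃)
          (X₂ - ν₀ • X₃ + (α / 2) • X₄) (-ν₀ • X₂ + (α / 2) • X₅)) 0
        fun x₁ x₂ x₃ x₄ x₅ x₆ => (True, ![])
  | g93b (ν₀ : ℝ) :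
      Row (n54 ++ act 0 (X₄ + ν₀ • X₅) (ν₀ • X₄) (X₂ - ν₀ • X₃) (-ν₀ • X₂)) 2
        fun x₁ x₂ x₃ x₄ x₅ x₆ => (True,
          ![x₁, (-2 * x₁ * x₆ + 2 * ν₀ * (x₂ * x₃ + x₄ * x₅) - x₂ ^ 2 + x₄ ^ 2) / 2])
  -- nilradical g_{5,5}
  | g94a (lam : ℝ) (hyp : lam + 2 ≠ 0) :
      Row (n55 ++ act ((lam + 2) • X₁) ((lam + 1) • X₂) (lam • X₃) ((2 : ℝ) • X₄) X₅) 0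
        fun x₁ x₂ x₃ x₄ x₅ x₆ => (True, ![])
  | g94b :
      Row (n55 ++ act 0 (-X₂) ((-2 : ℝ) • X₃) ((2 : ℝ) • X₄) X₅) 2
        fun x₁ x₂ x₃ x₄ x₅ x₆ => (True,
          ![x₁, (x₁ ^ 2 * x₆ + x₁ * x₂ * x₅ + 2 * x₁ * x₃ * x₄ - x₂ ^ 2 * x₄) / 2])
  | g95 :
      Row (n55 ++ act ((2 : ℝ) • X₁) X₂ 0 (X₁ + (2 : ℝ) • X₄) X₅) 0
        fun x₁ x₂ x₃ x₄ x₅ x₆ => (True, ![])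
  | g96 :
      Row (n55 ++ act ((3 : ℝ) • X₁) ((2 : ℝ) • X₂) X₃ (X₂ + (2 : ℝ) • X₄) (X₃ + X₅)) 0
        fun x₁ x₂ x₃ x₄ x₅ x₆ => (True, ![])
  | g97 :
      Row (n55 ++ act ((4 : ℝ) • X₁) ((3 : ℝ) • X₂) ((2 : ℝ) • X₃ + X₄) ((2 : ℝ) • X₄) X₅) 0
        fun x₁ x₂ x₃ x₄ x₅ x₆ => (True, ![])
  | g98 (h : ℝ) :
      Row (n55 ++ act X₁ (h • X₁ + X₂) X₃ 0 (h • X₄)) 0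
        fun x₁ x₂ x₃ x₄ x₅ x₆ => (True, ![])
  -- nilradical g_{5,6}
  | g99 :
      Row (n56 ++ act ((5 : ℝ) • X₁) ((4 : ℝ) • X₂) ((3 : ℝ) • X₃) ((2 : ℝ) • X₄) X₅) 0
        fun x₁ x₂ x₃ x₄ x₅ x₆ => (True, ![])

/-- The algebra `g_{6,12}`, whose invariants are complex-valued. -/
inductive ComplexRow : List Bracket → (r : ℕ) → Functions ℂ r → Prop
  | g12 (α p : ℝ) (hyp : α ≠ 0) :
      ComplexRow (n5g1 ++ act (α • X₁) (p • X₂ - X₃) (X₂ + p • X₃) (X₂ + p • X₄ - X₅)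
          (X₃ + X₄ + p • X₅)) 4
        fun x₁ x₂ x₃ x₄ x₅ x₆ =>
          (0 < x₁ ∧ (x₃ + Complex.I * x₂ : ℂ) ∈ Complex.slitPlane ∧
            ((Complex.I * x₄ + x₅) * α - (x₃ + Complex.I * x₂) * log x₁ : ℂ) ∈
              Complex.slitPlane,
          ![(x₃ + Complex.I * x₂ : ℂ) ^ (α : ℂ) * (x₁ : ℂ) ^ (Complex.I - p : ℂ),
            ((Complex.I * x₄ + x₅) * α - (x₃ + Complex.I * x₂) * log x₁ : ℂ) ^ (α : ℂ) /
              (x₁ : ℂ) ^ (p - Complex.I : ℂ),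
            (x₃ - Complex.I * x₂ : ℂ) ^ (α : ℂ) / (x₁ : ℂ) ^ (p + Complex.I : ℂ),
            ((-Complex.I * x₄ + x₅) * α - (x₃ - Complex.I * x₂) * log x₁ : ℂ) ^ (α : ℂ) /
              (x₁ : ℂ) ^ (p + Complex.I : ℂ)])

end

end Coadjoint

/-!
# Invariants of the coadjoint representation of the solvable algebras in the tables

Every algebra in the tables is an extension of a nilpotent algebra `𝔫`, the span of
`X_1, ..., X_5`, by one element `X_6` acting through `A : X_j ↦ [X_j, X_6]`.

*Structure.* The Jacobi identity says that `A` is a derivation of `𝔫` (`IsExtension`); the algebra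
is then solvable because `[𝔤, 𝔤] ⊆ 𝔫` and `𝔫` is nilpotent. A nilpotent ideal larger than `𝔫` would
contain some `y + t X_6` with `t ≠ 0`, and the adjoint action of that element would be nilpotent.
This is excluded if `A` acts injectively on some nonzero quotient of `𝔫 / [𝔫, 𝔫]`, or has a central
eigenvector with non-zero eigenvalue: `isSolvableWithNilradical_of_coord`,
`isSolvableWithNilradical_of_pair` and `isSolvableWithNilradical_of_center`.

*Invariants.* The operators `X̂_i` are, up to sign, the derivatives along the coadjoint vector
fields (`coadField`), so a function is an invariant when its differential annihilates the tangent
spaces of the coadjoint orbits. A differential that annihilates an orbit of codimension at most `r`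
lies in a space of dimension at most `r`. The codimension is at most `r` wherever a suitable
analytic function `R` is non-zero (`GenericCorank`); as soon as `R` is not identically zero this is
a dense set, and on it no `r + 1` invariants can have independent differentials. Hence `r` invariants
with differentials independent on a dense set form a fundamental set (`isFundamentalSetOn_of`). When
`r = 0` there is an open orbit, and invariants are locally constant
(`exists_eq_const_of_isFundamentalSetOn`).

For each nilradical, `spansOrbit_*` lists vectors spanning the tangent spaces and `genericCorank_*`
gives the possible functions `R`. For each row, what remains is to differentiate the listed
functions, by means of the calculus `HasGrad`, and to evaluate the differentials at these vectors
and at a few vectors which show their independence.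

The function `((u + i v) / (u - i v)) ^ (i p)` is `exp (-2 p arctan (v / u))` where `u ≠ 0`
(`unitPow_eq`).
-/

namespace Coadjoint

open scoped ContDiff

/-! ### Solvable algebras with a prescribed nilradical -/

/-- The multiplication of the algebra with brackets `b`, as a bilinear map on coordinates. -/
def brk (b : List Bracket) : (Fin 6 → ℝ) →ₗ[ℝ] (Fin 6 → ℝ) →ₗ[ℝ] (Fin 6 → ℝ) :=
  LinearMap.mk₂ ℝ (fun x y => ∑ i, ∑ j, (x i * y j) • structConst b i j)
    (fun x x' y => by simp only [Pi.add_apply, add_mul, add_smul, Finset.sum_add_distrib])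
    (fun c x y => by simp only [Pi.smul_apply, smul_eq_mul, mul_assoc, mul_smul, Finset.smul_sum])
    (fun x y y' => by simp only [Pi.add_apply, mul_add, add_smul, Finset.sum_add_distrib])
    (fun c x y => by
      simp only [Pi.smul_apply, smul_eq_mul, mul_left_comm _ c, mul_smul, Finset.smul_sum])

theorem brk_apply (b : List Bracket) (x y : Fin 6 → ℝ) :
    brk b x y = ∑ i, ∑ j, (x i * y j) • structConst b i j := rfl

theorem structConst_append (b b' : List Bracket) (i j : Fin 6) :
    structConst (b ++ b') i j = structConst b i j + structConst b' i j := by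
  simp [structConst]

theorem brk_append (b b' : List Bracket) (x y : Fin 6 → ℝ) :
    brk (b ++ b') x y = brk b x y + brk b' x y := by
  simp only [brk_apply, structConst_append, smul_add, Finset.sum_add_distrib]

/-- The linear map `X_j ↦ a_j` for `j ≤ 5`, `X_6 ↦ 0`. -/
def actMap (a₁ a₂ a₃ a₄ a₅ : Fin 6 → ℝ) : (Fin 6 → ℝ) →ₗ[ℝ] (Fin 6 → ℝ) where
  toFun x := x 0 • a₁ + x 1 • a₂ + x 2 • a₃ + x 3 • a₄ + x 4 • a₅
  map_add' x y := by simp only [Pi.add_apply]; module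
  map_smul' c x := by simp only [Pi.smul_apply, smul_eq_mul, RingHom.id_apply]; module

theorem actMap_apply (a₁ a₂ a₃ a₄ a₅ x : Fin 6 → ℝ) :
    actMap a₁ a₂ a₃ a₄ a₅ x = x 0 • a₁ + x 1 • a₂ + x 2 • a₃ + x 3 • a₄ + x 4 • a₅ := rfl

theorem brk_act (a₁ a₂ a₃ a₄ a₅ x y : Fin 6 → ℝ) :
    brk (act a₁ a₂ a₃ a₄ a₅) x y =
      y 5 • actMap a₁ a₂ a₃ a₄ a₅ x - x 5 • actMap a₁ a₂ a₃ a₄ a₅ y := by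
  ext k
  simp [brk_apply, structConst, act, actMap_apply, Fin.sum_univ_six]
  ring

/-- `b` defines a nilpotent Lie algebra structure on the span of `X_1, ..., X_5`; nilpotency is
stated in the form of Engel's theorem. -/
structure IsNilpotentBracket (b : List Bracket) : Prop where
  self (x : Fin 6 → ℝ) : brk b x x = 0
  jacobi (x y z : Fin 6 → ℝ) : brk b x (brk b y z) = brk b (brk b x y) z + brk b y (brk b x z)
  apply_five (x y : Fin 6 → ℝ) : brk b x y 5 = 0
  engel (x : Fin 6 → ℝ) : IsNilpotent (brk b x)

/-- Adjoining `X_6` to a nilpotent algebra by means of a linear map `A`, `[X_j, X_6] = A X_j`. -/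
theorem brk_append_act {n : List Bracket} {a₁ a₂ a₃ a₄ a₅ : Fin 6 → ℝ} (x y : Fin 6 → ℝ) :
    brk (n ++ act a₁ a₂ a₃ a₄ a₅) x y = brk n x y +
      (y 5 • actMap a₁ a₂ a₃ a₄ a₅ x - x 5 • actMap a₁ a₂ a₃ a₄ a₅ y) := by
  rw [brk_append, brk_act]

/-- The nilradical of a Lie algebra with coordinates `e` is the hyperplane `x_6 = 0` if this
hyperplane contains the derived algebra, and if `ad x` is nilpotent on it precisely when `x`
belongs to it. -/
theorem isNilradical_of_equiv {L : Type} [LieRing L] [LieAlgebra ℝ L] {b : List Bracket}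
    (e : (Fin 6 → ℝ) ≃ₗ[ℝ] L) (he : ∀ x y, ⁅e x, e y⁆ = e (brk b x y))
    (h5 : ∀ x y, brk b x y 5 = 0)
    (h0 : ∀ x, x 5 = 0 → ∃ k : ℕ, ∀ y, y 5 = 0 → (brk b x ^ k) y = 0)
    (h1 : ∀ x, (∃ k : ℕ, ∀ y, y 5 = 0 → (brk b x ^ k) y = 0) → x 5 = 0) :
    LieAlgebra.IsSolvable L ∧ ∃ N : LieIdeal ℝ L, IsNilradical N ∧
      N.toSubmodule = Submodule.span ℝ
        (Set.range fun i : Fin 5 => e (Pi.single i.castSucc 1)) := by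
  have hfin : Module.Finite ℝ L := Module.Finite.equiv e
  have he' : ∀ u v : L, e.symm ⁅u, v⁆ = brk b (e.symm u) (e.symm v) := fun u v => by
    rw [LinearEquiv.symm_apply_eq, ← he, e.apply_symm_apply, e.apply_symm_apply]
  let N : LieIdeal ℝ L :=
    { carrier := {u | e.symm u 5 = 0}
      add_mem' := fun {u v} hu hv => by
        change e.symm (u + v) 5 = 0
        rw [map_add, Pi.add_apply, show e.symm u 5 = 0 from hu, show e.symm v 5 = 0 from hv,
          add_zero]
      zero_mem' := by
        change e.symm 0 5 = 0
        rw [map_zero, Pi.zero_apply]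
      smul_mem' := fun c u hu => by
        change e.symm (c • u) 5 = 0
        rw [map_smul, Pi.smul_apply, show e.symm u 5 = 0 from hu, smul_zero]
      lie_mem := fun {u v} _ => by
        change e.symm ⁅u, v⁆ 5 = 0
        rw [he', h5] }
  have hN : ∀ u : L, u ∈ N ↔ e.symm u 5 = 0 := fun _ => Iff.rfl
  have hNnil : LieRing.IsNilpotent N := by
    rw [LieAlgebra.isNilpotent_iff_forall (R := ℝ)]
    intro u
    obtain ⟨k, hk⟩ := h0 _ u.2
    refine ⟨k, LinearMap.ext fun v => Subtype.ext (e.symm.injective ?_)⟩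
    have key : ∀ m : ℕ, e.symm (((LieAlgebra.ad ℝ N u) ^ m) v).1 =
        ((brk b (e.symm u.1)) ^ m) (e.symm v.1) := by
      intro m
      induction m with
      | zero => rfl
      | succ m ih =>
        rw [pow_succ', pow_succ', Module.End.mul_apply, Module.End.mul_apply, ← ih,
          LieAlgebra.ad_apply, LieIdeal.coe_bracket_of_module, ← he']
        rfl
    rw [key, hk _ v.2, LinearMap.zero_apply, ZeroMemClass.coe_zero, map_zero]
  refine ⟨?_, N, ⟨hNnil, fun J hJ u hu => ?_⟩, le_antisymm (fun u hu => ?_) ?_⟩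
  · obtain ⟨k, hk⟩ := (LieAlgebra.isSolvable_iff ℝ N).1 inferInstance
    refine LieAlgebra.IsSolvable.mk (R := ℝ) (k := k + 1) ?_
    rw [LieIdeal.derivedSeries_eq_bot_iff] at hk
    rw [LieAlgebra.derivedSeries_def, LieAlgebra.derivedSeriesOfIdeal_add, eq_bot_iff, ← hk]
    refine LieAlgebra.derivedSeriesOfIdeal_mono ?_ k
    rw [LieAlgebra.derivedSeriesOfIdeal_succ, LieAlgebra.derivedSeriesOfIdeal_zero,
      LieSubmodule.lieIdeal_oper_eq_span, LieSubmodule.lieSpan_le]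
    rintro _ ⟨u, v, rfl⟩
    change e.symm ⁅u.1, v.1⁆ 5 = 0
    rw [he', h5]
  · obtain ⟨k, hk⟩ := LieModule.exists_forall_pow_toEnd_eq_zero ℝ J J
    have hmem : ∀ v : L, ⁅u, v⁆ ∈ J := fun v => by
      rw [← lie_skew]; exact J.neg_mem (J.lie_mem hu)
    refine h1 _ ⟨k + 1, fun y _ => ?_⟩
    have key : ∀ m : ℕ, ((brk b (e.symm u)) ^ (m + 1)) y =
        e.symm ((LieModule.toEnd ℝ J J ⟨u, hu⟩ ^ m) ⟨⁅u, e y⁆, hmem _⟩).1 := by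
      intro m
      induction m with
      | zero => rw [zero_add, pow_one, pow_zero, Module.End.one_apply, he', e.symm_apply_apply]
      | succ m ih =>
        rw [pow_succ', Module.End.mul_apply, ih, pow_succ', Module.End.mul_apply,
          LieModule.toEnd_apply_apply, LieIdeal.coe_bracket_of_module, ← he']
        rfl
    rw [key, hk, LinearMap.zero_apply, ZeroMemClass.coe_zero, map_zero]
  · have h : u = e (∑ i, e.symm u i • Pi.single i 1) := by
      rw [← pi_eq_sum_univ', e.apply_symm_apply]
    rw [h, Fin.sum_univ_castSucc, show e.symm u (Fin.last 5) = 0 from hu, zero_smul, add_zero,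
      map_sum]
    exact Submodule.sum_mem _ fun i _ => by
      rw [map_smul]
      exact Submodule.smul_mem _ _ (Submodule.subset_span ⟨i, rfl⟩)
  · rw [Submodule.span_le]
    rintro _ ⟨i, rfl⟩
    change e.symm (e (Pi.single i.castSucc 1)) 5 = 0
    rw [e.symm_apply_apply]
    exact Pi.single_eq_of_ne (Fin.castSucc_lt_last i).ne' _

/-- The map `X_j ↦ a_j` is a derivation of the nilpotent algebra defined by `n` on the span of
`X_1, ..., X_5`, so that `X_6` can be adjoined to it with `[X_j, X_6] = a_j`. -/
structure IsExtension (n : List Bracket) (a₁ a₂ a₃ a₄ a₅ : Fin 6 → ℝ) : Prop where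
  nilpotent : IsNilpotentBracket n
  apply_five (x : Fin 6 → ℝ) : actMap a₁ a₂ a₃ a₄ a₅ x 5 = 0
  derivation (x y : Fin 6 → ℝ) : actMap a₁ a₂ a₃ a₄ a₅ (brk n x y) =
    brk n (actMap a₁ a₂ a₃ a₄ a₅ x) y + brk n x (actMap a₁ a₂ a₃ a₄ a₅ y)

/-- Adjoining `X_6` gives a solvable Lie algebra. Its nilradical is not larger than the span of
`X_1, ..., X_5` when no `ad (y + t X_6)` with `t ≠ 0` is nilpotent there. -/
theorem isSolvableWithNilradical_of_isExtension {n : List Bracket} {a₁ a₂ a₃ a₄ a₅ : Fin 6 → ℝ}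
    (h : IsExtension n a₁ a₂ a₃ a₄ a₅) (hnil : ∀ (y : Fin 6 → ℝ) (t : ℝ), t ≠ 0 →
      ¬ IsNilpotent (brk n y - t • actMap a₁ a₂ a₃ a₄ a₅)) :
    IsSolvableWithNilradical (n ++ act a₁ a₂ a₃ a₄ a₅) := by
  obtain ⟨hn, h5, hder⟩ := h
  set A := actMap a₁ a₂ a₃ a₄ a₅
  set b := n ++ act a₁ a₂ a₃ a₄ a₅
  have hbr : ∀ x y, brk b x y = brk n x y + (y 5 • A x - x 5 • A y) := brk_append_act
  have hself : ∀ x, brk b x x = 0 := fun x => by rw [hbr, hn.self, sub_self, add_zero]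
  have hjac : ∀ x y z, brk b x (brk b y z) = brk b (brk b x y) z + brk b y (brk b x z) := by
    intro x y z
    have hskew : ∀ x y, brk n x y = -brk n y x := fun x y => by
      have h := hn.self (x + y)
      simp only [map_add, LinearMap.add_apply, hn.self, zero_add, add_zero] at h
      exact eq_neg_of_add_eq_zero_right h
    simp only [hbr, map_add, map_sub, map_smul, LinearMap.add_apply, LinearMap.sub_apply,
      LinearMap.smul_apply, Pi.add_apply, Pi.sub_apply, Pi.smul_apply, h5, hn.apply_five,
      hder, hn.jacobi x y z, smul_eq_mul, mul_zero, sub_self, add_zero, zero_smul, zero_sub]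
    rw [hskew y (A x)]
    module
  have hb5 : ∀ x y, brk b x y 5 = 0 := fun x y => by
    rw [hbr, Pi.add_apply, Pi.sub_apply, Pi.smul_apply, Pi.smul_apply, h5, h5, hn.apply_five]
    simp
  let R : LieRing (Fin 6 → ℝ) :=
    { (inferInstance : AddCommGroup (Fin 6 → ℝ)) with
      bracket := fun x y => brk b x y
      add_lie := fun x y z => LinearMap.congr_fun (map_add (brk b) x y) z
      lie_add := fun x y z => map_add (brk b x) y z
      lie_self := hself
      leibniz_lie := hjac }
  let Al : @LieAlgebra ℝ (Fin 6 → ℝ) _ R :=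
    { (inferInstance : Module ℝ (Fin 6 → ℝ)) with
      lie_smul := fun t x y => map_smul (brk b x) t y }
  have hpow : ∀ x y (k : ℕ), y 5 = 0 → (brk b x ^ k) y = ((brk n x - x 5 • A) ^ k) y ∧
      ((brk b x ^ k) y) 5 = 0 := by
    intro x y k hy
    induction k with
    | zero => exact ⟨rfl, hy⟩
    | succ k ih =>
      rw [pow_succ', pow_succ', Module.End.mul_apply, Module.End.mul_apply, ← ih.1]
      refine ⟨?_, hb5 _ _⟩
      rw [hbr, ih.2, zero_smul, zero_sub, ← sub_eq_add_neg]
      rfl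
  have hmain := @isNilradical_of_equiv (Fin 6 → ℝ) R Al b (LinearEquiv.refl ℝ _)
    (fun _ _ => rfl) hb5
    (fun x hx => by
      obtain ⟨k, hk⟩ := hn.engel x
      refine ⟨k, fun y hy => ?_⟩
      rw [(hpow x y k hy).1, hx, zero_smul, sub_zero, hk]
      rfl)
    (fun x ⟨k, hk⟩ => by
      by_contra hx
      refine hnil x _ hx ⟨k + 1, LinearMap.ext fun y => ?_⟩
      rw [pow_succ, Module.End.mul_apply, ← (hpow x _ k ?_).1, hk _ ?_]
      · rfl
      all_goals simp [h5, hn.apply_five])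
  refine ⟨Fin 6 → ℝ, R, Al, Pi.basisFun ℝ (Fin 6), fun i j => ?_, hmain.1, ?_⟩
  · change brk b _ _ = ∑ k, structConst b i j k • (Pi.basisFun ℝ (Fin 6)) k
    simp only [Pi.basisFun_apply]
    rw [← pi_eq_sum_univ', brk_apply]
    simp [Pi.single_apply]
  · simp only [Pi.basisFun_apply]
    exact hmain.2

/-- A quotient of `𝔫 / [𝔫, 𝔫]` on which the derivation is injective prevents nilpotency. -/
theorem not_isNilpotent_of_quotient {n : List Bracket} {A : (Fin 6 → ℝ) →ₗ[ℝ] (Fin 6 → ℝ)}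
    {M : Type*} [AddCommGroup M] [Module ℝ M] (f : (Fin 6 → ℝ) →ₗ[ℝ] M)
    (hf : ∀ x y, f (brk n x y) = 0) (hA : ∀ v, f (A v) = 0 → f v = 0) (h0 : f ≠ 0)
    (y : Fin 6 → ℝ) (t : ℝ) (ht : t ≠ 0) : ¬ IsNilpotent (brk n y - t • A) := by
  rintro ⟨k, hk⟩
  refine h0 (LinearMap.ext fun v => ?_)
  by_contra hv
  have key : ∀ m : ℕ, f (((brk n y - t • A) ^ m) v) ≠ 0 := by
    intro m
    induction m with
    | zero => exact hv
    | succ m ih =>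
      rw [pow_succ', Module.End.mul_apply, LinearMap.sub_apply, map_sub, hf, zero_sub, neg_ne_zero,
        LinearMap.smul_apply, map_smul]
      exact smul_ne_zero ht fun h => ih (hA _ h)
  exact key k (by rw [hk, LinearMap.zero_apply, map_zero])

/-- A central eigenvector of the derivation with non-zero eigenvalue prevents nilpotency. -/
theorem not_isNilpotent_of_center {n : List Bracket} {A : (Fin 6 → ℝ) →ₗ[ℝ] (Fin 6 → ℝ)}
    {v : Fin 6 → ℝ} (hv : v ≠ 0) (hc : ∀ y, brk n y v = 0) {c : ℝ} (hc0 : c ≠ 0)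
    (hA : A v = c • v) (y : Fin 6 → ℝ) (t : ℝ) (ht : t ≠ 0) :
    ¬ IsNilpotent (brk n y - t • A) := by
  rintro ⟨k, hk⟩
  have key : ∀ m : ℕ, ((brk n y - t • A) ^ m) v = (-(t * c)) ^ m • v := by
    intro m
    induction m with
    | zero => simp
    | succ m ih =>
      rw [pow_succ', Module.End.mul_apply, ih, map_smul, LinearMap.sub_apply, hc,
        LinearMap.smul_apply, hA, pow_succ]
      module
  have h := key k
  rw [hk, LinearMap.zero_apply, eq_comm] at h
  exact smul_ne_zero (pow_ne_zero _ (neg_ne_zero.2 (mul_ne_zero ht hc0))) hv h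

end Coadjoint

namespace Coadjoint

/-! ### The nilpotent algebras and their derivations -/

/-!
For each nilpotent algebra `n` of the tables, the hypothesis `h` of `isExtension_n` writes out in
coordinates that `X_j ↦ a_j` is a derivation, and `h5` that the `a_j` lie in the span of
`X_1, ..., X_5`. For explicit vectors `a_j` both are checked by the default tactics.
-/

section

variable {a₁ a₂ a₃ a₄ a₅ : Fin 6 → ℝ}

/-- Nilpotency from an explicit formula `β` for the bracket. -/
theorem isNilpotentBracket_of {b : List Bracket} {β : (Fin 6 → ℝ) → (Fin 6 → ℝ) → Fin 6 → ℝ}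
    (h : ∀ x y, brk b x y = β x y) (hself : ∀ x, β x x = 0)
    (hjac : ∀ x y z, β x (β y z) = β (β x y) z + β y (β x z)) (h5 : ∀ x y, β x y 5 = 0)
    (k : ℕ) (hk : ∀ x y, (β x)^[k] y = 0) : IsNilpotentBracket b where
  self x := by rw [h, hself]
  jacobi x y z := by simp only [h, hjac x y z]
  apply_five x y := by rw [h, h5]
  engel x := ⟨k, LinearMap.ext fun y => by
    rw [Module.End.pow_apply, show ⇑(brk b x) = β x from funext (h x), hk]
    rfl⟩

/-- The last coordinate of the derivation identity is automatic, since both sides lie in the span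
of `X_1, ..., X_5`. -/
theorem isExtension_of {n : List Bracket} (hn : IsNilpotentBracket n)
    (h5 : a₁ 5 = 0 ∧ a₂ 5 = 0 ∧ a₃ 5 = 0 ∧ a₄ 5 = 0 ∧ a₅ 5 = 0)
    (hder : ∀ x y (k : Fin 5), actMap a₁ a₂ a₃ a₄ a₅ (brk n x y) k.castSucc =
      brk n (actMap a₁ a₂ a₃ a₄ a₅ x) y k.castSucc +
        brk n x (actMap a₁ a₂ a₃ a₄ a₅ y) k.castSucc) : IsExtension n a₁ a₂ a₃ a₄ a₅ := by
  have h : ∀ x, actMap a₁ a₂ a₃ a₄ a₅ x 5 = 0 := fun x => by simp [actMap_apply, h5]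
  refine ⟨hn, h, fun x y => funext fun k => Fin.lastCases ?_ (hder x y) k⟩
  exact (h _).trans (by rw [Pi.add_apply]; simp [hn.apply_five, Fin.last])

theorem brk_n5g1 (x y : Fin 6 → ℝ) : brk n5g1 x y = 0 := by
  simp [brk_apply, structConst, n5g1]

theorem isNilpotentBracket_n5g1 : IsNilpotentBracket n5g1 :=
  isNilpotentBracket_of brk_n5g1 (fun _ => rfl) (fun _ _ _ => (add_zero _).symm)
    (fun _ _ => rfl) 1 fun _ _ => rfl

theorem isExtension_n5g1
    (h5 : a₁ 5 = 0 ∧ a₂ 5 = 0 ∧ a₃ 5 = 0 ∧ a₄ 5 = 0 ∧ a₅ 5 = 0 := by simp) :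
    IsExtension n5g1 a₁ a₂ a₃ a₄ a₅ :=
  isExtension_of isNilpotentBracket_n5g1 h5 fun x y k => by simp [brk_n5g1]

theorem brk_n31 (x y : Fin 6 → ℝ) :
    brk n31 x y = ![x 1 * y 2 - x 2 * y 1, 0, 0, 0, 0, 0] := by
  ext k
  fin_cases k <;> simp [brk_apply, structConst, n31, Fin.sum_univ_six]; ring

theorem isNilpotentBracket_n31 : IsNilpotentBracket n31 :=
  isNilpotentBracket_of brk_n31 (fun x => by ext k; fin_cases k <;> simp; ring)
    (fun x y z => by ext k; fin_cases k <;> simp) (fun _ _ => rfl) 2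
    fun x y => by ext k; fin_cases k <;> simp

theorem isExtension_n31
    (h : a₁ 2 = 0 ∧ a₁ 1 = 0 ∧ a₁ 0 = a₂ 1 + a₃ 2 ∧ a₁ 3 = 0 ∧ a₁ 4 = 0 ∧ a₄ 2 = 0 ∧ a₅ 2 = 0 ∧
      a₄ 1 = 0 ∧ a₅ 1 = 0 := by
      simp <;> and_intros <;> ring)
    (h5 : a₁ 5 = 0 ∧ a₂ 5 = 0 ∧ a₃ 5 = 0 ∧ a₄ 5 = 0 ∧ a₅ 5 = 0 := by simp) :
    IsExtension n31 a₁ a₂ a₃ a₄ a₅ :=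
  isExtension_of isNilpotentBracket_n31 h5 fun x y k => by
    fin_cases k <;> simp [brk_n31, actMap_apply, -mul_eq_zero] <;> grind

theorem brk_n41 (x y : Fin 6 → ℝ) :
    brk n41 x y = ![(x 3 * y 4 - x 4 * y 3), (x 0 * y 4 - x 4 * y 0), 0, 0, 0, 0] := by
  ext k
  fin_cases k <;> simp [brk_apply, structConst, n41, Fin.sum_univ_six] <;> ring

theorem isNilpotentBracket_n41 : IsNilpotentBracket n41 :=
  isNilpotentBracket_of brk_n41 (fun x => by ext k; fin_cases k <;> simp <;> ring)
    (fun x y z => by ext k; fin_cases k <;> simp; ring) (fun _ _ => rfl) 3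
    fun x y => by ext k; fin_cases k <;> simp

theorem isExtension_n41
    (h : a₂ 4 = 0 ∧ a₃ 4 = 0 ∧ a₁ 4 = 0 ∧ a₄ 4 = 0 ∧ a₂ 0 = a₁ 3 ∧ a₂ 1 = a₁ 0 + a₅ 4 ∧
      a₂ 2 = 0 ∧ a₂ 3 = 0 ∧ a₂ 0 = 0 ∧ a₃ 3 = 0 ∧ a₃ 0 = 0 ∧ a₁ 0 = a₄ 3 + a₅ 4 ∧
      a₁ 1 = a₄ 0 ∧ a₁ 2 = 0 ∧ a₁ 3 = 0 := by
      simp <;> and_intros <;> ring)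
    (h5 : a₁ 5 = 0 ∧ a₂ 5 = 0 ∧ a₃ 5 = 0 ∧ a₄ 5 = 0 ∧ a₅ 5 = 0 := by simp) :
    IsExtension n41 a₁ a₂ a₃ a₄ a₅ :=
  isExtension_of isNilpotentBracket_n41 h5 fun x y k => by
    fin_cases k <;> simp [brk_n41, actMap_apply, -mul_eq_zero] <;> grind

theorem brk_n51 (x y : Fin 6 → ℝ) :
    brk n51 x y = ![(x 2 * y 4 - x 4 * y 2), (x 3 * y 4 - x 4 * y 3), 0, 0, 0, 0] := by
  ext k
  fin_cases k <;> simp [brk_apply, structConst, n51, Fin.sum_univ_six] <;> ring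

theorem isNilpotentBracket_n51 : IsNilpotentBracket n51 :=
  isNilpotentBracket_of brk_n51 (fun x => by ext k; fin_cases k <;> simp <;> ring)
    (fun x y z => by ext k; fin_cases k <;> simp) (fun _ _ => rfl) 2
    fun x y => by ext k; fin_cases k <;> simp

theorem isExtension_n51
    (h : a₁ 4 = 0 ∧ a₁ 2 = 0 ∧ a₁ 3 = 0 ∧ a₂ 4 = 0 ∧ a₂ 2 = 0 ∧ a₂ 3 = 0 ∧ a₄ 4 = 0 ∧
      a₃ 4 = 0 ∧ a₁ 0 = a₃ 2 + a₅ 4 ∧ a₁ 1 = a₃ 3 ∧ a₂ 0 = a₄ 2 ∧ a₂ 1 = a₄ 3 + a₅ 4 := by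
      simp <;> and_intros <;> ring)
    (h5 : a₁ 5 = 0 ∧ a₂ 5 = 0 ∧ a₃ 5 = 0 ∧ a₄ 5 = 0 ∧ a₅ 5 = 0 := by simp) :
    IsExtension n51 a₁ a₂ a₃ a₄ a₅ :=
  isExtension_of isNilpotentBracket_n51 h5 fun x y k => by
    fin_cases k <;> simp [brk_n51, actMap_apply, -mul_eq_zero] <;> grind

theorem brk_n52 (x y : Fin 6 → ℝ) :
    brk n52 x y =
      ![(x 1 * y 4 - x 4 * y 1), (x 2 * y 4 - x 4 * y 2), (x 3 * y 4 - x 4 * y 3), 0, 0, 0] := by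
  ext k
  fin_cases k <;> simp [brk_apply, structConst, n52, Fin.sum_univ_six] <;> ring

theorem isNilpotentBracket_n52 : IsNilpotentBracket n52 :=
  isNilpotentBracket_of brk_n52 (fun x => by ext k; fin_cases k <;> simp <;> ring)
    (fun x y z => by ext k; fin_cases k <;> simp <;> ring) (fun _ _ => rfl) 4
    fun x y => by ext k; fin_cases k <;> simp

theorem isExtension_n52
    (h : a₁ 4 = 0 ∧ a₁ 1 = 0 ∧ a₁ 2 = 0 ∧ a₁ 3 = 0 ∧ a₃ 4 = 0 ∧ a₂ 4 = 0 ∧ a₄ 4 = 0 ∧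
      a₁ 0 = a₂ 1 + a₅ 4 ∧ a₁ 1 = a₂ 2 ∧ a₁ 2 = a₂ 3 ∧ a₂ 0 = a₃ 1 ∧ a₂ 1 = a₃ 2 + a₅ 4 ∧
      a₂ 2 = a₃ 3 ∧ a₂ 3 = 0 ∧ a₃ 0 = a₄ 1 ∧ a₃ 1 = a₄ 2 ∧ a₃ 2 = a₄ 3 + a₅ 4 ∧ a₃ 3 = 0 := by
      simp <;> and_intros <;> ring)
    (h5 : a₁ 5 = 0 ∧ a₂ 5 = 0 ∧ a₃ 5 = 0 ∧ a₄ 5 = 0 ∧ a₅ 5 = 0 := by simp) :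
    IsExtension n52 a₁ a₂ a₃ a₄ a₅ :=
  isExtension_of isNilpotentBracket_n52 h5 fun x y k => by
    fin_cases k <;> simp [brk_n52, actMap_apply, -mul_eq_zero] <;> grind

theorem brk_n53 (x y : Fin 6 → ℝ) :
    brk n53 x y =
      ![(x 1 * y 4 - x 4 * y 1), (x 3 * y 4 - x 4 * y 3), (x 1 * y 3 - x 3 * y 1), 0, 0, 0] := by
  ext k
  fin_cases k <;> simp [brk_apply, structConst, n53, Fin.sum_univ_six] <;> ring

theorem isNilpotentBracket_n53 : IsNilpotentBracket n53 :=
  isNilpotentBracket_of brk_n53 (fun x => by ext k; fin_cases k <;> simp <;> ring)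
    (fun x y z => by ext k; fin_cases k <;> simp <;> ring) (fun _ _ => rfl) 3
    fun x y => by ext k; fin_cases k <;> simp

theorem isExtension_n53
    (h : a₁ 4 = 0 ∧ a₁ 3 = 0 ∧ a₁ 1 = 0 ∧ a₃ 4 = 0 ∧ a₃ 3 = 0 ∧ a₃ 0 = a₄ 4 ∧ a₃ 1 + a₂ 4 = 0 ∧
      a₃ 2 = a₂ 1 + a₄ 3 ∧ a₁ 0 = a₂ 1 + a₅ 4 ∧ a₁ 1 = a₂ 3 ∧ a₁ 2 = a₅ 3 ∧ a₃ 1 = 0 ∧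
      a₂ 0 = a₄ 1 ∧ a₂ 1 = a₄ 3 + a₅ 4 ∧ a₂ 2 + a₅ 1 = 0 ∧ a₂ 3 = 0 ∧ a₂ 4 = 0 := by
      simp <;> and_intros <;> ring)
    (h5 : a₁ 5 = 0 ∧ a₂ 5 = 0 ∧ a₃ 5 = 0 ∧ a₄ 5 = 0 ∧ a₅ 5 = 0 := by simp) :
    IsExtension n53 a₁ a₂ a₃ a₄ a₅ :=
  isExtension_of isNilpotentBracket_n53 h5 fun x y k => by
    fin_cases k <;> simp [brk_n53, actMap_apply, -mul_eq_zero] <;> grind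

theorem brk_n54 (x y : Fin 6 → ℝ) :
    brk n54 x y = ![(x 1 * y 3 - x 3 * y 1) + (x 2 * y 4 - x 4 * y 2), 0, 0, 0, 0, 0] := by
  ext k
  fin_cases k <;> simp [brk_apply, structConst, n54, Fin.sum_univ_six]; ring

theorem isNilpotentBracket_n54 : IsNilpotentBracket n54 :=
  isNilpotentBracket_of brk_n54 (fun x => by ext k; fin_cases k <;> simp; ring)
    (fun x y z => by ext k; fin_cases k <;> simp) (fun _ _ => rfl) 2
    fun x y => by ext k; fin_cases k <;> simp

theorem isExtension_n54
    (h : a₁ 3 = 0 ∧ a₁ 4 = 0 ∧ a₁ 1 = 0 ∧ a₁ 2 = 0 ∧ a₂ 4 = a₃ 3 ∧ a₁ 0 = a₂ 1 + a₄ 3 ∧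
      0 = a₂ 2 + a₅ 3 ∧ 0 = a₃ 1 + a₄ 4 ∧ a₁ 0 = a₃ 2 + a₅ 4 ∧ a₅ 1 = a₄ 2 := by
      simp <;> and_intros <;> ring)
    (h5 : a₁ 5 = 0 ∧ a₂ 5 = 0 ∧ a₃ 5 = 0 ∧ a₄ 5 = 0 ∧ a₅ 5 = 0 := by simp) :
    IsExtension n54 a₁ a₂ a₃ a₄ a₅ :=
  isExtension_of isNilpotentBracket_n54 h5 fun x y k => by
    fin_cases k <;> simp [brk_n54, actMap_apply, -mul_eq_zero] <;> grind

theorem brk_n54' (x y : Fin 6 → ℝ) :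
    brk n54' x y = ![0, 0, 0, 0, (x 1 * y 3 - x 3 * y 1) + (x 0 * y 2 - x 2 * y 0), 0] := by
  ext k
  fin_cases k <;> simp [brk_apply, structConst, n54', Fin.sum_univ_six]; ring

theorem isNilpotentBracket_n54' : IsNilpotentBracket n54' :=
  isNilpotentBracket_of brk_n54' (fun x => by ext k; fin_cases k <;> simp; ring)
    (fun x y z => by ext k; fin_cases k <;> simp) (fun _ _ => rfl) 2
    fun x y => by ext k; fin_cases k <;> simp

theorem isExtension_n54'
    (h : a₁ 3 = a₂ 2 ∧ a₅ 0 = 0 ∧ a₅ 1 = 0 ∧ a₅ 2 = 0 ∧ a₅ 3 = 0 ∧ a₅ 4 = a₁ 0 + a₃ 2 ∧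
      0 = a₁ 1 + a₄ 2 ∧ 0 = a₂ 0 + a₃ 3 ∧ a₅ 4 = a₂ 1 + a₄ 3 ∧ a₄ 0 = a₃ 1 := by
      simp <;> and_intros <;> ring)
    (h5 : a₁ 5 = 0 ∧ a₂ 5 = 0 ∧ a₃ 5 = 0 ∧ a₄ 5 = 0 ∧ a₅ 5 = 0 := by simp) :
    IsExtension n54' a₁ a₂ a₃ a₄ a₅ :=
  isExtension_of isNilpotentBracket_n54' h5 fun x y k => by
    fin_cases k <;> simp [brk_n54', actMap_apply, -mul_eq_zero] <;> grind

theorem brk_n55 (x y : Fin 6 → ℝ) :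
    brk n55 x y =
      ![(x 2 * y 3 - x 3 * y 2) + (x 1 * y 4 - x 4 * y 1), (x 2 * y 4 - x 4 * y 2), 0, 0, 0,
        0] := by
  ext k
  fin_cases k <;> simp [brk_apply, structConst, n55, Fin.sum_univ_six] <;> ring

theorem isNilpotentBracket_n55 : IsNilpotentBracket n55 :=
  isNilpotentBracket_of brk_n55 (fun x => by ext k; fin_cases k <;> simp <;> ring)
    (fun x y z => by ext k; fin_cases k <;> simp; ring) (fun _ _ => rfl) 3
    fun x y => by ext k; fin_cases k <;> simp

theorem isExtension_n55
    (h : a₁ 4 = 0 ∧ a₁ 3 = 0 ∧ a₁ 2 = 0 ∧ a₁ 1 = 0 ∧ a₂ 3 = a₃ 4 ∧ a₂ 4 = 0 ∧ 0 = a₂ 2 + a₄ 4 ∧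
      a₁ 0 = a₂ 1 + a₅ 4 ∧ a₁ 1 = a₂ 2 ∧ a₁ 0 = a₃ 2 + a₄ 3 ∧ a₁ 1 = a₄ 4 ∧
      a₂ 0 = a₃ 1 + a₅ 3 ∧ a₂ 1 = a₃ 2 + a₅ 4 ∧ a₂ 2 = 0 ∧ a₂ 3 = 0 ∧ a₅ 2 = a₄ 1 ∧
      a₄ 2 = 0 := by
      simp <;> and_intros <;> ring)
    (h5 : a₁ 5 = 0 ∧ a₂ 5 = 0 ∧ a₃ 5 = 0 ∧ a₄ 5 = 0 ∧ a₅ 5 = 0 := by simp) :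
    IsExtension n55 a₁ a₂ a₃ a₄ a₅ :=
  isExtension_of isNilpotentBracket_n55 h5 fun x y k => by
    fin_cases k <;> simp [brk_n55, actMap_apply, -mul_eq_zero] <;> grind

theorem brk_n56 (x y : Fin 6 → ℝ) :
    brk n56 x y = ![(x 2 * y 3 - x 3 * y 2) + (x 1 * y 4 - x 4 * y 1), (x 2 * y 4 - x 4 * y 2),
        (x 3 * y 4 - x 4 * y 3), 0, 0, 0] := by
  ext k
  fin_cases k <;> simp [brk_apply, structConst, n56, Fin.sum_univ_six] <;> ring

theorem isNilpotentBracket_n56 : IsNilpotentBracket n56 :=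
  isNilpotentBracket_of brk_n56 (fun x => by ext k; fin_cases k <;> simp <;> ring)
    (fun x y z => by ext k; fin_cases k <;> simp <;> ring) (fun _ _ => rfl) 4
    fun x y => by ext k; fin_cases k <;> simp

theorem isExtension_n56
    (h : a₁ 4 = 0 ∧ a₁ 3 = 0 ∧ a₁ 2 = 0 ∧ a₁ 1 = 0 ∧ a₂ 3 = a₃ 4 ∧ a₂ 4 = 0 ∧ 0 = a₂ 2 + a₄ 4 ∧
      a₁ 0 = a₂ 1 + a₅ 4 ∧ a₁ 1 = a₂ 2 ∧ a₁ 2 = a₂ 3 ∧ a₁ 0 = a₃ 2 + a₄ 3 ∧ a₁ 1 = a₄ 4 ∧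
      a₁ 2 + a₃ 4 = 0 ∧ a₂ 0 = a₃ 1 + a₅ 3 ∧ a₂ 1 = a₃ 2 + a₅ 4 ∧ a₂ 2 = a₃ 3 ∧ a₂ 3 = 0 ∧
      a₃ 0 + a₅ 2 = a₄ 1 ∧ a₃ 1 = a₄ 2 ∧ a₃ 2 = a₄ 3 + a₅ 4 ∧ a₃ 3 = 0 ∧ a₃ 4 = 0 := by
      simp <;> and_intros <;> ring)
    (h5 : a₁ 5 = 0 ∧ a₂ 5 = 0 ∧ a₃ 5 = 0 ∧ a₄ 5 = 0 ∧ a₅ 5 = 0 := by simp) :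
    IsExtension n56 a₁ a₂ a₃ a₄ a₅ :=
  isExtension_of isNilpotentBracket_n56 h5 fun x y k => by
    fin_cases k <;> simp [brk_n56, actMap_apply, -mul_eq_zero] <;> grind

end

end Coadjoint

namespace Coadjoint

open scoped ContDiff

/-! ### Coadjoint vector fields and fundamental sets -/

/-- The pairing of a vector of the algebra with a point of the dual space. -/
def dot (a x : Fin 6 → ℝ) : ℝ := ∑ k, a k * x k

theorem dot_add (a b x : Fin 6 → ℝ) : dot (a + b) x = dot a x + dot b x := by
  simp [dot, add_mul, Finset.sum_add_distrib]

theorem dot_sub (a b x : Fin 6 → ℝ) : dot (a - b) x = dot a x - dot b x := by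
  simp [dot, sub_mul, Finset.sum_sub_distrib]

theorem dot_smul (c : ℝ) (a x : Fin 6 → ℝ) : dot (c • a) x = c * dot a x := by
  simp [dot, Finset.mul_sum, mul_assoc]

theorem dot_zero (x : Fin 6 → ℝ) : dot 0 x = 0 := by simp [dot]

attribute [local simp] dot_add dot_sub dot_smul dot_zero

/-- The value at `x` of the vector field on the dual space given by the element `v`: its `j`-th
component is the pairing of `[v, X_j]` with `x`. -/
def coadField (b : List Bracket) (x v : Fin 6 → ℝ) : Fin 6 → ℝ :=
  fun j => dot (brk b v (Pi.single j 1)) x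

theorem brk_single (b : List Bracket) (i j : Fin 6) :
    brk b (Pi.single i 1) (Pi.single j 1) = structConst b i j := by
  simp [brk_apply, Pi.single_apply]

variable {𝕜 : Type} [RCLike 𝕜]

theorem coadjointOp_eq (b : List Bracket) (i : Fin 6) (F : (Fin 6 → ℝ) → 𝕜) (x : Fin 6 → ℝ) :
    coadjointOp (structConst b) i F x = -fderiv ℝ F x (coadField b x (Pi.single i 1)) := by
  rw [coadjointOp, pi_eq_sum_univ' (coadField b x (Pi.single i 1)), map_sum]
  simp only [map_smul, coadField, brk_single, dot]

/-- The components of a coadjoint vector field: `X_6` contributes the linear field of `A`, and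
every `X_i` with `i ≤ 5` contributes a multiple of `∂/∂x_6`. -/
theorem coadField_append_act (n : List Bracket) (a₁ a₂ a₃ a₄ a₅ x v : Fin 6 → ℝ) :
    coadField (n ++ act a₁ a₂ a₃ a₄ a₅) x v = coadField n x v +
      (dot (actMap a₁ a₂ a₃ a₄ a₅ v) x • Pi.single 5 1 -
        v 5 • ![dot a₁ x, dot a₂ x, dot a₃ x, dot a₄ x, dot a₅ x, 0]) := by
  ext j
  simp only [coadField, brk_append_act, Pi.add_apply, Pi.sub_apply, Pi.smul_apply, dot_add,
    dot_sub, dot_smul, smul_eq_mul]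
  congr 2
  · simp [Pi.single_apply, mul_comm, eq_comm]
  · congr 1
    fin_cases j <;> simp [actMap_apply]

/-- The annihilator of the coadjoint orbit through `x` has dimension at most `r`: a covector on
the orbit's normal space is determined by `r` of its coordinates. -/
def CorankLE (𝕜 : Type) [RCLike 𝕜] (b : List Bracket) (r : ℕ) (x : Fin 6 → ℝ) : Prop :=
  ∃ s : Fin r → Fin 6, ∀ L : (Fin 6 → ℝ) →L[ℝ] 𝕜,
    (∀ i, L (coadField b x (Pi.single i 1)) = 0) → (∀ n, L (Pi.single (s n) 1) = 0) → L = 0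

/-- The coadjoint orbits have codimension at most `r` at the points where the analytic function `R`
does not vanish. This is a dense set of points as soon as `R` is not identically zero. -/
def GenericCorank (𝕜 : Type) [RCLike 𝕜] (b : List Bracket) (r : ℕ) (R : (Fin 6 → ℝ) → ℝ) : Prop :=
  AnalyticOnNhd ℝ R Set.univ ∧ ∀ x, R x ≠ 0 → CorankLE 𝕜 b r x

theorem analyticOnNhd_apply (i : Fin 6) :
    AnalyticOnNhd ℝ (fun x : Fin 6 → ℝ => x i) Set.univ :=
  (ContinuousLinearMap.proj (R := ℝ) (φ := fun _ : Fin 6 => ℝ) i).analyticOnNhd _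

theorem IsInvariantOn.fderiv_coadField {b : List Bracket} {U : Set (Fin 6 → ℝ)}
    {F : (Fin 6 → ℝ) → 𝕜} (hF : IsInvariantOn (structConst b) U F) {x : Fin 6 → ℝ} (hx : x ∈ U)
    (i : Fin 6) : fderiv ℝ F x (coadField b x (Pi.single i 1)) = 0 :=
  neg_eq_zero.1 ((coadjointOp_eq b i F x).symm.trans (hF.2 x hx i))

/-- More covectors than the corank are linearly dependent. -/
theorem CorankLE.not_linearIndependent {b : List Bracket} {r : ℕ} {x : Fin 6 → ℝ}
    (h : CorankLE 𝕜 b r x) (L : Fin (r + 1) → (Fin 6 → ℝ) →L[ℝ] 𝕜)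
    (hL : ∀ n i, L n (coadField b x (Pi.single i 1)) = 0) : ¬ LinearIndependent 𝕜 L := by
  obtain ⟨s, hs⟩ := h
  intro hli
  let ev : ((Fin 6 → ℝ) →L[ℝ] 𝕜) →ₗ[𝕜] (Fin r → 𝕜) :=
    { toFun := fun M n => M (Pi.single (s n) 1)
      map_add' := fun _ _ => rfl
      map_smul' := fun _ _ => rfl }
  have hdis : Disjoint (Submodule.span 𝕜 (Set.range L)) (LinearMap.ker ev) := by
    rw [Submodule.disjoint_def]
    intro M hM hev
    refine hs M (fun i => ?_) fun n => congrFun (LinearMap.mem_ker.1 hev) n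
    clear hev
    induction hM using Submodule.span_induction with
    | mem M hM => obtain ⟨n, rfl⟩ := hM; exact hL n i
    | zero => rfl
    | add M M' _ _ h h' => rw [add_apply, h, h', add_zero]
    | smul c M _ h => rw [smul_apply, h, smul_zero]
  have hli' := hli.map hdis
  simpa using hli'.fintype_card_le_finrank

/-- An analytic function that does not vanish identically is nonzero on a dense set. -/
theorem dense_ne_zero {G : (Fin 6 → ℝ) → ℝ} (hG : AnalyticOnNhd ℝ G Set.univ) {x₀ : Fin 6 → ℝ}
    (hx₀ : G x₀ ≠ 0) : Dense {x | G x ≠ 0} := by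
  rw [dense_iff_inter_open]
  rintro V hV ⟨x, hx⟩
  by_contra! h
  have h0 : G =ᶠ[nhds x] 0 := Filter.eventually_of_mem (hV.mem_nhds hx) fun y hy => by
    by_contra hne
    exact Set.notMem_empty y (h ▸ ⟨hy, hne⟩)
  have := hG.eqOn_of_preconnected_of_eventuallyEq (g := 0) (fun _ _ => analyticAt_const)
    isPreconnected_univ (Set.mem_univ x) h0 (Set.mem_univ x₀)
  exact hx₀ this

/-- A criterion for fundamental sets: the coadjoint orbits have codimension at most `r` where an
analytic function `R` does not vanish, and the differentials of the invariants are independent on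
a dense set. -/
theorem isFundamentalSetOn_of {b : List Bracket} {r : ℕ} {U : Set (Fin 6 → ℝ)}
    {f : Fin r → (Fin 6 → ℝ) → 𝕜} {R G : (Fin 6 → ℝ) → ℝ} (hU : IsOpen U)
    (hR : GenericCorank 𝕜 b r R) (hG : Dense {x | G x ≠ 0}) {x₀ : Fin 6 → ℝ}
    (hx₀ : x₀ ∈ U ∧ R x₀ ≠ 0)
    (hf : ∀ x ∈ U, ∀ n, ContDiffAt ℝ ∞ (f n) x ∧
      ∀ i, fderiv ℝ (f n) x (coadField b x (Pi.single i 1)) = 0)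
    (hli : ∀ x ∈ U, R x ≠ 0 → G x ≠ 0 → LinearIndependent 𝕜 fun n => fderiv ℝ (f n) x) :
    IsFundamentalSetOn (structConst b) U f := by
  have hRo : IsOpen {x | R x ≠ 0} :=
    isOpen_ne_fun (continuousOn_univ.1 hR.1.continuousOn) continuous_const
  have hRd : Dense {x | R x ≠ 0} := dense_ne_zero hR.1 hx₀.2
  have hinv : ∀ n, IsInvariantOn (structConst b) U (f n) := fun n =>
    ⟨fun x hx => (hf x hx n).1.contDiffWithinAt, fun x hx i => by
      rw [coadjointOp_eq, (hf x hx n).2 i, neg_zero]⟩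
  refine ⟨hU, ⟨x₀, hx₀.1⟩, hinv, fun x hx => ?_, fun V hVU hV hVne F hF hind => ?_⟩
  · rw [mem_closure_iff]
    intro O hO hxO
    obtain ⟨y, hy, hRy, hGy⟩ := (hRd.inter_of_isOpen_left hG hRo).inter_open_nonempty (O ∩ U)
      (hO.inter hU) ⟨x, hxO, hx⟩
    exact ⟨y, hy.1, hy.2, hli y hy.2 hRy hGy⟩
  · obtain ⟨y, hy, hRy⟩ := hRd.inter_open_nonempty V hV hVne
    obtain ⟨z, ⟨hzV, hRz⟩, hz⟩ := mem_closure_iff.1 (hind hy) _ (hV.inter hRo) ⟨hy, hRy⟩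
    refine (hR.2 z hRz).not_linearIndependent _ (fun n i => ?_) hz.2
    refine Fin.cases ?_ (fun m => ?_) n
    · exact hF.fderiv_coadField hzV i
    · exact (hf z (hVU hzV) m).2 i

/-- If the empty set is a fundamental set on the whole space, all invariants are locally
constant: the differential of an invariant cannot be non-zero on a nonempty open set. -/
theorem exists_eq_const_of_isFundamentalSetOn {b : List Bracket}
    {f : Fin 0 → (Fin 6 → ℝ) → ℝ} (h : IsFundamentalSetOn (structConst b) Set.univ f)
    {V : Set (Fin 6 → ℝ)} (hV : IsOpen V) (hVc : IsPreconnected V) {F : (Fin 6 → ℝ) → ℝ}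
    (hF : IsInvariantOn (structConst b) V F) : ∃ a : ℝ, ∀ x ∈ V, F x = a := by
  have hd : ∀ x ∈ V, fderiv ℝ F x = 0 := by
    by_contra! hne
    obtain ⟨x, hx, hne⟩ := hne
    have hcont : ContinuousOn (fderiv ℝ F) V := hF.1.continuousOn_fderiv_of_isOpen hV (by simp)
    have hO : IsOpen (V ∩ fderiv ℝ F ⁻¹' {0}ᶜ) :=
      hcont.isOpen_inter_preimage hV isOpen_compl_singleton
    refine h.2.2.2.2 _ (Set.subset_univ _) hO ⟨x, hx, hne⟩ F
      ⟨hF.1.mono Set.inter_subset_left, fun y hy => hF.2 y hy.1⟩ ?_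
    intro y hy
    refine subset_closure ⟨hy, ?_⟩
    exact (linearIndependent_unique_iff (ι := Fin 1)
      (v := fun n => fderiv ℝ ((Fin.cons F f : Fin 1 → (Fin 6 → ℝ) → ℝ) n) y)).2 hy.2
  exact hV.exists_is_const_of_fderiv_eq_zero hVc
    (fun x hx => ((hF.1.contDiffAt (hV.mem_nhds hx)).differentiableAt
      (by simp)).differentiableWithinAt)
    fun x hx => hd x hx

end Coadjoint

namespace Coadjoint

open scoped ContDiff

section

open Real (exp log arctan)

/-! ### Differentiation of the listed functions -/

variable {𝕜 : Type} [RCLike 𝕜]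

/-- `F` is smooth at `x` and its derivative there in the direction `v` is `F' v`. The lemmas below
follow the way in which the listed functions are composed, so that a term of this type both proves
smoothness and computes the derivative. -/
structure HasGrad (F F' : (Fin 6 → ℝ) → 𝕜) (x : Fin 6 → ℝ) : Prop where
  contDiffAt : ContDiffAt ℝ ∞ F x
  fderiv_apply : ∀ v, fderiv ℝ F x v = F' v

namespace HasGrad

variable {F F' H H' : (Fin 6 → ℝ) → 𝕜} {f f' h h' : (Fin 6 → ℝ) → ℝ} {x : Fin 6 → ℝ}

theorem differentiableAt (hF : HasGrad F F' x) : DifferentiableAt ℝ F x :=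
  hF.contDiffAt.differentiableAt (by simp)

theorem of_hasFDerivAt {L : (Fin 6 → ℝ) →L[ℝ] 𝕜} (hF : ContDiffAt ℝ ∞ F x)
    (hL : HasFDerivAt F L x) (h : ∀ v, L v = F' v) : HasGrad F F' x :=
  ⟨hF, fun v => by rw [hL.fderiv, h]⟩

theorem coord (i : Fin 6) : HasGrad (fun y => y i) (fun v => v i) x :=
  of_hasFDerivAt (by fun_prop) (hasFDerivAt_apply i x) fun _ => rfl

theorem const (c : 𝕜) : HasGrad (fun _ => c) (fun _ => 0) x :=
  of_hasFDerivAt contDiffAt_const (hasFDerivAt_const c x) fun _ => rfl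

theorem add (hF : HasGrad F F' x) (hH : HasGrad H H' x) :
    HasGrad (fun y => F y + H y) (fun v => F' v + H' v) x :=
  of_hasFDerivAt (hF.contDiffAt.add hH.contDiffAt)
    (hF.differentiableAt.hasFDerivAt.add hH.differentiableAt.hasFDerivAt) fun v => by
      rw [add_apply, hF.2, hH.2]

theorem sub (hF : HasGrad F F' x) (hH : HasGrad H H' x) :
    HasGrad (fun y => F y - H y) (fun v => F' v - H' v) x :=
  of_hasFDerivAt (hF.contDiffAt.sub hH.contDiffAt)
    (hF.differentiableAt.hasFDerivAt.sub hH.differentiableAt.hasFDerivAt) fun v => by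
      rw [sub_apply, hF.2, hH.2]

theorem neg (hF : HasGrad F F' x) : HasGrad (fun y => -F y) (fun v => -F' v) x :=
  of_hasFDerivAt hF.contDiffAt.neg hF.differentiableAt.hasFDerivAt.neg fun v => by
    rw [neg_apply, hF.2]

theorem mul (hF : HasGrad F F' x) (hH : HasGrad H H' x) :
    HasGrad (fun y => F y * H y) (fun v => F' v * H x + F x * H' v) x :=
  of_hasFDerivAt (hF.contDiffAt.mul hH.contDiffAt)
    (hF.differentiableAt.hasFDerivAt.mul hH.differentiableAt.hasFDerivAt) fun v => by
      simp only [add_apply, smul_apply, hF.2, hH.2, smul_eq_mul]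
      ring

/-- Composition with a function of one variable. -/
theorem comp {g : 𝕜 → 𝕜} {g' : 𝕜} (hF : HasGrad F F' x) (hg : ContDiffAt ℝ ∞ g (F x))
    (hg' : HasDerivAt g g' (F x)) : HasGrad (fun y => g (F y)) (fun v => g' * F' v) x :=
  of_hasFDerivAt (hg.comp x hF.contDiffAt)
    (hg'.hasFDerivAt.restrictScalars ℝ |>.comp x hF.differentiableAt.hasFDerivAt) fun v => by
      simp [hF.2, mul_comm]

theorem pow (hF : HasGrad F F' x) (n : ℕ) :
    HasGrad (fun y => F y ^ n) (fun v => n * F x ^ (n - 1) * F' v) x :=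
  hF.comp (contDiffAt_id.pow n) (hasDerivAt_pow n _)

theorem inv (hF : HasGrad F F' x) (h0 : F x ≠ 0) :
    HasGrad (fun y => (F y)⁻¹) (fun v => -(F x ^ 2)⁻¹ * F' v) x :=
  hF.comp (contDiffAt_inv ℝ h0) (hasDerivAt_inv h0)

theorem div (hF : HasGrad F F' x) (hH : HasGrad H H' x) (h0 : H x ≠ 0) :
    HasGrad (fun y => F y / H y) (fun v => (F' v * H x - F x * H' v) / H x ^ 2) x := by
  simp only [div_eq_mul_inv]
  refine ⟨(hF.mul (hH.inv h0)).1, fun v => ((hF.mul (hH.inv h0)).2 v).trans ?_⟩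
  field_simp
  ring

theorem exp (hf : HasGrad f f' x) :
    HasGrad (fun y => Real.exp (f y)) (fun v => Real.exp (f x) * f' v) x :=
  hf.comp Real.contDiff_exp.contDiffAt (Real.hasDerivAt_exp _)

theorem log (hf : HasGrad f f' x) (h0 : f x ≠ 0) :
    HasGrad (fun y => Real.log (f y)) (fun v => (f x)⁻¹ * f' v) x :=
  hf.comp (Real.contDiffAt_log.2 h0) (Real.hasDerivAt_log h0)

theorem arctan (hf : HasGrad f f' x) :
    HasGrad (fun y => Real.arctan (f y)) (fun v => (1 / (1 + f x ^ 2)) * f' v) x :=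
  hf.comp Real.contDiff_arctan.contDiffAt (Real.hasDerivAt_arctan _)

theorem sqrt (hf : HasGrad f f' x) (h0 : 0 < f x) :
    HasGrad (fun y => √(f y)) (fun v => (1 / (2 * √(f x))) * f' v) x :=
  hf.comp (Real.contDiffAt_sqrt h0.ne') (Real.hasDerivAt_sqrt h0.ne')

theorem rpow (hf : HasGrad f f' x) (h0 : 0 < f x) (c : ℝ) :
    HasGrad (fun y => f y ^ c) (fun v => c * f x ^ c / f x * f' v) x := by
  refine hf.comp (g := fun t => t ^ c) (Real.contDiffAt_rpow_const_of_ne h0.ne') ?_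
  rw [mul_div_assoc, ← Real.rpow_sub_one h0.ne']
  exact Real.hasDerivAt_rpow_const (Or.inl h0.ne')

end HasGrad

/-- Away from the branch cut, `((u + i v) / (u - i v)) ^ (i p)` is an exponential of the angle. -/
theorem unitPow_eq {u : ℝ} (hu : u ≠ 0) (v p : ℝ) :
    unitPow u v p = exp (-2 * p * arctan (v / u)) := by
  obtain ⟨θ, hθ⟩ : ∃ θ, θ = arctan (v / u) := ⟨_, rfl⟩
  rw [← hθ]
  have hc : Real.cos θ ≠ 0 := hθ ▸ (Real.cos_arctan_pos _).ne'
  have hs : v = u / Real.cos θ * Real.sin θ := by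
    have : Real.tan θ = v / u := hθ ▸ Real.tan_arctan _
    rw [Real.tan_eq_sin_div_cos, div_eq_div_iff hc hu] at this
    field_simp
    linear_combination -this
  obtain ⟨k, hk⟩ : ∃ k, k = u / Real.cos θ := ⟨_, rfl⟩
  have hu' : u = k * Real.cos θ := by rw [hk, div_mul_cancel₀ _ hc]
  rw [← hk] at hs
  have hk : (k : ℂ) ≠ 0 := by
    rw [hk]
    exact_mod_cast div_ne_zero hu hc
  have h1 : ((u : ℂ) + Complex.I * v) = k * Complex.exp (θ * Complex.I) := by
    rw [Complex.exp_mul_I, hu', hs]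
    push_cast
    ring
  have h2 : ((u : ℂ) - Complex.I * v) = k * Complex.exp ((-θ : ℝ) * Complex.I) := by
    rw [Complex.exp_mul_I, hu', hs]
    push_cast
    rw [Complex.cos_neg, Complex.sin_neg]
    ring
  have h3 : ((u : ℂ) + Complex.I * v) / ((u : ℂ) - Complex.I * v) =
      Complex.exp ((2 * θ : ℝ) * Complex.I) := by
    rw [h1, h2, mul_div_mul_left _ _ hk, ← Complex.exp_sub]
    push_cast
    ring_nf
  have h4 : Complex.log (Complex.exp ((2 * θ : ℝ) * Complex.I)) = (2 * θ : ℝ) * Complex.I := by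
    apply Complex.log_exp
    · simp
      linarith [hθ, Real.neg_pi_div_two_lt_arctan (v / u)]
    · simp
      linarith [hθ, Real.arctan_lt_pi_div_two (v / u)]
  rw [unitPow, h3, Complex.cpow_def_of_ne_zero (Complex.exp_ne_zero _), h4,
    show ((2 * θ : ℝ) : ℂ) * Complex.I * (Complex.I * (p : ℂ)) = ((-2 * p * θ : ℝ) : ℂ) by
      push_cast
      linear_combination (2 * θ * p : ℂ) * Complex.I_mul_I,
    Complex.exp_ofReal_re]

theorem unitPow_pos {u : ℝ} (hu : u ≠ 0) (v p : ℝ) : 0 < unitPow u v p := by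
  rw [unitPow_eq hu]
  exact Real.exp_pos _

/-- The gradient of `(u ^ 2 + v ^ 2) * ((u + i v) / (u - i v)) ^ (i p)`; with `u + i v = ρ e^{iθ}`
this function is `ρ ^ 2 e^{-2 p θ}` up to a locally constant factor. -/
theorem HasGrad.mul_unitPow {f f' h h' q : (Fin 6 → ℝ) → ℝ} {x : Fin 6 → ℝ} (hf : HasGrad f f' x)
    (hh : HasGrad h h' x) (h0 : f x ≠ 0) (p : ℝ) (hq : ∀ y, q y = f y ^ 2 + h y ^ 2) :
    HasGrad (fun y => q y * unitPow (f y) (h y) p) (fun v => unitPow (f x) (h x) p *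
      (2 * (f x * f' v + h x * h' v) - 2 * p * (f x * h' v - h x * f' v))) x := by
  have key := ((hf.pow 2).add (hh.pow 2)).mul ((hh.div hf h0).arctan.mul (.const (-2 * p))).exp
  have heq : (fun y => q y * unitPow (f y) (h y) p) =ᶠ[nhds x]
      fun y => (f y ^ 2 + h y ^ 2) * Real.exp (Real.arctan (h y / f y) * (-2 * p)) := by
    filter_upwards [hf.contDiffAt.continuousAt.eventually_ne h0] with y hy
    rw [unitPow_eq hy, mul_comm _ (-2 * p), hq]
  refine ⟨key.1.congr_of_eventuallyEq heq, fun v => ?_⟩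
  rw [heq.fderiv_eq, key.2, unitPow_eq h0, mul_comm (-2 * p)]
  have : f x ^ 2 + h x ^ 2 ≠ 0 := by positivity
  have : 1 + (h x / f x) ^ 2 ≠ 0 := by positivity
  generalize Real.exp _ = E
  field_simp
  ring

/-- In the radial direction `(u, v)` the derivative given by `HasGrad.mul_unitPow` is non-zero. -/
theorem radial_ne {u : ℝ} (hu : u ≠ 0) (v p : ℝ) :
    unitPow u v p * (2 * (u * u + v * v) - 2 * p * (u * v - v * u)) ≠ 0 := by
  refine mul_ne_zero (unitPow_pos hu v p).ne' ?_
  have : 0 < u ^ 2 + v ^ 2 := by positivity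
  intro h
  linarith

/-- In the direction `(-v, u)` of rotation the derivative given by `HasGrad.mul_unitPow` is non-zero
if `p ≠ 0`. -/
theorem rotation_ne {u : ℝ} (hu : u ≠ 0) (v : ℝ) {p : ℝ} (hp : p ≠ 0) :
    unitPow u v p * (2 * (u * -v + v * u) - 2 * p * (u * u - v * -v)) ≠ 0 := by
  refine mul_ne_zero (unitPow_pos hu v p).ne' ?_
  have : 0 < u ^ 2 + v ^ 2 := by positivity
  have := mul_ne_zero hp this.ne'
  intro h
  exact this (by linarith)

/-! ### Criteria in coordinates -/

theorem linearIndependent_two {L : Fin 2 → (Fin 6 → ℝ) →L[ℝ] 𝕜} {v w : Fin 6 → ℝ}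
    (hv : L 0 v ≠ 0) (hw : L 1 w ≠ 0) (h : L 1 v = 0 ∨ L 0 w = 0) : LinearIndependent 𝕜 L := by
  rw [Fintype.linearIndependent_iff]
  intro c hc
  rw [Fin.sum_univ_two] at hc
  have h1 : c 0 * L 0 v + c 1 * L 1 v = 0 := congrArg (· v) hc
  have h2 : c 0 * L 0 w + c 1 * L 1 w = 0 := congrArg (· w) hc
  rw [Fin.forall_fin_two]
  rcases h with h | h <;> simp_all

/-- Covectors that form a triangular matrix with respect to some vectors are independent. -/
theorem linearIndependent_four {L : Fin 4 → (Fin 6 → ℝ) →L[ℝ] 𝕜} {v : Fin 4 → Fin 6 → ℝ}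
    (hd : ∀ n, L n (v n) ≠ 0) (h : ∀ m n, n < m → L m (v n) = 0) : LinearIndependent 𝕜 L := by
  rw [Fintype.linearIndependent_iff]
  intro c hc
  have key : ∀ n, c 0 * L 0 (v n) + c 1 * L 1 (v n) + c 2 * L 2 (v n) + c 3 * L 3 (v n) = 0 := by
    intro n
    rw [Fin.sum_univ_four] at hc
    exact congrArg (· (v n)) hc
  have k0 := key 0
  rw [h 1 0 (by decide), h 2 0 (by decide), h 3 0 (by decide)] at k0
  have c0 : c 0 = 0 := by simpa [hd 0] using k0
  have k1 := key 1
  rw [h 2 1 (by decide), h 3 1 (by decide), c0] at k1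
  have c1 : c 1 = 0 := by simpa [hd 1] using k1
  have k2 := key 2
  rw [h 3 2 (by decide), c0, c1] at k2
  have c2 : c 2 = 0 := by simpa [hd 2] using k2
  have k3 := key 3
  rw [c0, c1, c2] at k3
  have c3 : c 3 = 0 := by simpa [hd 3] using k3
  intro n
  fin_cases n <;> assumption

/-- The vectors `τ x p q r s`, with free parameters `p q r s`, span a space that contains the values
at `x` of the coadjoint vector fields: covectors that vanish on the former vanish on the latter. -/
def SpansOrbit (b : List Bracket) (τ : (Fin 6 → ℝ) → ℝ → ℝ → ℝ → ℝ → (Fin 6 → ℝ)) : Prop :=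
  ∀ x (L : (Fin 6 → ℝ) →L[ℝ] 𝕜), (∀ p q r s, L (τ x p q r s) = 0) →
    ∀ i, L (coadField b x (Pi.single i 1)) = 0

theorem isOpen_ne {f : (Fin 6 → ℝ) → ℝ} (hf : Continuous f) : IsOpen {x | f x ≠ 0} :=
  isOpen_ne_fun hf continuous_const

theorem isOpen_pos {f : (Fin 6 → ℝ) → ℝ} (hf : Continuous f) : IsOpen {x | 0 < f x} :=
  isOpen_lt continuous_const hf

/-- The criterion `isFundamentalSetOn_of` for two functions. The gradients are given by `HasGrad`,
they vanish on the vectors `τ x p q r s` spanning the orbit, and their independence is read off from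
two vectors on which they form a triangular matrix. -/
theorem isFundamentalSetOn_two {b : List Bracket} {U : Set (Fin 6 → ℝ)}
    {f : Fin 2 → (Fin 6 → ℝ) → ℝ} {τ : (Fin 6 → ℝ) → ℝ → ℝ → ℝ → ℝ → (Fin 6 → ℝ)}
    {R G : (Fin 6 → ℝ) → ℝ} (hτ : SpansOrbit (𝕜 := ℝ) b τ) (hR : GenericCorank ℝ b 2 R)
    (hG : Dense {x | G x ≠ 0}) (x₀ : Fin 6 → ℝ)
    (h : ∀ x ∈ U, ∃ D E, HasGrad (f 0) D x ∧ HasGrad (f 1) E x ∧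
      (∀ p q r s, D (τ x p q r s) = 0) ∧ (∀ p q r s, E (τ x p q r s) = 0) ∧
      (R x ≠ 0 → G x ≠ 0 → ∃ v w, D v ≠ 0 ∧ E w ≠ 0 ∧ (E v = 0 ∨ D w = 0)))
    (hx₀ : x₀ ∈ U ∧ R x₀ ≠ 0 := by simp)
    (hU : IsOpen U := by
      repeat first
        | exact isOpen_univ
        | exact isOpen_ne (by fun_prop)
        | exact isOpen_pos (by fun_prop)
        | refine IsOpen.and ?_ ?_) :
    IsFundamentalSetOn (structConst b) U f := by
  refine isFundamentalSetOn_of hU hR hG hx₀ (fun x hx => ?_) fun x hx hRx hGx => ?_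
  · obtain ⟨D, E, hD, hE, hD0, hE0, -⟩ := h x hx
    rw [Fin.forall_fin_two]
    exact ⟨⟨hD.1, hτ x _ fun p q r s => by rw [hD.2, hD0]⟩,
      ⟨hE.1, hτ x _ fun p q r s => by rw [hE.2, hE0]⟩⟩
  · obtain ⟨D, E, hD, hE, -, -, hli⟩ := h x hx
    obtain ⟨v, w, hv, hw, hvw⟩ := hli hRx hGx
    refine linearIndependent_two (v := v) (w := w) ?_ ?_ ?_
    · rwa [hD.2]
    · rwa [hE.2]
    · rwa [hE.2, hD.2]

/-- The analogue of `isFundamentalSetOn_two` for four functions. -/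
theorem isFundamentalSetOn_four {b : List Bracket} {U : Set (Fin 6 → ℝ)}
    {f : Fin 4 → (Fin 6 → ℝ) → 𝕜} {τ : (Fin 6 → ℝ) → ℝ → ℝ → ℝ → ℝ → (Fin 6 → ℝ)}
    {R G : (Fin 6 → ℝ) → ℝ} (hτ : SpansOrbit (𝕜 := 𝕜) b τ) (hR : GenericCorank 𝕜 b 4 R)
    (hG : Dense {x | G x ≠ 0}) (x₀ : Fin 6 → ℝ)
    (h : ∀ x ∈ U, ∃ D₀ D₁ D₂ D₃, HasGrad (f 0) D₀ x ∧ HasGrad (f 1) D₁ x ∧ HasGrad (f 2) D₂ x ∧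
      HasGrad (f 3) D₃ x ∧ (∀ p q r s, D₀ (τ x p q r s) = 0) ∧ (∀ p q r s, D₁ (τ x p q r s) = 0) ∧
      (∀ p q r s, D₂ (τ x p q r s) = 0) ∧ (∀ p q r s, D₃ (τ x p q r s) = 0) ∧
      (R x ≠ 0 → G x ≠ 0 → ∃ v₀ v₁ v₂ v₃, (D₀ v₀ ≠ 0 ∧ D₁ v₁ ≠ 0 ∧ D₂ v₂ ≠ 0 ∧ D₃ v₃ ≠ 0) ∧
        D₁ v₀ = 0 ∧ D₂ v₀ = 0 ∧ D₃ v₀ = 0 ∧ D₂ v₁ = 0 ∧ D₃ v₁ = 0 ∧ D₃ v₂ = 0))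
    (hx₀ : x₀ ∈ U ∧ R x₀ ≠ 0 := by simp)
    (hU : IsOpen U := by
      repeat first
        | exact isOpen_ne (by fun_prop)
        | exact isOpen_pos (by fun_prop)
        | refine IsOpen.and ?_ ?_) :
    IsFundamentalSetOn (structConst b) U f := by
  refine isFundamentalSetOn_of hU hR hG hx₀ (fun x hx => ?_) fun x hx hRx hGx => ?_
  · obtain ⟨D₀, D₁, D₂, D₃, h0, h1, h2, h3, z0, z1, z2, z3, -⟩ := h x hx
    intro n
    fin_cases n
    · exact ⟨h0.1, hτ x _ fun p q r s => by rw [← z0 p q r s, ← h0.2]; rfl⟩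
    · exact ⟨h1.1, hτ x _ fun p q r s => by rw [← z1 p q r s, ← h1.2]; rfl⟩
    · exact ⟨h2.1, hτ x _ fun p q r s => by rw [← z2 p q r s, ← h2.2]; rfl⟩
    · exact ⟨h3.1, hτ x _ fun p q r s => by rw [← z3 p q r s, ← h3.2]; rfl⟩
  · obtain ⟨D₀, D₁, D₂, D₃, h0, h1, h2, h3, -, -, -, -, hli⟩ := h x hx
    obtain ⟨v₀, v₁, v₂, v₃, ⟨n0, n1, n2, n3⟩, z10, z20, z30, z21, z31, z32⟩ :=
      hli hRx hGx
    simp only [← h0.2, ← h1.2, ← h2.2, ← h3.2] at *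
    refine linearIndependent_four (v := ![v₀, v₁, v₂, v₃]) (fun n => ?_) fun m n hmn => ?_
    · fin_cases n <;> assumption
    · fin_cases m <;> fin_cases n <;> first | exact absurd hmn (by decide) | assumption

/-- The data which `isFundamentalSetOn_two` asks for at a point, with the vanishing of the
differentials on the orbit direction `t` left to `simp`, `field_simp` and `ring`. -/
theorem exists_grad_two {f : Fin 2 → (Fin 6 → ℝ) → ℝ} {t : ℝ → ℝ → ℝ → ℝ → (Fin 6 → ℝ)}
    {x : Fin 6 → ℝ} {D E : (Fin 6 → ℝ) → ℝ} {P Q : Prop} (v w : Fin 6 → ℝ)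
    (hD : HasGrad (f 0) D x) (hE : HasGrad (f 1) E x)
    (hli : P → Q → D v ≠ 0 ∧ E w ≠ 0 ∧ (E v = 0 ∨ D w = 0))
    (hD0 : ∀ p q r s, D (t p q r s) = 0 := by
      intro p q r s; simp <;> first | ring1 | (field_simp; ring1))
    (hE0 : ∀ p q r s, E (t p q r s) = 0 := by
      intro p q r s; simp <;> first | ring1 | (field_simp; ring1)) :
    ∃ D E, HasGrad (f 0) D x ∧ HasGrad (f 1) E x ∧ (∀ p q r s, D (t p q r s) = 0) ∧
      (∀ p q r s, E (t p q r s) = 0) ∧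
      (P → Q → ∃ v w, D v ≠ 0 ∧ E w ≠ 0 ∧ (E v = 0 ∨ D w = 0)) :=
  ⟨D, E, hD, hE, hD0, hE0, fun hP hQ => ⟨v, w, hli hP hQ⟩⟩

/-- The analogue of `exists_grad_two` for four functions. -/
theorem exists_grad_four {f : Fin 4 → (Fin 6 → ℝ) → 𝕜} {t : ℝ → ℝ → ℝ → ℝ → (Fin 6 → ℝ)}
    {x : Fin 6 → ℝ} {D₀ D₁ D₂ D₃ : (Fin 6 → ℝ) → 𝕜} {P Q : Prop} (v₀ v₁ v₂ v₃ : Fin 6 → ℝ)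
    (h0 : HasGrad (f 0) D₀ x) (h1 : HasGrad (f 1) D₁ x) (h2 : HasGrad (f 2) D₂ x)
    (h3 : HasGrad (f 3) D₃ x)
    (hli : P → Q → (D₀ v₀ ≠ 0 ∧ D₁ v₁ ≠ 0 ∧ D₂ v₂ ≠ 0 ∧ D₃ v₃ ≠ 0) ∧
        D₁ v₀ = 0 ∧ D₂ v₀ = 0 ∧ D₃ v₀ = 0 ∧ D₂ v₁ = 0 ∧ D₃ v₁ = 0 ∧ D₃ v₂ = 0)
    (z0 : ∀ p q r s, D₀ (t p q r s) = 0 := by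
      intro p q r s; simp <;> first | ring1 | (field_simp; ring1))
    (z1 : ∀ p q r s, D₁ (t p q r s) = 0 := by
      intro p q r s; simp <;> first | ring1 | (field_simp; ring1))
    (z2 : ∀ p q r s, D₂ (t p q r s) = 0 := by
      intro p q r s; simp <;> first | ring1 | (field_simp; ring1))
    (z3 : ∀ p q r s, D₃ (t p q r s) = 0 := by
      intro p q r s; simp <;> first | ring1 | (field_simp; ring1)) :
    ∃ D₀ D₁ D₂ D₃, HasGrad (f 0) D₀ x ∧ HasGrad (f 1) D₁ x ∧ HasGrad (f 2) D₂ x ∧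
      HasGrad (f 3) D₃ x ∧ (∀ p q r s, D₀ (t p q r s) = 0) ∧ (∀ p q r s, D₁ (t p q r s) = 0) ∧
      (∀ p q r s, D₂ (t p q r s) = 0) ∧ (∀ p q r s, D₃ (t p q r s) = 0) ∧
      (P → Q → ∃ v₀ v₁ v₂ v₃, (D₀ v₀ ≠ 0 ∧ D₁ v₁ ≠ 0 ∧ D₂ v₂ ≠ 0 ∧ D₃ v₃ ≠ 0) ∧
        D₁ v₀ = 0 ∧ D₂ v₀ = 0 ∧ D₃ v₀ = 0 ∧ D₂ v₁ = 0 ∧ D₃ v₁ = 0 ∧ D₃ v₂ = 0) :=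
  ⟨D₀, D₁, D₂, D₃, h0, h1, h2, h3, z0, z1, z2, z3, fun hP hQ => ⟨v₀, v₁, v₂, v₃, hli hP hQ⟩⟩

end

end Coadjoint

namespace Coadjoint

/-! ### Coadjoint orbits for each nilradical -/

section

variable {𝕜 : Type} [RCLike 𝕜]

theorem map_vec (L : (Fin 6 → ℝ) →L[ℝ] 𝕜) (a b c d e f : ℝ) :
    L ![a, b, c, d, e, f] = a * L (Pi.single 0 1) + b * L (Pi.single 1 1) +
      c * L (Pi.single 2 1) + d * L (Pi.single 3 1) + e * L (Pi.single 4 1) +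
      f * L (Pi.single 5 1) := by
  rw [pi_eq_sum_univ' ![a, b, c, d, e, f], map_sum, Fin.sum_univ_six]
  simp [RCLike.real_smul_eq_coe_mul]

theorem eq_zero_of_single {L : (Fin 6 → ℝ) →L[ℝ] 𝕜} (h0 : L (Pi.single 0 1) = 0)
    (h1 : L (Pi.single 1 1) = 0) (h2 : L (Pi.single 2 1) = 0) (h3 : L (Pi.single 3 1) = 0)
    (h4 : L (Pi.single 4 1) = 0) (h5 : L (Pi.single 5 1) = 0) : L = 0 := by
  ext v
  rw [pi_eq_sum_univ' v, map_sum, Fin.sum_univ_six]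
  simp [h0, h1, h2, h3, h4, h5]

theorem coadField_single_append_act (n : List Bracket) (a₁ a₂ a₃ a₄ a₅ x : Fin 6 → ℝ)
    (L : (Fin 6 → ℝ) →L[ℝ] 𝕜) (i : Fin 6) :
    L (coadField (n ++ act a₁ a₂ a₃ a₄ a₅) x (Pi.single i 1)) =
      L (coadField n x (Pi.single i 1)) +
        ![dot a₁ x * L (Pi.single 5 1), dot a₂ x * L (Pi.single 5 1),
          dot a₃ x * L (Pi.single 5 1), dot a₄ x * L (Pi.single 5 1),
          dot a₅ x * L (Pi.single 5 1),
          -(dot a₁ x * L (Pi.single 0 1) + dot a₂ x * L (Pi.single 1 1) +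
            dot a₃ x * L (Pi.single 2 1) + dot a₄ x * L (Pi.single 3 1) +
            dot a₅ x * L (Pi.single 4 1))] i := by
  rw [coadField_append_act, map_add, map_sub, map_smul, map_smul, map_vec]
  fin_cases i <;> simp [actMap_apply, dot_zero, RCLike.real_smul_eq_coe_mul]

/-- The conditions on a covector to annihilate the coadjoint orbit through `x`, with the
contribution of `X_6` made explicit. -/
theorem coad_append_act {n : List Bracket} {a₁ a₂ a₃ a₄ a₅ x : Fin 6 → ℝ}
    {L : (Fin 6 → ℝ) →L[ℝ] 𝕜} :
    (∀ i, L (coadField (n ++ act a₁ a₂ a₃ a₄ a₅) x (Pi.single i 1)) = 0) ↔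
      L (coadField n x (Pi.single 0 1)) + dot a₁ x * L (Pi.single 5 1) = 0 ∧
      L (coadField n x (Pi.single 1 1)) + dot a₂ x * L (Pi.single 5 1) = 0 ∧
      L (coadField n x (Pi.single 2 1)) + dot a₃ x * L (Pi.single 5 1) = 0 ∧
      L (coadField n x (Pi.single 3 1)) + dot a₄ x * L (Pi.single 5 1) = 0 ∧
      L (coadField n x (Pi.single 4 1)) + dot a₅ x * L (Pi.single 5 1) = 0 ∧
      L (coadField n x (Pi.single 5 1)) = dot a₁ x * L (Pi.single 0 1) +
        dot a₂ x * L (Pi.single 1 1) + dot a₃ x * L (Pi.single 2 1) +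
        dot a₄ x * L (Pi.single 3 1) + dot a₅ x * L (Pi.single 4 1) := by
  simp only [coadField_single_append_act, Fin.forall_fin_succ, IsEmpty.forall_iff, and_true]
  refine and_congr .rfl <| and_congr .rfl <| and_congr .rfl <| and_congr .rfl <|
    and_congr .rfl ?_
  exact add_neg_eq_zero

theorem coadField_n5g1 (x v : Fin 6 → ℝ) :
    coadField n5g1 x v = ![0, 0, 0, 0, 0, 0] := by
  ext j
  fin_cases j <;> simp [coadField, brk_n5g1, dot]

theorem coadField_n31 (x v : Fin 6 → ℝ) :
    coadField n31 x v = ![0, -(v 2 * x 0), v 1 * x 0, 0, 0, 0] := by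
  ext j
  fin_cases j <;> simp [coadField, brk_n31, dot, Fin.sum_univ_six]

theorem coadField_n41 (x v : Fin 6 → ℝ) :
    coadField n41 x v = ![-(v 4 * x 1), 0, 0, -(v 4 * x 0), v 0 * x 1 + v 3 * x 0, 0] := by
  ext j
  fin_cases j <;> simp [coadField, brk_n41, dot, Fin.sum_univ_six, add_comm, sub_eq_add_neg]

theorem coadField_n51 (x v : Fin 6 → ℝ) :
    coadField n51 x v = ![0, 0, -(v 4 * x 0), -(v 4 * x 1), v 2 * x 0 + v 3 * x 1, 0] := by
  ext j
  fin_cases j <;> simp [coadField, brk_n51, dot, Fin.sum_univ_six, add_comm, sub_eq_add_neg]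

theorem coadField_n52 (x v : Fin 6 → ℝ) :
    coadField n52 x v =
      ![0, -(v 4 * x 0), -(v 4 * x 1), -(v 4 * x 2), v 1 * x 0 + v 2 * x 1 + v 3 * x 2, 0] := by
  ext j
  fin_cases j <;> simp [coadField, brk_n52, dot, Fin.sum_univ_six, add_comm, sub_eq_add_neg]

theorem coadField_n53 (x v : Fin 6 → ℝ) :
    coadField n53 x v =
      ![0, -(v 3 * x 2) - v 4 * x 0, 0, v 1 * x 2 - v 4 * x 1, v 1 * x 0 + v 3 * x 1, 0] := by
  ext j
  fin_cases j <;> simp [coadField, brk_n53, dot, Fin.sum_univ_six, add_comm, sub_eq_add_neg]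

theorem coadField_n54 (x v : Fin 6 → ℝ) :
    coadField n54 x v = ![0, -(v 3 * x 0), -(v 4 * x 0), v 1 * x 0, v 2 * x 0, 0] := by
  ext j
  fin_cases j <;> simp [coadField, brk_n54, dot, Fin.sum_univ_six]

theorem coadField_n54' (x v : Fin 6 → ℝ) :
    coadField n54' x v = ![-(v 2 * x 4), -(v 3 * x 4), v 0 * x 4, v 1 * x 4, 0, 0] := by
  ext j
  fin_cases j <;> simp [coadField, brk_n54', dot, Fin.sum_univ_six]

theorem coadField_n55 (x v : Fin 6 → ℝ) :
    coadField n55 x v =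
      ![0, -(v 4 * x 0), -(v 3 * x 0) - v 4 * x 1, v 2 * x 0, v 1 * x 0 + v 2 * x 1, 0] := by
  ext j
  fin_cases j <;> simp [coadField, brk_n55, dot, Fin.sum_univ_six, add_comm, sub_eq_add_neg]

theorem coadField_n56 (x v : Fin 6 → ℝ) :
    coadField n56 x v = ![0, -(v 4 * x 0), -(v 3 * x 0) - v 4 * x 1, v 2 * x 0 - v 4 * x 2,
        v 1 * x 0 + v 2 * x 1 + v 3 * x 2, 0] := by
  ext j
  fin_cases j <;> simp [coadField, brk_n56, dot, Fin.sum_univ_six, add_comm, sub_eq_add_neg]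

variable {a₁ a₂ a₃ a₄ a₅ x : Fin 6 → ℝ}

theorem spansOrbit_of {b : List Bracket} {τ : (Fin 6 → ℝ) → ℝ → ℝ → ℝ → ℝ → (Fin 6 → ℝ)}
    (h : ∀ x (L : (Fin 6 → ℝ) →L[ℝ] 𝕜), L (τ x 0 0 0 0) = 0 → L (τ x 1 0 0 0) = 0 →
      L (τ x 0 1 0 0) = 0 → L (τ x 0 0 1 0) = 0 → L (τ x 0 0 0 1) = 0 →
      ∀ i, L (coadField b x (Pi.single i 1)) = 0) : SpansOrbit (𝕜 := 𝕜) b τ :=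
  fun x L hL => h x L (hL 0 0 0 0) (hL 1 0 0 0) (hL 0 1 0 0) (hL 0 0 1 0) (hL 0 0 0 1)

theorem spansOrbit_n5g1 :
    SpansOrbit (𝕜 := 𝕜) (n5g1 ++ act a₁ a₂ a₃ a₄ a₅) fun x p _ _ _ =>
      ![dot a₁ x, dot a₂ x, dot a₃ x,
      dot a₄ x, dot a₅ x, p] :=
  spansOrbit_of fun x L e ep eq er es => by
    simp [map_vec] at e ep eq er es
    simp [coad_append_act, coadField_n5g1, map_vec]
    grind

theorem spansOrbit_n31 :
    SpansOrbit (𝕜 := ℝ) (n31 ++ act a₁ a₂ a₃ a₄ a₅) fun x p q r _ =>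
      ![dot a₁ x, p, q,
      dot a₄ x, dot a₅ x, r] :=
  spansOrbit_of fun x L e ep eq er es => by
    simp [map_vec] at e ep eq er es
    simp [coad_append_act, coadField_n31, map_vec]
    grind

theorem spansOrbit_n41 :
    SpansOrbit (𝕜 := ℝ) (n41 ++ act a₁ a₂ a₃ a₄ a₅) fun x p q r _ =>
      ![dot a₁ x + p * x 1, dot a₂ x, dot a₃ x,
      dot a₄ x + p * x 0, q, r] :=
  spansOrbit_of fun x L e ep eq er es => by
    simp [map_vec] at e ep eq er es
    simp [coad_append_act, coadField_n41, map_vec]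
    grind

theorem spansOrbit_n51 :
    SpansOrbit (𝕜 := ℝ) (n51 ++ act a₁ a₂ a₃ a₄ a₅) fun x p q r _ =>
      ![dot a₁ x, dot a₂ x, dot a₃ x + p * x 0,
      dot a₄ x + p * x 1, q, r] :=
  spansOrbit_of fun x L e ep eq er es => by
    simp [map_vec] at e ep eq er es
    simp [coad_append_act, coadField_n51, map_vec]
    grind

theorem spansOrbit_n52 :
    SpansOrbit (𝕜 := ℝ) (n52 ++ act a₁ a₂ a₃ a₄ a₅) fun x p q r _ =>
      ![dot a₁ x, dot a₂ x + p * x 0, dot a₃ x + p * x 1,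
      dot a₄ x + p * x 2, q, r] :=
  spansOrbit_of fun x L e ep eq er es => by
    simp [map_vec] at e ep eq er es
    simp [coad_append_act, coadField_n52, map_vec]
    grind

theorem spansOrbit_n53 :
    SpansOrbit (𝕜 := ℝ) (n53 ++ act a₁ a₂ a₃ a₄ a₅) fun x p q r s =>
      ![dot a₁ x, dot a₂ x - q * x 2 - r * x 0, dot a₃ x,
      dot a₄ x + p * x 2 - r * x 1, dot a₅ x + p * x 0 + q * x 1, s] :=
  spansOrbit_of fun x L e ep eq er es => by
    simp [map_vec] at e ep eq er es
    simp [coad_append_act, coadField_n53, map_vec]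
    grind

theorem spansOrbit_n54 :
    SpansOrbit (𝕜 := ℝ) (n54 ++ act 0 a₂ a₃ a₄ a₅) fun x p q r s =>
      ![0, dot a₂ x - r * x 0, dot a₃ x - s * x 0,
      dot a₄ x + p * x 0, dot a₅ x + q * x 0, p * dot a₂ x + q * dot a₃ x + r * dot a₄ x + s
        * dot a₅ x] :=
  spansOrbit_of fun x L e ep eq er es => by
    simp [map_vec] at e ep eq er es
    simp [coad_append_act, coadField_n54, map_vec, dot_zero]
    grind

theorem spansOrbit_n54' :
    SpansOrbit (𝕜 := ℝ) (n54' ++ act a₁ a₂ a₃ a₄ 0) fun x p q r s =>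
      ![dot a₁ x - r * x 4, dot a₂ x - s * x 4, dot a₃ x + p * x 4,
      dot a₄ x + q * x 4, 0, p * dot a₁ x + q * dot a₂ x + r * dot a₃ x + s * dot a₄ x] :=
  spansOrbit_of fun x L e ep eq er es => by
    simp [map_vec] at e ep eq er es
    simp [coad_append_act, coadField_n54', map_vec, dot_zero]
    grind

theorem spansOrbit_n55 :
    SpansOrbit (𝕜 := ℝ) (n55 ++ act 0 a₂ a₃ a₄ a₅) fun x p q r s =>
      ![0, dot a₂ x - s * x 0, dot a₃ x - r * x 0 - s * x 1,
      dot a₄ x + q * x 0, dot a₅ x + p * x 0 + q * x 1,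
        p * dot a₂ x + q * dot a₃ x + r * dot a₄ x + s * dot a₅ x] :=
  spansOrbit_of fun x L e ep eq er es => by
    simp [map_vec] at e ep eq er es
    simp [coad_append_act, coadField_n55, map_vec, dot_zero]
    grind

theorem contDiff_dot (a : Fin 6 → ℝ) {n : WithTop ℕ∞} : ContDiff ℝ n (dot a) := by
  unfold dot
  fun_prop

attribute [local fun_prop] contDiff_dot

open scoped ContDiff

/-- A covector that annihilates the orbit through `x` and the coordinate vectors with indices `s` is
zero where `R x ≠ 0`. -/
theorem genericCorank_of {b : List Bracket} {r : ℕ} {R : (Fin 6 → ℝ) → ℝ}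
    (hR : ContDiff ℝ ω R) (s : Fin r → Fin 6)
    (h : ∀ x, R x ≠ 0 → ∀ L : (Fin 6 → ℝ) →L[ℝ] 𝕜,
      (∀ i, L (coadField b x (Pi.single i 1)) = 0) → (∀ n, L (Pi.single (s n) 1) = 0) →
      L (Pi.single 0 1) = 0 ∧ L (Pi.single 1 1) = 0 ∧ L (Pi.single 2 1) = 0 ∧
        L (Pi.single 3 1) = 0 ∧ L (Pi.single 4 1) = 0 ∧ L (Pi.single 5 1) = 0) :
    GenericCorank 𝕜 b r R := by
  refine ⟨contDiff_omega_iff_analyticOnNhd.1 hR, fun x hx => ⟨s, fun L hL hn => ?_⟩⟩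
  obtain ⟨h0, h1, h2, h3, h4, h5⟩ := h x hx L hL hn
  exact eq_zero_of_single h0 h1 h2 h3 h4 h5

theorem genericCorank_n5g1₁ :
    GenericCorank 𝕜 (n5g1 ++ act a₁ a₂ a₃ a₄ a₅) 4 fun x => dot a₁ x :=
  genericCorank_of (by fun_prop) ![1, 2, 3, 4] fun x h L hL hn => by
    have h' := RCLike.ofReal_ne_zero (K := 𝕜).2 h
    simp [Fin.forall_fin_succ] at hn
    simp [coad_append_act, coadField_n5g1, map_vec, hn, h'] at hL
    simp [hn, hL]

theorem genericCorank_n5g1₂ :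
    GenericCorank 𝕜 (n5g1 ++ act a₁ a₂ a₃ a₄ a₅) 4 fun x => dot a₂ x :=
  genericCorank_of (by fun_prop) ![0, 2, 3, 4] fun x h L hL hn => by
    have h' := RCLike.ofReal_ne_zero (K := 𝕜).2 h
    simp [Fin.forall_fin_succ] at hn
    simp [coad_append_act, coadField_n5g1, map_vec, hn, h'] at hL
    simp [hn, hL]

theorem genericCorank_n31₁ :
    GenericCorank ℝ (n31 ++ act a₁ a₂ a₃ a₄ a₅) 2 fun x => x 0 * dot a₁ x :=
  genericCorank_of (by fun_prop) ![3, 4] fun x h L hL hn => by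
    simp [coad_append_act, coadField_n31, map_vec] at hL
    simp [Fin.forall_fin_two] at hn
    grind

theorem genericCorank_n31₄ :
    GenericCorank ℝ (n31 ++ act a₁ a₂ a₃ a₄ a₅) 2 fun x => x 0 * dot a₄ x :=
  genericCorank_of (by fun_prop) ![0, 4] fun x h L hL hn => by
    simp [coad_append_act, coadField_n31, map_vec] at hL
    simp [Fin.forall_fin_two] at hn
    grind

theorem genericCorank_n31₅ :
    GenericCorank ℝ (n31 ++ act a₁ a₂ a₃ a₄ a₅) 2 fun x => x 0 * dot a₅ x :=
  genericCorank_of (by fun_prop) ![0, 3] fun x h L hL hn => by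
    simp [coad_append_act, coadField_n31, map_vec] at hL
    simp [Fin.forall_fin_two] at hn
    grind

theorem genericCorank_n41₂ :
    GenericCorank ℝ (n41 ++ act a₁ a₂ a₃ a₄ a₅) 2 fun x => x 1 * dot a₂ x :=
  genericCorank_of (by fun_prop) ![3, 2] fun x h L hL hn => by
    simp [coad_append_act, coadField_n41, map_vec] at hL
    simp [Fin.forall_fin_two] at hn
    grind

theorem genericCorank_n41₃ :
    GenericCorank ℝ (n41 ++ act a₁ a₂ a₃ a₄ a₅) 2 fun x => x 1 * dot a₃ x :=
  genericCorank_of (by fun_prop) ![3, 1] fun x h L hL hn => by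
    simp [coad_append_act, coadField_n41, map_vec] at hL
    simp [Fin.forall_fin_two] at hn
    grind

theorem genericCorank_n51₁ :
    GenericCorank ℝ (n51 ++ act a₁ a₂ a₃ a₄ a₅) 2 fun x => x 0 * dot a₁ x :=
  genericCorank_of (by fun_prop) ![3, 1] fun x h L hL hn => by
    simp [coad_append_act, coadField_n51, map_vec] at hL
    simp [Fin.forall_fin_two] at hn
    grind

theorem genericCorank_n51₁' :
    GenericCorank ℝ (n51 ++ act a₁ a₂ a₃ a₄ a₅) 2 fun x => x 1 * dot a₁ x :=
  genericCorank_of (by fun_prop) ![2, 1] fun x h L hL hn => by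
    simp [coad_append_act, coadField_n51, map_vec] at hL
    simp [Fin.forall_fin_two] at hn
    grind

theorem genericCorank_n51 :
    GenericCorank ℝ (n51 ++ act a₁ a₂ a₃ a₄ a₅) 2 fun x => x 0 * dot a₄ x - x 1 * dot a₃ x :=
  genericCorank_of (by fun_prop) ![0, 1] fun x h L hL hn => by
    simp [coad_append_act, coadField_n51, map_vec] at hL
    simp [Fin.forall_fin_two] at hn
    grind

theorem genericCorank_n52₁ :
    GenericCorank ℝ (n52 ++ act a₁ a₂ a₃ a₄ a₅) 2 fun x => x 0 * dot a₁ x :=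
  genericCorank_of (by fun_prop) ![2, 3] fun x h L hL hn => by
    simp [coad_append_act, coadField_n52, map_vec] at hL
    simp [Fin.forall_fin_two] at hn
    grind

theorem genericCorank_n52 :
    GenericCorank ℝ (n52 ++ act a₁ a₂ a₃ a₄ a₅) 2 fun x => x 0 * (x 0 * dot a₃ x - x 1 * dot a₂ x)
      :=
  genericCorank_of (by fun_prop) ![0, 3] fun x h L hL hn => by
    simp [coad_append_act, coadField_n52, map_vec] at hL
    simp [Fin.forall_fin_two] at hn
    grind

theorem genericCorank_n53₁ :
    GenericCorank ℝ (n53 ++ act a₁ a₂ a₃ a₄ a₅) 2 fun x => x 0 * dot a₁ x :=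
  genericCorank_of (by fun_prop) ![3, 2] fun x h L hL hn => by
    simp [coad_append_act, coadField_n53, map_vec] at hL
    simp [Fin.forall_fin_two] at hn
    grind

theorem genericCorank_n53₃ :
    GenericCorank ℝ (n53 ++ act a₁ a₂ a₃ a₄ a₅) 2 fun x => x 0 * dot a₃ x :=
  genericCorank_of (by fun_prop) ![3, 0] fun x h L hL hn => by
    simp [coad_append_act, coadField_n53, map_vec] at hL
    simp [Fin.forall_fin_two] at hn
    grind

theorem genericCorank_n54_zero :
    GenericCorank ℝ (n54 ++ act a₁ a₂ a₃ a₄ a₅) 0 fun x => x 0 * dot a₁ x :=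
  genericCorank_of (by fun_prop) ![] fun x h L hL hn => by
    simp [coad_append_act, coadField_n54, map_vec] at hL
    grind

theorem genericCorank_n54_two :
    GenericCorank ℝ (n54 ++ act a₁ a₂ a₃ a₄ a₅) 2 fun x => x 0 :=
  genericCorank_of (by fun_prop) ![0, 5] fun x h L hL hn => by
    simp [coad_append_act, coadField_n54, map_vec] at hL
    simp [Fin.forall_fin_two] at hn
    grind

theorem genericCorank_n54'_zero :
    GenericCorank ℝ (n54' ++ act a₁ a₂ a₃ a₄ a₅) 0 fun x => x 4 * dot a₅ x :=
  genericCorank_of (by fun_prop) ![] fun x h L hL hn => by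
    simp [coad_append_act, coadField_n54', map_vec] at hL
    grind

theorem genericCorank_n54'_two :
    GenericCorank ℝ (n54' ++ act a₁ a₂ a₃ a₄ a₅) 2 fun x => x 4 :=
  genericCorank_of (by fun_prop) ![4, 5] fun x h L hL hn => by
    simp [coad_append_act, coadField_n54', map_vec] at hL
    simp [Fin.forall_fin_two] at hn
    grind

theorem genericCorank_n55_zero :
    GenericCorank ℝ (n55 ++ act a₁ a₂ a₃ a₄ a₅) 0 fun x => x 0 * dot a₁ x :=
  genericCorank_of (by fun_prop) ![] fun x h L hL hn => by
    simp [coad_append_act, coadField_n55, map_vec] at hL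
    grind

theorem genericCorank_n55_two :
    GenericCorank ℝ (n55 ++ act a₁ a₂ a₃ a₄ a₅) 2 fun x => x 0 :=
  genericCorank_of (by fun_prop) ![0, 5] fun x h L hL hn => by
    simp [coad_append_act, coadField_n55, map_vec] at hL
    simp [Fin.forall_fin_two] at hn
    grind

theorem genericCorank_n56_zero :
    GenericCorank ℝ (n56 ++ act a₁ a₂ a₃ a₄ a₅) 0 fun x => x 0 * dot a₁ x :=
  genericCorank_of (by fun_prop) ![] fun x h L hL hn => by
    simp [coad_append_act, coadField_n56, map_vec] at hL
    grind

/-- If some orbit is open, the empty set is fundamental. -/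
theorem isFundamentalSetOn_zero {b : List Bracket} {R : (Fin 6 → ℝ) → ℝ}
    (hR : GenericCorank ℝ b 0 R) (x₀ : Fin 6 → ℝ) (hx₀ : R x₀ ≠ 0)
    (f : Fin 0 → (Fin 6 → ℝ) → ℝ) : IsFundamentalSetOn (structConst b) Set.univ f :=
  isFundamentalSetOn_of isOpen_univ hR (dense_ne_zero hR.1 hx₀) ⟨Set.mem_univ x₀, hx₀⟩
    (fun _ _ n => n.elim0) fun _ _ _ _ => linearIndependent_empty_type

end

end Coadjoint

namespace Coadjoint

open scoped ContDiff

section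

variable {a₁ a₂ a₃ a₄ a₅ : Fin 6 → ℝ} {n : List Bracket}

/-! ### Tools for the verification of the rows -/

/-- The claim made about a row of the tables. -/
def Row.Good {b : List Bracket} {r : ℕ} {f : Functions ℝ r} (_ : Row b r f) : Prop :=
  IsSolvableWithNilradical b ∧ IsFundamentalSetOn (structConst b) f.dom f.fn

/-- The claim made about the complex-valued row. -/
def ComplexRow.Good {b : List Bracket} {r : ℕ} {f : Functions ℂ r} (_ : ComplexRow b r f) : Prop :=
  IsSolvableWithNilradical b ∧ IsFundamentalSetOn (structConst b) f.dom f.fn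

/-- A coordinate that vanishes on `[𝔫, 𝔫]` and is an eigenvector of the transpose of `A` shows that
`𝔫` is the nilradical. -/
theorem isSolvableWithNilradical_of_coord (h : IsExtension n a₁ a₂ a₃ a₄ a₅)
    (k : Fin 6) (hA : ∀ v, actMap a₁ a₂ a₃ a₄ a₅ v k = 0 → v k = 0 := by simp)
    (hk : ∀ x y, brk n x y k = 0 := by simp) :
    IsSolvableWithNilradical (n ++ act a₁ a₂ a₃ a₄ a₅) :=
  isSolvableWithNilradical_of_isExtension h <|
    not_isNilpotent_of_quotient (LinearMap.proj k : (Fin 6 → ℝ) →ₗ[ℝ] ℝ) hk hA fun h => by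
      simpa using LinearMap.congr_fun h (Pi.single k 1)

/-- A pair of coordinates that vanish on `[𝔫, 𝔫]` and on which the transpose of `A` acts invertibly
shows that `𝔫` is the nilradical. -/
theorem isSolvableWithNilradical_of_pair (h : IsExtension n a₁ a₂ a₃ a₄ a₅)
    (k l : Fin 6) (α β γ δ : ℝ) (hdet : α * δ - β * γ ≠ 0)
    (hA : ∀ v, actMap a₁ a₂ a₃ a₄ a₅ v k = α * v k + β * v l ∧
      actMap a₁ a₂ a₃ a₄ a₅ v l = γ * v k + δ * v l := by
        intro v; constructor <;> simp <;> ring)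
    (hkl : ∀ x y, brk n x y k = 0 ∧ brk n x y l = 0 := by simp) :
    IsSolvableWithNilradical (n ++ act a₁ a₂ a₃ a₄ a₅) := by
  refine isSolvableWithNilradical_of_isExtension h <|
    not_isNilpotent_of_quotient ((LinearMap.proj k : (Fin 6 → ℝ) →ₗ[ℝ] ℝ).prod (LinearMap.proj l))
      (fun x y => Prod.ext (hkl x y).1 (hkl x y).2) (fun v hv => ?_) fun h => ?_
  · have h1 := (hA v).1.symm.trans (congrArg Prod.fst hv)
    have h2 := (hA v).2.symm.trans (congrArg Prod.snd hv)
    simp only [Prod.fst_zero, Prod.snd_zero] at h1 h2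
    refine Prod.ext ((mul_eq_zero.1 ?_).resolve_left hdet) ((mul_eq_zero.1 ?_).resolve_left hdet)
    · change _ * v k = 0
      linear_combination δ * h1 - β * h2
    · change _ * v l = 0
      linear_combination α * h2 - γ * h1
  · simpa using congrArg Prod.fst (LinearMap.congr_fun h (Pi.single k 1))

/-- A central element of `𝔫` that is an eigenvector of `A` shows that `𝔫` is the nilradical. -/
theorem isSolvableWithNilradical_of_center (h : IsExtension n a₁ a₂ a₃ a₄ a₅)
    (v : Fin 6 → ℝ) {c : ℝ} (hc0 : c ≠ 0)
    (hA : actMap a₁ a₂ a₃ a₄ a₅ v = c • v := by ext i; fin_cases i <;> simp)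
    (hv : v ≠ 0 := by simp) (hc : ∀ y, brk n y v = 0 := by simp) :
    IsSolvableWithNilradical (n ++ act a₁ a₂ a₃ a₄ a₅) :=
  isSolvableWithNilradical_of_isExtension h (not_isNilpotent_of_center hv hc hc0 hA)

theorem dense_ne_zero_of_contDiff {G : (Fin 6 → ℝ) → ℝ} (hG : ContDiff ℝ ω G)
    {x₀ : Fin 6 → ℝ} (hx₀ : G x₀ ≠ 0) : Dense {x | G x ≠ 0} :=
  dense_ne_zero (contDiff_omega_iff_analyticOnNhd.1 hG) hx₀

theorem dense_one : Dense {x : Fin 6 → ℝ | (fun _ => 1 : (Fin 6 → ℝ) → ℝ) x ≠ 0} := by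
  simp

theorem dense_apply (i : Fin 6) : Dense {x : Fin 6 → ℝ | (fun x => x i : (Fin 6 → ℝ) → ℝ) x ≠ 0} :=
  dense_ne_zero (analyticOnNhd_apply i) (x₀ := fun _ => 1) one_ne_zero

theorem rpow_ne_zero {t : ℝ} (ht : 0 < t) (c : ℝ) : t ^ c ≠ 0 :=
  (Real.rpow_pos_of_pos ht c).ne'

theorem dot_vec (a b c d e f : ℝ) (x : Fin 6 → ℝ) :
    dot ![a, b, c, d, e, f] x = a * x 0 + b * x 1 + c * x 2 + d * x 3 + e * x 4 + f * x 5 := by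
  simp [dot, Fin.sum_univ_six]

/-- Sums of the vectors `X_1, ..., X_5` are normalized by `simp` to lists with a constant tail `0`,
which is the left-hand side here and in `dot_vec_5`. -/
theorem dot_vec_3 (a b c : ℝ) (x : Fin 6 → ℝ) :
    dot (Matrix.vecCons a (Matrix.vecCons b (Matrix.vecCons c 0))) x = a * x 0 + b * x 1 + c
      * x 2 := by
  rw [show (0 : Fin 3 → ℝ) = ![0, 0, 0] by ext i; fin_cases i <;> rfl, dot_vec]
  ring

theorem dot_vec_5 (a b c d e : ℝ) (x : Fin 6 → ℝ) :
    dot (Matrix.vecCons a (Matrix.vecCons b (Matrix.vecCons c (Matrix.vecCons d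
      (Matrix.vecCons e 0))))) x = a * x 0 + b * x 1 + c * x 2 + d * x 3 + e * x 4 := by
  rw [show (0 : Fin 1 → ℝ) = ![0] by ext i; fin_cases i; rfl, dot_vec]
  ring

end

end Coadjoint

namespace Coadjoint

section

/-! ### The complex-valued row -/

open Complex (I slitPlane)
open HasGrad

namespace HasGrad

variable {F F' : (Fin 6 → ℝ) → ℂ} {f f' : (Fin 6 → ℝ) → ℝ} {x : Fin 6 → ℝ}

theorem ofReal (hf : HasGrad f f' x) : HasGrad (fun y => (f y : ℂ)) (fun v => (f' v : ℂ)) x :=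
  of_hasFDerivAt (Complex.ofRealCLM.contDiff.contDiffAt.comp x hf.contDiffAt)
    (Complex.ofRealCLM.hasFDerivAt.comp x hf.differentiableAt.hasFDerivAt) fun v => by
      simp [hf.2]

theorem cpow (hF : HasGrad F F' x) (h0 : F x ∈ slitPlane) (c : ℂ) :
    HasGrad (fun y => F y ^ c) (fun v => c * F x ^ c / F x * F' v) x := by
  refine hF.comp (g := fun t => t ^ c) ?_ ?_
  · exact ((analyticAt_id.cpow analyticAt_const h0).contDiffAt (n := ⊤)).restrict_scalars ℝ |>.of_le
      le_top
  · have h := (hasDerivAt_id' (F x)).cpow_const (c := c) h0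
    rw [Complex.cpow_sub _ _ (Complex.slitPlane_ne_zero h0), Complex.cpow_one, mul_one,
      ← mul_div_assoc] at h
    exact h

theorem cpow_div_cpow (hF : HasGrad F F' x) (h0 : F x ∈ slitPlane) (hx : 0 < x 0) (a c : ℂ) :
    HasGrad (fun y => F y ^ a / (y 0 : ℂ) ^ c)
      (fun v => F x ^ a / (x 0 : ℂ) ^ c * (a * (F' v / F x) - c * (v 0 / x 0))) x := by
  have hx0 : (x 0 : ℂ) ≠ 0 := Complex.ofReal_ne_zero.2 hx.ne'
  have hc : (x 0 : ℂ) ^ c ≠ 0 := Complex.cpow_ne_zero_iff.2 (Or.inl hx0)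
  have hF0 := Complex.slitPlane_ne_zero h0
  have h := (hF.cpow h0 a).div ((coord 0).ofReal.cpow (Complex.ofReal_mem_slitPlane.2 hx) c) hc
  refine ⟨h.1, fun v => (h.2 v).trans ?_⟩
  field_simp

end HasGrad

theorem conj_mem_slitPlane {z : ℂ} (h : z ∈ slitPlane) : (starRingEnd ℂ) z ∈ slitPlane := by
  simpa [Complex.mem_slitPlane_iff] using h

/-- A function multiplied by `c` along a flow that multiplies `x` by `a` contributes the
logarithmic derivative of a constant. -/
theorem mul_div_sub_mul_div_eq_zero {F F' x v a c : ℂ} (hF : F ≠ 0) (hx : x ≠ 0)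
    (hF' : F' = c * F) (hv : v = a * x) : a * (F' / F) - c * (v / x) = 0 := by
  rw [hF', hv, mul_div_cancel_right₀ _ hF, mul_div_cancel_right₀ _ hx, mul_comm, sub_self]

/-- The linear algebra behind the independence of the four differentials: a vanishing combination
with coefficients `a b c d`, evaluated on `X_2, ..., X_5`, gives `e₁`, ..., `e₄`; the variables
`x_4`, `x_5` first separate `b` and `d`, then `x_2`, `x_3` separate `a` and `c`. -/
theorem eq_zero_of_conj_pairs {a b c d K₀ K₁ K₂ K₃ w w' z z' α l : ℂ} (hα : α ≠ 0)
    (h₀ : K₀ ≠ 0) (h₁ : K₁ ≠ 0) (h₂ : K₂ ≠ 0) (h₃ : K₃ ≠ 0)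
    (hw : w ≠ 0) (hw' : w' ≠ 0) (hz : z ≠ 0) (hz' : z' ≠ 0)
    (e₁ : a * (K₀ * (α * (I / w))) + b * (K₁ * (α * (-(I * l) / z))) +
      c * (K₂ * (α * (-I / w'))) + d * (K₃ * (α * (I * l / z'))) = 0)
    (e₂ : a * (K₀ * (α * w⁻¹)) + b * (K₁ * (α * (-l / z))) +
      c * (K₂ * (α * w'⁻¹)) + d * (K₃ * (α * (-l / z'))) = 0)
    (e₃ : b * (K₁ * (α * (I * α / z))) + d * (K₃ * (α * (-(I * α) / z'))) = 0)
    (e₄ : b * (K₁ * (α * (α / z))) + d * (K₃ * (α * (α / z'))) = 0) :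
    a = 0 ∧ b = 0 ∧ c = 0 ∧ d = 0 := by
  have k₃ := (mul_eq_zero.1 (show I * α ^ 2 * (b * (K₁ / z) - d * (K₃ / z')) = 0 by
    linear_combination e₃)).resolve_left (by simp [hα])
  have k₄ := (mul_eq_zero.1 (show α ^ 2 * (b * (K₁ / z) + d * (K₃ / z')) = 0 by
    linear_combination e₄)).resolve_left (by simp [hα])
  obtain rfl : b = 0 := (mul_eq_zero.1 (show b * (K₁ / z) = 0 by
    linear_combination (k₃ + k₄) / 2)).resolve_right (div_ne_zero h₁ hz)
  obtain rfl : d = 0 := (mul_eq_zero.1 (show d * (K₃ / z') = 0 by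
    linear_combination (k₄ - k₃) / 2)).resolve_right (div_ne_zero h₃ hz')
  have k₁ := (mul_eq_zero.1 (show I * α * (a * (K₀ / w) - c * (K₂ / w')) = 0 by
    linear_combination e₁)).resolve_left (by simp [hα])
  have k₂ := (mul_eq_zero.1 (show α * (a * (K₀ / w) + c * (K₂ / w')) = 0 by
    linear_combination e₂)).resolve_left hα
  exact ⟨(mul_eq_zero.1 (show a * (K₀ / w) = 0 by
      linear_combination (k₁ + k₂) / 2)).resolve_right (div_ne_zero h₀ hw), rfl,
    (mul_eq_zero.1 (show c * (K₂ / w') = 0 by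
      linear_combination (k₂ - k₁) / 2)).resolve_right (div_ne_zero h₂ hw'), rfl⟩

attribute [local simp] dot_add dot_sub dot_smul dot_vec dot_vec_3 dot_vec_5 actMap_apply

/-- The invariants of `g_{6,12}` come in complex conjugate pairs of functions of
`w = x_3 + i x_2` and `z = (i x_4 + x_5) α - w ln x_1`. Along `X_6` these are multiplied by
`p - i`, while `x_1` is multiplied by `α`. -/
theorem good_g12 (α p : ℝ) (hα : α ≠ 0) : (ComplexRow.g12 α p hα).Good := by
  refine ⟨isSolvableWithNilradical_of_coord isExtension_n5g1 0 (by simp [hα])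
    (by simp [brk_n5g1]), ?_⟩
  have hαc : (α : ℂ) ≠ 0 := Complex.ofReal_ne_zero.2 hα
  have hw (x : Fin 6 → ℝ) :
      HasGrad (fun y => (y 2 + I * y 1 : ℂ)) (fun v => v 2 + I * v 1) x := by
    simpa using (coord 2).ofReal.add ((const I).mul (coord 1).ofReal)
  have hw' (x : Fin 6 → ℝ) :
      HasGrad (fun y => (y 2 - I * y 1 : ℂ)) (fun v => v 2 - I * v 1) x := by
    simpa using (coord 2).ofReal.sub ((const I).mul (coord 1).ofReal)
  have hz {x : Fin 6 → ℝ} (h0 : 0 < x 0) : HasGrad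
      (fun y => ((I * y 3 + y 4) * α - (y 2 + I * y 1) * Real.log (y 0) : ℂ)) (fun v =>
        (I * v 3 + v 4) * α - ((v 2 + I * v 1) * Real.log (x 0) +
          (x 2 + I * x 1) * ((x 0)⁻¹ * v 0))) x := by
    simpa using ((((const I).mul (coord 3).ofReal).add (coord 4).ofReal).mul (const _)).sub
      ((hw x).mul ((coord 0).log h0.ne').ofReal)
  have hz' {x : Fin 6 → ℝ} (h0 : 0 < x 0) : HasGrad
      (fun y => ((-I * y 3 + y 4) * α - (y 2 - I * y 1) * Real.log (y 0) : ℂ)) (fun v =>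
        (-I * v 3 + v 4) * α - ((v 2 - I * v 1) * Real.log (x 0) +
          (x 2 - I * x 1) * ((x 0)⁻¹ * v 0))) x := by
    simpa using ((((const (-I)).mul (coord 3).ofReal).add (coord 4).ofReal).mul (const _)).sub
      ((hw' x).mul ((coord 0).log h0.ne').ofReal)
  refine isFundamentalSetOn_of (R := fun x => dot (α • X₁) x) ?_ genericCorank_n5g1₁ dense_one
    (x₀ := ![1, 0, 1, 0, α, 0]) ⟨⟨one_pos, ?_, ?_⟩, by simp [hα]⟩ (fun x ⟨h0, h1, h2⟩ => ?_)
    fun x ⟨h0, h1, h2⟩ _ _ => ?_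
  · rw [isOpen_iff_mem_nhds]
    rintro x ⟨h0, h1, h2⟩
    refine Filter.inter_mem ((isOpen_pos (f := fun x => x 0) (by fun_prop)).mem_nhds h0)
      (Filter.inter_mem ?_ ?_)
    · exact (hw x).1.continuousAt (Complex.isOpen_slitPlane.mem_nhds h1)
    · exact (hz h0).1.continuousAt (Complex.isOpen_slitPlane.mem_nhds h2)
  · simp
  · simpa [Complex.mem_slitPlane_iff] using hα
  all_goals
    have hx0 : (x 0 : ℂ) ≠ 0 := Complex.ofReal_ne_zero.2 (ne_of_gt h0)
    have h1' : (x 2 - I * x 1 : ℂ) ∈ slitPlane := by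
      simpa [← sub_eq_add_neg] using conj_mem_slitPlane h1
    have h2' : ((-I * x 3 + x 4) * α - (x 2 - I * x 1) * Real.log (x 0) : ℂ) ∈ slitPlane := by
      simpa [← sub_eq_add_neg] using conj_mem_slitPlane h2
    have k1 := Complex.slitPlane_ne_zero h1
    have k2 := Complex.slitPlane_ne_zero h2
    have k1' := Complex.slitPlane_ne_zero h1'
    have k2' := Complex.slitPlane_ne_zero h2'
    have g0 := (hw x).cpow_div_cpow h1 h0 α (p - I)
    simp only [div_eq_mul_inv _ ((_ : ℂ) ^ (_ : ℂ)), ← Complex.cpow_neg, neg_sub] at g0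
    have g1 := (hz h0).cpow_div_cpow h2 h0 α (p - I)
    have g2 := (hw' x).cpow_div_cpow h1' h0 α (p + I)
    have g3 := (hz' h0).cpow_div_cpow h2' h0 α (p + I)
  · intro n
    fin_cases n
    · refine ⟨g0.1, spansOrbit_n5g1 x _ fun a b c d => (g0.2 _).trans
        (mul_eq_zero_of_right _ (mul_div_sub_mul_div_eq_zero k1 hx0 ?_ (by simp)))⟩
      simp
      linear_combination (x 1 : ℂ) * Complex.I_sq
    · refine ⟨g1.1, spansOrbit_n5g1 x _ fun a b c d => (g1.2 _).trans
        (mul_eq_zero_of_right _ (mul_div_sub_mul_div_eq_zero k2 hx0 ?_ (by simp)))⟩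
      simp
      field_simp
      linear_combination (α * x 3 - x 1 * Real.log (x 0) : ℂ) * Complex.I_sq
    · refine ⟨g2.1, spansOrbit_n5g1 x _ fun a b c d => (g2.2 _).trans
        (mul_eq_zero_of_right _ (mul_div_sub_mul_div_eq_zero k1' hx0 ?_ (by simp)))⟩
      simp
      linear_combination (x 1 : ℂ) * Complex.I_sq
    · refine ⟨g3.1, spansOrbit_n5g1 x _ fun a b c d => (g3.2 _).trans
        (mul_eq_zero_of_right _ (mul_div_sub_mul_div_eq_zero k2' hx0 ?_ (by simp)))⟩
      simp
      field_simp
      linear_combination (α * x 3 - x 1 * Real.log (x 0) : ℂ) * Complex.I_sq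
  · rw [Fintype.linearIndependent_iff]
    intro g hg
    have e (v : Fin 6 → ℝ) := (congrArg₂ (· + ·) (congrArg₂ (· + ·) (congrArg₂ (· + ·)
      (congrArg (g 0 * ·) (g0.2 v)) (congrArg (g 1 * ·) (g1.2 v))) (congrArg (g 2 * ·) (g2.2 v)))
      (congrArg (g 3 * ·) (g3.2 v))).symm.trans
      (congrArg (fun L : (Fin 6 → ℝ) →L[ℝ] ℂ => L v) ((Fin.sum_univ_four _).symm.trans hg))
    have n0 (c : ℂ) : (x 0 : ℂ) ^ c ≠ 0 := Complex.cpow_ne_zero_iff.2 (.inl hx0)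
    have e1 := e X₂
    have e2 := e X₃
    have e3 := e X₄
    have e4 := e X₅
    simp at e1 e2 e3 e4
    obtain ⟨a0, a1, a2, a3⟩ : g 0 = 0 ∧ g 1 = 0 ∧ g 2 = 0 ∧ g 3 = 0 := by
      refine eq_zero_of_conj_pairs hαc ?_ ?_ ?_ ?_ k1 k1' k2 (by simpa using k2') e1 e2 e3 e4
      · exact mul_ne_zero (Complex.cpow_ne_zero_iff.2 (.inl k1)) (n0 _)
      · exact div_ne_zero (Complex.cpow_ne_zero_iff.2 (.inl k2)) (n0 _)
      · exact div_ne_zero (Complex.cpow_ne_zero_iff.2 (.inl k1')) (n0 _)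
      · exact div_ne_zero (Complex.cpow_ne_zero_iff.2 (.inl (by simpa using k2'))) (n0 _)
    intro n
    fin_cases n <;> assumption

end

end Coadjoint

namespace Coadjoint

section

/-! ### The real-valued rows

The proof for a row consists of its data. For the nilradical: the coordinates, or the central
vector, that prevent nilpotency outside the span of `X_1, ..., X_5`. For the invariants: the
`genericCorank` lemma whose function `R` is not identically zero for this algebra, the dense set on
which the differentials are independent (`dense_one` where they are so wherever `R x ≠ 0`), a point
of the domain with `R ≠ 0`, the vectors that bring the differentials into triangular form, and the
gradients of the functions. -/

open HasGrad

attribute [local simp] dot_add dot_sub dot_smul dot_zero dot_vec dot_vec_3 dot_vec_5 actMap_apply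
  Functions.dom brk_n5g1 brk_n31 brk_n41 brk_n51 brk_n52 brk_n53 brk_n54 brk_n54' brk_n55 brk_n56
-- `simp` has to leave the products and quotients produced by differentiation unsplit, so that
-- `field_simp` and `ring` can finish; the lemmas are named where their splitting is wanted
attribute [-simp] mul_eq_zero div_eq_zero_iff neg_add_rev

/-! ### The rows with abelian nilradical -/

theorem good_g1 (α β γ δ : ℝ) (hyp0 : 0 < |δ|) (hyp1 : |δ| ≤ |γ|) (hyp2 : |γ| ≤ |β|)
    (hyp3 : |β| ≤ |α|) (hyp4 : |α| ≤ 1) :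
    Row.Good (.g1 α β γ δ ⟨hyp0, hyp1, hyp2, hyp3, hyp4⟩) :=
  ⟨isSolvableWithNilradical_of_coord isExtension_n5g1 0,
    isFundamentalSetOn_four spansOrbit_n5g1 genericCorank_n5g1₁ dense_one
      X₁ fun x (h0 : 0 < x 0) => exists_grad_four X₂ X₃ X₄ X₅
        ((coord 1).mul ((coord 0).rpow h0 _))
        ((coord 2).mul ((coord 0).rpow h0 _))
        ((coord 3).mul ((coord 0).rpow h0 _))
        ((coord 4).mul ((coord 0).rpow h0 _))
        fun _ _ => by simp [rpow_ne_zero h0]⟩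

theorem good_g2 (α γ δ : ℝ) (hyp0 : 0 < |δ|) (hyp1 : |δ| ≤ |γ|) (hyp2 : |γ| ≤ 1) :
    Row.Good (.g2 α γ δ ⟨hyp0, hyp1, hyp2⟩) :=
  ⟨isSolvableWithNilradical_of_coord isExtension_n5g1 2,
    isFundamentalSetOn_four spansOrbit_n5g1 genericCorank_n5g1₂ dense_one
      X₁ fun x (h0 : x 0 ≠ 0) => exists_grad_four ![x 0, x 1, 0, 0, 0, 0] X₃ X₄ X₅
        ((coord 0).mul ((((const _).mul (coord 1)).div (coord 0) h0).exp))
        ((coord 2).mul ((((coord 1).neg).div (coord 0) h0).exp))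
        ((coord 3).mul ((((const _).mul (coord 1)).div (coord 0) h0).exp))
        ((coord 4).mul ((((const _).mul (coord 1)).div (coord 0) h0).exp))
        fun _ _ => by simp [mul_eq_zero, h0]⟩

theorem good_g3 (α δ : ℝ) (hyp0 : 0 < |δ|) (hyp1 : |δ| ≤ 1) : Row.Good (.g3 α δ ⟨hyp0, hyp1⟩) :=
  ⟨isSolvableWithNilradical_of_coord isExtension_n5g1 3,
    isFundamentalSetOn_four spansOrbit_n5g1 genericCorank_n5g1₂ dense_one
      X₁ fun x (h0 : x 0 ≠ 0) => exists_grad_four ![x 0, x 1, x 2, 0, 0, 0] X₃ X₄ X₅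
        ((coord 0).mul ((((const _).mul (coord 1)).div (coord 0) h0).exp))
        (((((const _).mul (coord 0)).mul (coord 2)).sub ((coord 1).pow 2)).div ((coord 0).pow 2)
          (pow_ne_zero _ h0))
        ((coord 3).mul ((((coord 1).neg).div (coord 0) h0).exp))
        ((coord 4).mul ((((const _).mul (coord 1)).div (coord 0) h0).exp))
        fun _ _ => ⟨by simp [h0, div_eq_zero_iff, mul_eq_zero],
          by and_intros <;> simp; field_simp; ring⟩⟩

theorem good_g4 (α : ℝ) : Row.Good (.g4 α) :=
  ⟨isSolvableWithNilradical_of_coord isExtension_n5g1 4,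
    isFundamentalSetOn_four spansOrbit_n5g1 genericCorank_n5g1₂ dense_one
      X₁
      fun x (h0 : x 0 ≠ 0) => exists_grad_four
        ![x 0, x 1, x 2, x 3, 0, 0] ![0, 0, x 0, x 1, 0, 0] X₄ X₅
        ((coord 0).mul ((((const _).mul (coord 1)).div (coord 0) h0).exp))
        (((((const _).mul (coord 0)).mul (coord 2)).sub ((coord 1).pow 2)).div ((coord 0).pow 2)
          (pow_ne_zero _ h0))
        ((((((const _).mul ((coord 0).pow 2)).mul (coord 3)).add ((coord 1).pow 3)).sub
          ((((const _).mul (coord 0)).mul (coord 1)).mul (coord 2))).div ((coord 0).pow 3)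
          (pow_ne_zero _ h0))
        ((coord 4).mul ((((coord 1).neg).div (coord 0) h0).exp))
        fun _ _ => ⟨by simp [h0, div_eq_zero_iff, mul_eq_zero],
          by and_intros <;> simp <;> field_simp <;> ring⟩⟩

theorem good_g5 : Row.Good .g5 :=
  ⟨isSolvableWithNilradical_of_coord isExtension_n5g1 4,
    isFundamentalSetOn_four spansOrbit_n5g1 genericCorank_n5g1₁ dense_one
      X₁
      fun x (h0 : x 0 ≠ 0) => exists_grad_four
        ![x 0, x 1, x 2, x 3, x 4, 0] ![0, 0, 2 * x 0 ^ 2, 2 * x 0 * x 1, x 1 ^ 2, 0]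
        ![0, 0, 0, x 0, x 1, 0] X₅
        ((coord 0).mul ((((coord 1).neg).div (coord 0) h0).exp))
        (((((const _).mul (coord 0)).mul (coord 2)).sub ((coord 1).pow 2)).div ((coord 0).pow 2)
          (pow_ne_zero _ h0))
        ((((((const _).mul ((coord 0).pow 2)).mul (coord 3)).add ((coord 1).pow 3)).sub
          ((((const _).mul (coord 0)).mul (coord 1)).mul (coord 2))).div ((coord 0).pow 3)
          (pow_ne_zero _ h0))
        ((((((coord 1).pow 4).sub (((const _).mul ((coord 0).pow 3)).mul (coord 4))).sub
          ((((const _).mul (coord 0)).mul ((coord 1).pow 2)).mul (coord 2))).add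
          ((((const _).mul ((coord 0).pow 2)).mul (coord 1)).mul (coord 3))).div ((coord 0).pow 4)
          (pow_ne_zero _ h0))
        fun _ _ => ⟨by simp [h0, div_eq_zero_iff, mul_eq_zero],
          by and_intros <;> simp <;> field_simp <;> ring⟩⟩

theorem good_g6 (α β : ℝ) (hyp : α ≤ β) : Row.Good (.g6 α β hyp) :=
  ⟨isSolvableWithNilradical_of_coord isExtension_n5g1 0,
    isFundamentalSetOn_four spansOrbit_n5g1 genericCorank_n5g1₁ dense_one
      ![1, 1, 0, 1, 0, 0]
      fun x ⟨h0, h1, h3⟩ => exists_grad_four ![0, x 1, x 2, 0, 0, 0] X₃ ![0, 0, 0, x 3, x 4, 0] X₁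
        ((coord 1).mul ((coord 0).rpow h0 _))
        ((coord 0).mul ((((coord 2).neg).div (coord 1) h1).exp))
        ((coord 3).mul ((coord 0).rpow h0 _))
        ((coord 0).mul ((((coord 4).neg).div (coord 3) h3).exp))
        fun _ _ => by simp [mul_eq_zero, div_eq_zero_iff, h0.ne', h1, h3, rpow_ne_zero h0]⟩

theorem good_g7 (α β : ℝ) (hαβ : α ^ 2 + β ^ 2 ≠ 0) : Row.Good (.g7 α β hαβ) :=
  ⟨(by
    by_cases hα : α = 0
    · exact isSolvableWithNilradical_of_coord isExtension_n5g1 4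
        (by simp [show β ≠ 0 from fun h => hαβ (by simp [hα, h]), mul_eq_zero])
    · exact isSolvableWithNilradical_of_coord isExtension_n5g1 2 (by simp [hα, mul_eq_zero])),
    isFundamentalSetOn_four spansOrbit_n5g1 genericCorank_n5g1₂ dense_one
      X₁ fun x (h0 : x 0 ≠ 0) => exists_grad_four ![x 0, x 1, x 2, 0, 0, 0] X₃ X₅ X₄
        ((coord 0).mul ((((const _).mul (coord 1)).div (coord 0) h0).exp))
        (((((const _).mul (coord 0)).mul (coord 2)).sub ((coord 1).pow 2)).div ((coord 0).pow 2)
          (pow_ne_zero _ h0))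
        (((((coord 0).mul (coord 4)).sub ((coord 1).mul (coord 3))).div (coord 0) h0).mul
          ((((const _).mul (coord 1)).div (coord 0) h0).exp))
        ((coord 3).mul ((((const _).mul (coord 1)).div (coord 0) h0).exp))
        fun _ _ => ⟨by simp [h0, div_eq_zero_iff, mul_eq_zero],
          by and_intros <;> simp; field_simp; ring⟩⟩

theorem good_g8 (α β γ p : ℝ) (hyp0 : 0 < |γ|) (hyp1 : |γ| ≤ |β|) (hyp2 : |β| ≤ |α|) :
    Row.Good (.g8 α β γ p ⟨hyp0, hyp1, hyp2⟩) := by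
  have hα : α ≠ 0 := abs_pos.1 (hyp0.trans_le (hyp1.trans hyp2))
  exact ⟨isSolvableWithNilradical_of_pair isExtension_n5g1 3 4 p 1 (-1) p
    (by nlinarith [sq_nonneg p]),
    isFundamentalSetOn_four spansOrbit_n5g1 genericCorank_n5g1₁ dense_one
      ![1, 0, 0, 1, 1, 0]
      (hx₀ := by simp [hα])
      fun x ⟨h3, h4⟩ => exists_grad_four ![0, 0, 0, x 3, x 4, 0] X₁ X₂ X₃
        ((coord 3).mul_unitPow (coord 4) h3 _ fun y => by ring)
        ((coord 0).mul (((const _).mul (((coord 3).div (coord 4) h4).arctan)).exp))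
        ((coord 1).mul (((const _).mul (((coord 3).div (coord 4) h4).arctan)).exp))
        ((coord 2).mul (((const _).mul (((coord 3).div (coord 4) h4).arctan)).exp))
        fun _ _ => ⟨⟨radial_ne h3 _ _, by simp⟩, by simp⟩⟩

theorem good_g9 (α β p : ℝ) (hα : α ≠ 0) : Row.Good (.g9 α β p hα) :=
  ⟨isSolvableWithNilradical_of_pair isExtension_n5g1 3 4 p 1 (-1) p (by nlinarith [sq_nonneg p]),
    isFundamentalSetOn_four spansOrbit_n5g1 genericCorank_n5g1₁ dense_one
      ![1, 0, 0, 1, 1, 0]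
      (hx₀ := by simp [hα])
      fun x ⟨h3, h4⟩ => exists_grad_four
        ![0, 0, 0, x 3, x 4, 0] X₁ ![0, 1, -Real.arctan (x 3 / x 4), 0, 0, 0] X₃
        ((coord 3).mul_unitPow (coord 4) h3 _ fun y => by ring)
        ((coord 0).mul (((const _).mul (((coord 3).div (coord 4) h4).arctan)).exp))
        ((coord 1).mul (((const _).mul (((coord 3).div (coord 4) h4).arctan)).exp))
        (((coord 2).add ((coord 1).mul (((coord 3).div (coord 4) h4).arctan))).mul
          (((const _).mul (((coord 3).div (coord 4) h4).arctan)).exp))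
        fun _ _ => ⟨⟨radial_ne h3 _ _, by simp⟩, by and_intros <;> simp⟩⟩

theorem good_g10 (α p : ℝ) : Row.Good (.g10 α p) :=
  ⟨isSolvableWithNilradical_of_pair isExtension_n5g1 3 4 p 1 (-1) p (by nlinarith [sq_nonneg p]),
    isFundamentalSetOn_four spansOrbit_n5g1 genericCorank_n5g1₂ dense_one
      ![1, 0, 0, 1, 1, 0]
      fun x ⟨h0, h3, h4⟩ => exists_grad_four
        ![0, 0, 0, x 3, x 4, 0]
        ![x 0, -x 0 * Real.arctan (x 3 / x 4),
          -x 1 * Real.arctan (x 3 / x 4) + x 2 - x 1 ^ 2 / x 0, 0, 0, 0]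
        ![0, 1, x 1 / x 0, 0, 0, 0] X₃
        ((coord 3).mul_unitPow (coord 4) h3 _ fun y => by ring)
        ((coord 0).mul (((const _).mul (((coord 3).div (coord 4) h4).arctan)).exp))
        (((coord 1).add ((coord 0).mul (((coord 3).div (coord 4) h4).arctan))).mul
          (((const _).mul (((coord 3).div (coord 4) h4).arctan)).exp))
        (((((const _).mul (coord 2)).mul (coord 0)).sub ((coord 1).pow 2)).div ((coord 0).pow 2)
          (pow_ne_zero _ h0))
        fun _ _ => ⟨⟨radial_ne h3 _ _, by simp [h0, div_eq_zero_iff, mul_eq_zero]⟩,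
          by and_intros <;> simp <;> field_simp <;> ring⟩⟩

theorem good_g11a (α p q s : ℝ) (hαs : α * s ≠ 0) (hpq : p * q ≠ 0) :
    Row.Good (.g11a α p q s ⟨hαs, hpq⟩) := by
  have hα := left_ne_zero_of_mul hαs
  have hs := right_ne_zero_of_mul hαs
  have hp := left_ne_zero_of_mul hpq
  have hq := right_ne_zero_of_mul hpq
  exact ⟨isSolvableWithNilradical_of_coord isExtension_n5g1 0 (by simp [mul_eq_zero, hα]),
    isFundamentalSetOn_four spansOrbit_n5g1 genericCorank_n5g1₁ dense_one
      ![1, 1, 1, 1, 1, 0]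
      (hx₀ := by simp [hα])
      fun x ⟨h0, h1, h3⟩ => exists_grad_four
        ![0, -x 2, x 1, 0, 0, 0] ![0, 0, 0, -x 4, x 3, 0] ![0, x 1, x 2, 0, 0, 0]
        ![0, 0, 0, x 3, x 4, 0]
        ((coord 1).mul_unitPow (coord 2) h1 _ fun y => by ring)
        ((coord 3).mul_unitPow (coord 4) h3 _ fun y => by ring)
        (((((coord 1).pow 2).add ((coord 2).pow 2)).rpow (by positivity) _).mul
          ((coord 0).rpow h0 _))
        (((((coord 3).pow 2).add ((coord 4).pow 2)).rpow (by positivity) _).mul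
          ((coord 0).rpow h0 _))
        fun _ _ => ⟨⟨rotation_ne h1 _ hp, rotation_ne h3 _ (div_ne_zero hq hs),
          by simp [rpow_ne_zero h0, hα, mul_eq_zero, div_eq_zero_iff,
          (show x 1 ^ 2 + x 2 ^ 2 ≠ 0 by positivity),
          rpow_ne_zero (show 0 < x 1 ^ 2 + x 2 ^ 2 by positivity) α,
          show 2 * x 1 * x 1 + 2 * x 2 * x 2 ≠ 0 from fun h =>
          (show 0 < x 1 ^ 2 + x 2 ^ 2 by positivity).ne' (by linarith)], by simp [rpow_ne_zero h0,
          hα, mul_eq_zero, div_eq_zero_iff, (show x 3 ^ 2 + x 4 ^ 2 ≠ 0 by positivity),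
          rpow_ne_zero (show 0 < x 3 ^ 2 + x 4 ^ 2 by positivity) α,
          show 2 * x 3 * x 3 + 2 * x 4 * x 4 ≠ 0 from fun h =>
          (show 0 < x 3 ^ 2 + x 4 ^ 2 by positivity).ne' (by linarith)]⟩,
          by and_intros <;> simp <;> field_simp <;> ring⟩⟩

theorem good_g11b (α p q s : ℝ) (hαs : α * s ≠ 0) (hyp1 : p * q = 0) :
    Row.Good (.g11b α p q s ⟨hαs, hyp1⟩) := by
  have hα := left_ne_zero_of_mul hαs
  have hs := right_ne_zero_of_mul hαs
  exact ⟨isSolvableWithNilradical_of_coord isExtension_n5g1 0 (by simp [mul_eq_zero, hα]),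
    isFundamentalSetOn_four spansOrbit_n5g1 genericCorank_n5g1₁ (dense_apply 0)
      ![1, 1, 1, 1, 1, 0]
      (hx₀ := by simp [hα])
      fun x ⟨h1, h2, h3, h4⟩ => exists_grad_four
        ![0, x 1, x 2, 0, 0, 0] ![0, 0, 0, x 3, x 4, 0] X₂ X₁
        ((coord 1).mul_unitPow (coord 2) h1 _ fun y => by ring)
        ((coord 3).mul_unitPow (coord 4) h3 _ fun y => by ring)
        ((coord 0).mul (((const _).mul (((coord 1).div (coord 2) h2).arctan)).exp))
        ((coord 0).mul (((const _).mul (((coord 3).div (coord 4) h4).arctan)).exp))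
        fun _ hG => ⟨⟨radial_ne h1 _ _, radial_ne h3 _ _, by simp [h2, hα, hG, mul_eq_zero,
          div_eq_zero_iff, show 1 + (x 1 / x 2) ^ 2 ≠ 0 by positivity], by simp⟩,
          by and_intros <;> simp⟩⟩

/-! ### The rows with nilradical `g_{3,1} + 2g_1` -/

theorem good_g13 (α β h : ℝ) (hα : α ≠ 0) : Row.Good (.g13 α β h hα) :=
  ⟨isSolvableWithNilradical_of_coord isExtension_n31 3,
    isFundamentalSetOn_two spansOrbit_n31 genericCorank_n31₄ dense_one
      ![1, 0, 0, 1, 1, 0] fun x ⟨h0, h3, h4⟩ => exists_grad_two X₁ X₅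
        (((coord 3).rpow h3 _).div (coord 0) h0)
        (((coord 3).rpow h3 _).div (coord 4) h4)
        fun _ _ => by simp [div_eq_zero_iff, h0, h4, rpow_ne_zero h3]⟩

theorem good_g14a (α β : ℝ) (hαβ : α + β ≠ 0) : Row.Good (.g14a α β hαβ) :=
  ⟨isSolvableWithNilradical_of_coord isExtension_n31 3,
    isFundamentalSetOn_two spansOrbit_n31 genericCorank_n31₁ dense_one
      ![1, 0, 0, 1, 0, 0] (hx₀ := by simp [hαβ]) fun x ⟨h0, h3⟩ => exists_grad_two X₁ X₅
        (((coord 3).rpow h3 _).div (coord 0) h0)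
        ((coord 0).mul ((((const _).mul (coord 4)).div (coord 0) h0).exp))
        fun _ _ => by simp [mul_eq_zero, div_eq_zero_iff, h0, rpow_ne_zero h3, hαβ]⟩

theorem good_g14b (α β : ℝ) (hyp : α + β = 0) : Row.Good (.g14b α β hyp) := by
  obtain rfl : β = -α := by linarith
  exact ⟨isSolvableWithNilradical_of_coord isExtension_n31 3,
    isFundamentalSetOn_two spansOrbit_n31 genericCorank_n31₄ dense_one
      ![1, 0, 0, 1, 0, 0] fun x (h0 : x 0 ≠ 0) => exists_grad_two X₁ X₄
        (coord 0)
        ((coord 3).mul ((((coord 4).neg).div (coord 0) h0).exp))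
        fun _ _ => by simp⟩

theorem good_g15 (h : ℝ) : Row.Good (.g15 h) :=
  ⟨isSolvableWithNilradical_of_coord isExtension_n31 1,
    isFundamentalSetOn_two spansOrbit_n31 genericCorank_n31₄ dense_one
      ![1, 0, 0, 1, 0, 0] fun x ⟨h0, h3⟩ => exists_grad_two X₁ X₅
        (((coord 3).rpow h3 _).div (coord 0) h0)
        ((coord 4).mul ((coord 3).rpow h3 _))
        fun _ _ => by simp [div_eq_zero_iff, h0, rpow_ne_zero h3]⟩

theorem good_g16 : Row.Good .g16 :=
  ⟨isSolvableWithNilradical_of_coord isExtension_n31 1,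
    isFundamentalSetOn_two spansOrbit_n31 genericCorank_n31₁ dense_one
      X₁ fun x (h0 : x 0 ≠ 0) => exists_grad_two X₅ X₄
        (coord 4)
        ((coord 0).mul ((((coord 3).neg).div (coord 0) h0).exp))
        fun _ _ => by simp [mul_eq_zero, div_eq_zero_iff, h0]⟩

theorem good_g17a (α ε : ℝ) (hyp0 : α * ε = 0) (hα : α ≠ 0) : Row.Good (.g17a α ε ⟨hyp0, hα⟩) :=
  ⟨isSolvableWithNilradical_of_coord isExtension_n31 4,
    isFundamentalSetOn_two spansOrbit_n31 genericCorank_n31₁ dense_one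
      ![1, 0, 0, 0, 1, 0] (hx₀ := by simp [hα]) fun x ⟨h0, h4⟩ => exists_grad_two X₁ X₄
        (((coord 4).rpow h4 _).div (coord 0) h0)
        (((const _).mul (coord 0)).sub ((const _).mul (coord 3)))
        fun _ _ => by simp [div_eq_zero_iff, h0, rpow_ne_zero h4, hα]⟩

theorem good_g17b (α ε : ℝ) (hα : α = 0) (hε : ε ≠ 0) : Row.Good (.g17b α ε ⟨hα, hε⟩) := by
  subst hα
  exact ⟨isSolvableWithNilradical_of_coord isExtension_n31 4,
    isFundamentalSetOn_two spansOrbit_n31 genericCorank_n31₄ dense_one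
      ![1, 0, 0, 0, 1, 0] (hx₀ := by simp [hε]) fun x ⟨h0, h4⟩ => exists_grad_two X₁ X₄
        (((coord 4).rpow h4 _).div (coord 0) h0)
        ((coord 4).mul ((((coord 3).neg).div ((const _).mul (coord 0)) (mul_ne_zero hε h0)).exp))
        fun _ _ => by simp [mul_eq_zero, div_eq_zero_iff, h0, h4.ne', hε]⟩

theorem good_g18 (α β : ℝ) (hβ : β ≠ 0) : Row.Good (.g18 α β hβ) :=
  ⟨isSolvableWithNilradical_of_coord isExtension_n31 2,
    isFundamentalSetOn_two spansOrbit_n31 genericCorank_n31₄ dense_one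
      ![1, 0, 0, 1, 0, 0] fun x ⟨h0, h3⟩ => exists_grad_two X₁ X₅
        (((coord 3).rpow h3 _).div (coord 0) h0)
        ((coord 4).mul ((coord 3).rpow h3 _))
        fun _ _ => by simp [div_eq_zero_iff, h0, rpow_ne_zero h3]⟩

theorem good_g19 (α : ℝ) : Row.Good (.g19 α) :=
  ⟨isSolvableWithNilradical_of_coord isExtension_n31 2,
    isFundamentalSetOn_two spansOrbit_n31 genericCorank_n31₄ dense_one
      ![1, 0, 0, 1, 0, 0] fun x ⟨h0, h3⟩ => exists_grad_two X₁ X₅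
        (((coord 3).rpow h3 _).div (coord 0) h0)
        ((coord 3).mul ((((coord 4).neg).div (coord 0) h0).exp))
        fun _ _ => by simp [mul_eq_zero, div_eq_zero_iff, h0, h3.ne', rpow_ne_zero h3]⟩

theorem good_g20 (β : ℝ) (hβ : β ≠ 0) : Row.Good (.g20 β hβ) :=
  ⟨isSolvableWithNilradical_of_coord isExtension_n31 2,
    isFundamentalSetOn_two spansOrbit_n31 genericCorank_n31₁ dense_one
      X₁ fun x (h0 : 0 < x 0) => exists_grad_two X₅ X₄
        ((coord 4).mul ((coord 0).rpow h0 _))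
        ((coord 0).mul ((((coord 3).neg).div (coord 0) h0.ne').exp))
        fun _ _ => by simp [mul_eq_zero, div_eq_zero_iff, h0.ne', rpow_ne_zero h0]⟩

theorem good_g21 (α h : ℝ) (hh : h ≠ 0) : Row.Good (.g21 α h hh) :=
  ⟨isSolvableWithNilradical_of_coord isExtension_n31 3,
    isFundamentalSetOn_two spansOrbit_n31 genericCorank_n31₄ dense_one
      ![1, 0, 0, 1, 0, 0] fun x ⟨h0, h3⟩ => exists_grad_two X₁ X₅
        (((coord 3).rpow h3 _).div (coord 0) h0)
        ((coord 4).mul ((coord 3).rpow h3 _))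
        fun _ _ => by simp [div_eq_zero_iff, h0, rpow_ne_zero h3]⟩

theorem good_g22 (α : ℝ) : Row.Good (.g22 α) :=
  ⟨isSolvableWithNilradical_of_coord isExtension_n31 3,
    isFundamentalSetOn_two spansOrbit_n31 genericCorank_n31₄ dense_one
      ![1, 0, 0, 1, 0, 0] fun x ⟨h0, h3⟩ => exists_grad_two X₁ X₅
        (((coord 3).rpow h3 _).div (coord 0) h0)
        ((coord 3).mul ((((coord 4).neg).div (coord 0) h0).exp))
        fun _ _ => by simp [mul_eq_zero, div_eq_zero_iff, h0, h3.ne', rpow_ne_zero h3]⟩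

/-- Where `α = 0`, both the nilradical and the orbits are controlled by `X_5` in place of `X_2`
and `X_4`. -/
theorem good_g23a (α ε h : ℝ) (hyp0 : ε * h = 0) (hh : h ≠ 0) :
    Row.Good (.g23a α ε h ⟨hyp0, hh⟩) := by
  obtain rfl : ε = 0 := (mul_eq_zero.1 hyp0).resolve_right hh
  obtain ⟨R, hR, hR₀⟩ : ∃ R, GenericCorank ℝ (n31 ++ act ((2 * α) • X₁) (α • X₂ + X₃) (α • X₃ + X₄)
    (α • X₄) ((0 : ℝ) • X₁ + (2 * α + h) • X₅)) 2 R ∧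
      R ![1, 0, 0, 1, h, 0] ≠ 0 := by
    by_cases hα : α = 0
    · exact ⟨_, genericCorank_n31₅, by simp [hα, hh, mul_eq_zero]⟩
    · exact ⟨_, genericCorank_n31₄, by simp [hα]⟩
  exact ⟨(by
    by_cases hα : α = 0
    · exact isSolvableWithNilradical_of_coord isExtension_n31 4 (by simp [hα, hh, mul_eq_zero])
    · exact isSolvableWithNilradical_of_coord isExtension_n31 1 (by simp [hα, mul_eq_zero])),
    isFundamentalSetOn_two spansOrbit_n31 hR (dense_apply 3)
      ![1, 0, 0, 1, h, 0]
      (hx₀ := ⟨⟨one_pos, by simp; positivity⟩, hR₀⟩)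
      fun x ⟨h0, hu⟩ => exists_grad_two X₄ ![x 0, 0, 0, 0, x 4, 0]
        (((coord 3).pow 2).div (coord 0) h0.ne')
        (((((const _).mul (coord 4)).add ((const _).mul (coord 0))).rpow hu _).div
          ((coord 0).rpow h0 _) (rpow_ne_zero h0 _))
        (hE0 := by
          intro a b c d
          have hu' : h * x 4 ≠ 0 := by simpa using hu.ne'
          have h4 : x 4 ≠ 0 := right_ne_zero_of_mul hu'
          simp
          field_simp
          ring)
        fun _ hG => by
          have hu' : 0 < h * x 4 := by simpa using hu
          simp [h0.ne', rpow_ne_zero h0, hG, mul_eq_zero, div_eq_zero_iff]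
          intro e
          rw [div_mul_cancel₀ _ hu'.ne'] at e
          exact mul_ne_zero (mul_ne_zero hh (rpow_ne_zero hu' (2 * α))) (rpow_ne_zero h0
            (2 * α + h))
            (by linear_combination -e)⟩

theorem good_g23b (α ε h : ℝ) (hh : h = 0) (hα : α ≠ 0) : Row.Good (.g23b α ε h ⟨hh, hα⟩) := by
  subst hh
  exact ⟨isSolvableWithNilradical_of_coord isExtension_n31 4 (by simp [mul_eq_zero, hα]),
    isFundamentalSetOn_two spansOrbit_n31 genericCorank_n31₁ (dense_apply 3)
      X₁ (hx₀ := by simp [mul_eq_zero, hα]) fun x (h0 : 0 < x 0) => exists_grad_two X₁ X₅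
        (((coord 3).pow 2).div (coord 0) h0.ne')
        ((((const _).mul (coord 4)).sub (((const _).mul (coord 0)).mul ((coord 0).log h0.ne'))).div
          (coord 0) h0.ne')
        fun _ hG => by simp [mul_eq_zero, div_eq_zero_iff, h0.ne', hα, hG]⟩

theorem good_g24 (h : ℝ) : Row.Good (.g24 h) :=
  ⟨isSolvableWithNilradical_of_coord isExtension_n31 4,
    isFundamentalSetOn_two spansOrbit_n31 genericCorank_n31₅ dense_one
      ![1, 0, 0, 0, 1, 0] fun x ⟨h0, h4⟩ => exists_grad_two X₁ X₄
        (coord 0)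
        (((coord 4).rpow h4 _).mul ((((coord 3).neg).div (coord 0) h0).exp))
        fun _ _ => by simp [mul_eq_zero, div_eq_zero_iff, h0, rpow_ne_zero h4]⟩

theorem good_g25a (β h : ℝ) (h_ne : h ≠ -1) : Row.Good (.g25a β h h_ne) :=
  ⟨isSolvableWithNilradical_of_coord isExtension_n31 1,
    isFundamentalSetOn_two spansOrbit_n31 genericCorank_n31₁ dense_one
      ![1, 0, 0, 0, 1, 0]
      (hx₀ := by simp [show 1 + h ≠ 0 from fun e => h_ne (by linarith)])
      fun x ⟨h0, h4⟩ => exists_grad_two X₅ X₄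
        (((coord 0).rpow h0 _).mul ((coord 4).rpow h4 _))
        ((coord 0).mul ((((const _).mul (coord 3)).div (coord 4) h4.ne').exp))
        fun _ _ => by simp [mul_eq_zero, div_eq_zero_iff, h0.ne', h4.ne', rpow_ne_zero h0,
          rpow_ne_zero h4, show 1 + h ≠ 0 from fun e => h_ne (by linarith)]⟩

theorem good_g25b (β h : ℝ) (hh : h = -1) : Row.Good (.g25b β h hh) := by
  subst hh
  exact ⟨isSolvableWithNilradical_of_coord isExtension_n31 1,
    isFundamentalSetOn_two spansOrbit_n31 genericCorank_n31₄ dense_one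
      ![1, 0, 0, 0, 1, 0] fun x (h4 : x 4 ≠ 0) => exists_grad_two X₁ ![x 0, x 1, x 2, x 3, x 4, 0]
        (coord 0)
        ((coord 4).mul ((((const _).mul (coord 3)).div (coord 4) h4).exp))
        fun _ _ => by simp [mul_eq_zero, h4]⟩

theorem good_g26 (h : ℝ) : Row.Good (.g26 h) :=
  ⟨isSolvableWithNilradical_of_coord isExtension_n31 1,
    isFundamentalSetOn_two spansOrbit_n31 genericCorank_n31₄ dense_one
      ![1, 0, 0, 0, 1, 0] fun x (h0 : x 0 ≠ 0) => exists_grad_two X₄ ![x 0, x 1, x 2, x 3, x 4, 0]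
        (((((const _).mul (coord 0)).mul (coord 3)).sub ((coord 4).pow 2)).div ((coord 0).pow 2)
          (pow_ne_zero _ h0))
        ((coord 0).mul ((((const _).mul (coord 4)).div (coord 0) h0).exp))
        fun _ _ => by simp [mul_eq_zero, div_eq_zero_iff, h0]⟩

theorem good_g27a (α β ε : ℝ) (hα : α ≠ 0) (hαβ : α + β ≠ 0) : Row.Good (.g27a α β ε ⟨hα, hαβ⟩) :=
  ⟨isSolvableWithNilradical_of_coord isExtension_n31 1 (by simp [mul_eq_zero, hα]),
    isFundamentalSetOn_two spansOrbit_n31 genericCorank_n31₁ dense_one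
      ![1, 0, 0, 0, (1 + ε) / α, 0]
      (hx₀ := ⟨⟨one_pos, by simp; field_simp; simp⟩, by simp [hαβ]⟩)
      fun x ⟨h0, hu⟩ => exists_grad_two X₅ X₄
        (((((const _).mul (coord 4)).sub ((const _).mul (coord 0))).rpow hu _).div
          ((coord 0).rpow h0 _) (rpow_ne_zero h0 _))
        (((coord 0).rpow h0 _).mul (((((const _).mul (coord 3)).sub ((const _).mul (coord 0))).div
          (((const _).mul (coord 4)).sub ((const _).mul (coord 0))) hu.ne').exp))
        (hE0 := by
          intro a b c d
          have hv : α * x 4 - x 0 * ε ≠ 0 := by rw [mul_comm (x 0)]; exact hu.ne'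
          simp
          field_simp
          ring)
        fun _ _ => by simp [mul_eq_zero, div_eq_zero_iff, hu.ne', rpow_ne_zero h0, rpow_ne_zero hu,
          hα, hαβ]⟩

theorem good_g27b (α β ε : ℝ) (hα : α ≠ 0) (hyp1 : α + β = 0) :
    Row.Good (.g27b α β ε ⟨hα, hyp1⟩) := by
  obtain rfl : β = -α := by linarith
  exact ⟨isSolvableWithNilradical_of_coord isExtension_n31 2 (by simp [mul_eq_zero, hα]),
    isFundamentalSetOn_two spansOrbit_n31 genericCorank_n31₅ dense_one
      ![1, 0, 0, 0, (1 + ε) / α, 0]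
      (hx₀ := ⟨⟨one_ne_zero, by simp; field_simp; simp⟩, by simp; field_simp; intro e; linarith⟩)
      fun x ⟨h0, hu⟩ => exists_grad_two X₁ X₄
        (coord 0)
        (((((const _).mul (coord 4)).sub ((const _).mul (coord 0))).div (coord 0) h0).mul
          (((((const _).mul (coord 3)).sub ((const _).mul (coord 0))).div
          (((const _).mul (coord 4)).sub ((const _).mul (coord 0))) hu).exp))
        (hE0 := by
          intro a b c d
          have hv : α * x 4 - x 0 * ε ≠ 0 := by rw [mul_comm (x 0)]; exact hu
          simp
          field_simp
          ring)
        fun _ _ => by simp [mul_eq_zero, div_eq_zero_iff, h0, hu, hα]⟩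

theorem good_g27c (α β ε : ℝ) (hα : α = 0) (hβ : β ≠ 0) (hε : ε = 0) :
    Row.Good (.g27c α β ε ⟨hα, hβ, hε⟩) := by
  subst hα; subst hε
  exact ⟨isSolvableWithNilradical_of_coord isExtension_n31 2 (by simp [mul_eq_zero, hβ]),
    isFundamentalSetOn_two spansOrbit_n31 genericCorank_n31₁ dense_one
      ![1, 0, 0, 0, 1, 0] (hx₀ := by simp [hβ]) fun x ⟨h0, h4⟩ => exists_grad_two X₁ X₄
        ((coord 4).div (coord 0) h0)
        ((coord 0).mul ((((const _).mul (coord 3)).div (coord 4) h4).exp))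
        fun _ _ => by simp [mul_eq_zero, div_eq_zero_iff, h0, h4, hβ]⟩

theorem good_g29 (α β ε : ℝ) (hα : α = 0) (hβ : β ≠ 0) (hε : ε ≠ 0) :
    Row.Good (.g29 α β ε ⟨hα, hβ, hε⟩) := by
  subst hα
  exact ⟨isSolvableWithNilradical_of_coord isExtension_n31 2 (by simp [mul_eq_zero, hβ]),
    isFundamentalSetOn_two spansOrbit_n31 genericCorank_n31₁ dense_one
      X₁ (hx₀ := by simp [hβ]) fun x (h0 : x 0 ≠ 0) => exists_grad_two X₄ X₅
        (((((const _).mul (coord 0)).mul (coord 3)).add ((coord 4).pow 2)).div ((coord 0).pow 2)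
          (pow_ne_zero _ h0))
        ((coord 0).mul ((((const _).mul (coord 4)).div ((const _).mul (coord 0))
          (mul_ne_zero hε h0)).exp))
        fun _ _ => by simp [mul_eq_zero, div_eq_zero_iff, h0, hβ, hε]⟩

theorem good_g28 (β : ℝ) : Row.Good (.g28 β) :=
  ⟨isSolvableWithNilradical_of_coord isExtension_n31 1,
    isFundamentalSetOn_two spansOrbit_n31 genericCorank_n31₁ dense_one
      ![1, 0, 0, 0, 1, 0] fun x ⟨h0, h4⟩ => exists_grad_two X₅ X₄
        (((coord 4).pow 2).mul ((coord 0).rpow h0 _))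
        ((coord 0).mul ((((const _).mul (coord 3)).div (coord 4) h4).exp))
        fun _ _ => by simp [mul_eq_zero, div_eq_zero_iff, h0.ne', h4, rpow_ne_zero h0]⟩

theorem good_g30 : Row.Good .g30 :=
  ⟨isSolvableWithNilradical_of_coord isExtension_n31 3,
    isFundamentalSetOn_two spansOrbit_n31 genericCorank_n31₄ dense_one
      ![1, 0, 0, 0, 1, 0] fun x (h4 : x 4 ≠ 0) => exists_grad_two X₁ X₄
        (coord 0)
        ((coord 4).mul ((((coord 3).neg).div (coord 4) h4).exp))
        fun _ _ => by simp [mul_eq_zero, div_eq_zero_iff, h4]⟩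

theorem good_g31 : Row.Good .g31 :=
  ⟨isSolvableWithNilradical_of_coord isExtension_n31 1,
    isFundamentalSetOn_two spansOrbit_n31 genericCorank_n31₁ dense_one
      ![1, 0, 0, 0, 1, 0] fun x ⟨h0, h4⟩ => exists_grad_two X₁ X₄
        (((coord 4).pow 2).div (coord 0) h0)
        ((coord 0).mul ((((const _).mul (coord 3)).div (coord 4) h4).exp))
        fun _ _ => by simp [mul_eq_zero, div_eq_zero_iff, h0, h4]⟩

theorem good_g32a (α γ ε h : ℝ) (hyp0 : γ < 2 * α + h) (hyp1 : ε * h = 0) (hh : h ≠ 0)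
    (hγ : γ ≠ 0) :
    Row.Good (.g32a α γ ε h ⟨hyp0, hyp1, hh, hγ⟩) := by
  obtain rfl : ε = 0 := (mul_eq_zero.1 hyp1).resolve_right hh
  exact ⟨isSolvableWithNilradical_of_pair isExtension_n31 1 2 α (-1) 1 α
    (by nlinarith [sq_nonneg α]),
    isFundamentalSetOn_two spansOrbit_n31 genericCorank_n31₅ dense_one
      ![1, 0, 0, h, 1, 0]
      (hx₀ := ⟨⟨one_pos, one_pos, by simp; positivity⟩, by simp [hγ]⟩)
      fun x ⟨h0, h4, hu⟩ => exists_grad_two X₁ X₄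
        (((coord 4).rpow h4 _).mul ((coord 0).rpow h0 _))
        (((((const _).mul (coord 3)).add ((const _).mul (coord 0))).rpow hu _).mul
          ((coord 4).rpow h4 _))
        (hE0 := by
          intro a b c d
          have hu' : h * x 3 ≠ 0 := by simpa using hu.ne'
          have h3 : x 3 ≠ 0 := right_ne_zero_of_mul hu'
          simp
          field_simp
          ring)
        fun _ _ => by
          have hu' : 0 < h * x 3 := by simpa using hu
          simp [h0.ne', rpow_ne_zero h0, rpow_ne_zero h4, hh, hγ, mul_eq_zero, div_eq_zero_iff,
            rpow_ne_zero hu' γ, right_ne_zero_of_mul hu'.ne']⟩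

theorem good_g32b (α γ ε h : ℝ) (hyp0 : γ < 2 * α + h) (hyp1 : ε * h = 0) (hh : h ≠ 0)
    (hγ : γ = 0) :
    Row.Good (.g32b α γ ε h ⟨hyp0, hyp1, hh, hγ⟩) := by
  subst hγ
  obtain rfl : ε = 0 := (mul_eq_zero.1 hyp1).resolve_right hh
  exact ⟨isSolvableWithNilradical_of_pair isExtension_n31 1 2 α (-1) 1 α
    (by nlinarith [sq_nonneg α]),
    isFundamentalSetOn_two spansOrbit_n31 genericCorank_n31₄ dense_one
      ![1, 0, 0, h, 0, 0]
      (hx₀ := ⟨⟨one_pos, by simp; positivity⟩, by simp [mul_eq_zero, hh, hyp0.ne']⟩)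
      fun x ⟨h0, hu⟩ => exists_grad_two X₅ X₁
        (coord 4)
        (((((const _).mul (coord 3)).add ((const _).mul (coord 0))).rpow hu _).mul
          ((coord 0).rpow h0 _))
        (hE0 := by
          intro a b c d
          have hu' : h * x 3 ≠ 0 := by simpa using hu.ne'
          have h3 : x 3 ≠ 0 := right_ne_zero_of_mul hu'
          simp
          field_simp
          ring)
        fun _ _ => by
          have hu' : 0 < h * x 3 := by simpa using hu
          simp [h0.ne', rpow_ne_zero h0, hyp0.ne', mul_eq_zero, div_eq_zero_iff,
            rpow_ne_zero hu' (2 * α)]⟩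

theorem good_g32c (α γ ε h : ℝ) (hyp0 : γ < 2 * α + h) (hh : h = 0) (hγ : γ ≠ 0) :
    Row.Good (.g32c α γ ε h ⟨hyp0, hh, hγ⟩) := by
  subst hh
  exact ⟨isSolvableWithNilradical_of_pair isExtension_n31 1 2 α (-1) 1 α
    (by nlinarith [sq_nonneg α]),
    isFundamentalSetOn_two spansOrbit_n31 genericCorank_n31₅ dense_one
      ![1, 0, 0, 0, 1, 0] (hx₀ := by simp [hγ]) fun x ⟨h0, h4⟩ => exists_grad_two X₁ X₄
        (((coord 4).rpow h4 _).mul ((coord 0).rpow h0 _))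
        ((((const _).mul (coord 3)).sub (((const _).mul (coord 0)).mul ((coord 4).log h4.ne'))).div
          (coord 0) h0.ne')
        fun _ _ => by simp [mul_eq_zero, div_eq_zero_iff, h0.ne', rpow_ne_zero h0, rpow_ne_zero h4,
          hγ]⟩

theorem good_g32d (α γ ε h : ℝ) (hyp0 : γ < 2 * α + h) (hh : h = 0) (hγ : γ = 0) :
    Row.Good (.g32d α γ ε h ⟨hyp0, hh, hγ⟩) := by
  subst hh; subst hγ
  exact ⟨isSolvableWithNilradical_of_pair isExtension_n31 1 2 α (-1) 1 α
    (by nlinarith [sq_nonneg α]),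
    isFundamentalSetOn_two spansOrbit_n31 genericCorank_n31₁ dense_one
      X₁
      (hx₀ := by simp [mul_eq_zero, show α ≠ 0 from fun e => by simp [e] at hyp0])
      fun x (h0 : 0 < x 0) => exists_grad_two X₅ X₄
        (coord 4)
        ((((const _).mul (coord 3)).sub (((const _).mul (coord 0)).mul ((coord 0).log h0.ne'))).div
          (coord 0) h0.ne')
        fun _ _ => by simp [mul_eq_zero, div_eq_zero_iff, h0.ne',
          show α ≠ 0 from fun e => by simp [e] at hyp0]⟩

theorem good_g33a (α β : ℝ) (hyp0 : β ≤ 2 * α) (hα : α ≠ 0) : Row.Good (.g33a α β ⟨hyp0, hα⟩) :=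
  ⟨isSolvableWithNilradical_of_pair isExtension_n31 1 2 α (-1) 1 α (by nlinarith [sq_nonneg α]),
    isFundamentalSetOn_two spansOrbit_n31 genericCorank_n31₁ dense_one
      ![1, 0, 0, 1, 0, 0] (hx₀ := by simp [mul_eq_zero, hα]) fun x ⟨h0, h3⟩ => exists_grad_two X₄ X₅
        (((coord 3).rpow h3 _).mul ((coord 0).rpow h0 _))
        ((coord 0).mul ((((const _).mul (coord 4)).div (coord 0) h0.ne').exp))
        fun _ _ => by simp [mul_eq_zero, div_eq_zero_iff, h0.ne', h3.ne', rpow_ne_zero h0,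
          rpow_ne_zero h3, hα]⟩

theorem good_g33b (α β : ℝ) (hyp0 : β ≤ 2 * α) (hα : α = 0) : Row.Good (.g33b α β ⟨hyp0, hα⟩) := by
  subst hα
  exact ⟨isSolvableWithNilradical_of_pair isExtension_n31 1 2 0 (-1) 1 0 (by norm_num),
    isFundamentalSetOn_two spansOrbit_n31 genericCorank_n31₅ dense_one
      X₁ fun x (h0 : x 0 ≠ 0) => exists_grad_two X₁ X₄
        (coord 0)
        ((coord 3).mul ((((const _).mul (coord 4)).div (coord 0) h0).exp))
        fun _ _ => by simp⟩

theorem good_g34a (α ε h : ℝ) (hε : ε = 0) (hα : α ≠ 0) : Row.Good (.g34a α ε h ⟨hε, hα⟩) := by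
  subst hε
  exact ⟨isSolvableWithNilradical_of_pair isExtension_n31 1 2 α (-1) 1 α
    (by nlinarith [sq_nonneg α]),
    isFundamentalSetOn_two spansOrbit_n31 genericCorank_n31₁ dense_one
      ![1, 0, 0, 0, 1, 0] (hx₀ := by simp [mul_eq_zero, hα]) fun x ⟨h0, h4⟩ => exists_grad_two X₅ X₄
        (((coord 4).rpow h4 _).mul ((coord 0).rpow h0 _))
        ((coord 0).mul ((((const _).mul (coord 3)).div (coord 4) h4.ne').exp))
        fun _ _ => by simp [mul_eq_zero, div_eq_zero_iff, h0.ne', h4.ne', rpow_ne_zero h0,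
          rpow_ne_zero h4, hα]⟩

theorem good_g34b (α ε h : ℝ) (hε : ε = 0) (hα : α = 0) : Row.Good (.g34b α ε h ⟨hε, hα⟩) := by
  subst hε; subst hα
  exact ⟨isSolvableWithNilradical_of_pair isExtension_n31 1 2 0 (-1) 1 0 (by norm_num),
    isFundamentalSetOn_two spansOrbit_n31 genericCorank_n31₄ dense_one
      ![1, 0, 0, 0, 1, 0] fun x (h4 : x 4 ≠ 0) => exists_grad_two X₁ ![x 0, x 1, x 2, x 3, x 4, 0]
        (coord 0)
        ((coord 4).mul ((((const _).mul (coord 3)).div (coord 4) h4).exp))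
        fun _ _ => by simp [mul_eq_zero, h4]⟩

theorem good_g34c (α ε h : ℝ) (hε : ε ≠ 0) (hh : h = 0) : Row.Good (.g34c α ε h ⟨hε, hh⟩) := by
  subst hh
  exact ⟨isSolvableWithNilradical_of_pair isExtension_n31 1 2 α (-1) 1 α
    (by nlinarith [sq_nonneg α]),
    isFundamentalSetOn_two spansOrbit_n31 genericCorank_n31₄ dense_one
      ![1, 0, 0, 0, 1, 0] fun x (h0 : x 0 ≠ 0) => exists_grad_two X₄ ![x 0, x 1, x 2, x 3, x 4, 0]
        (((((const _).mul (coord 0)).mul (coord 3)).add ((coord 4).pow 2)).div ((coord 0).pow 2)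
          (pow_ne_zero _ h0))
        ((coord 0).mul ((((const _).mul (coord 4)).div ((const _).mul (coord 0))
          (mul_ne_zero hε h0)).exp))
        fun _ _ => by simp [mul_eq_zero, div_eq_zero_iff, h0, hε]⟩

theorem good_g35 (α β γ : ℝ) (hαβ : α ^ 2 + β ^ 2 ≠ 0) : Row.Good (.g35 α β γ hαβ) :=
  ⟨isSolvableWithNilradical_of_pair isExtension_n31 3 4 γ (-1) 1 γ (by nlinarith [sq_nonneg γ]),
    isFundamentalSetOn_two spansOrbit_n31 genericCorank_n31₄ dense_one
      ![1, 0, 0, 1, 1 + γ ^ 2, 0]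
      (hx₀ := ⟨⟨one_ne_zero, by simp; positivity⟩, by simp; nlinarith⟩)
      fun x ⟨h3, h4⟩ => exists_grad_two ![0, 0, 0, x 3, x 4, 0] X₁
        ((coord 3).mul_unitPow ((coord 4).neg) h3 _ fun y => by ring)
        ((coord 0).mul (((const _).mul (((coord 3).div (coord 4) h4).arctan)).exp))
        fun _ _ => ⟨radial_ne h3 _ _, by simp⟩⟩

theorem good_g36 (α γ : ℝ) : Row.Good (.g36 α γ) :=
  ⟨isSolvableWithNilradical_of_pair isExtension_n31 3 4 γ (-1) 1 γ (by nlinarith [sq_nonneg γ]),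
    isFundamentalSetOn_two spansOrbit_n31 genericCorank_n31₄ dense_one
      ![1, 0, 0, 1, 1 + γ ^ 2, 0]
      (hx₀ := ⟨⟨one_ne_zero, by simp; positivity⟩, by simp; nlinarith⟩)
      fun x ⟨h3, h4⟩ => exists_grad_two ![0, 0, 0, x 3, x 4, 0] X₁
        ((coord 3).mul_unitPow ((coord 4).neg) h3 _ fun y => by ring)
        ((coord 0).mul (((const _).mul (((coord 3).div (coord 4) h4).arctan)).exp))
        fun _ _ => ⟨radial_ne h3 _ _, by simp⟩⟩

theorem good_g37 (α β s : ℝ) (hs : s ≠ 0) : Row.Good (.g37 α β s hs) :=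
  ⟨isSolvableWithNilradical_of_pair isExtension_n31 1 2 α (-1) 1 α (by nlinarith [sq_nonneg α]),
    isFundamentalSetOn_two spansOrbit_n31 genericCorank_n31₄ dense_one
      ![1, 0, 0, 1, (1 + β ^ 2) / s, 0]
      (hx₀ := ⟨⟨one_ne_zero, by simp; positivity⟩, by simp; field_simp; nlinarith⟩)
      fun x ⟨h3, h4⟩ => exists_grad_two ![0, 0, 0, x 3, x 4, 0] X₁
        ((coord 3).mul_unitPow ((coord 4).neg) h3 _ fun y => by ring)
        ((coord 0).mul (((const _).mul (((coord 3).div (coord 4) h4).arctan)).exp))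
        fun _ _ => ⟨radial_ne h3 _ _, by simp⟩⟩

theorem good_g38 (α : ℝ) : Row.Good (.g38 α) :=
  ⟨isSolvableWithNilradical_of_pair isExtension_n31 1 2 α (-1) 1 α (by nlinarith [sq_nonneg α]),
    isFundamentalSetOn_two spansOrbit_n31 genericCorank_n31₄ dense_one
      ![1, 0, 0, 1, 1 + α ^ 2, 0]
      (hx₀ := ⟨⟨one_ne_zero, by simp; positivity⟩, by simp; nlinarith⟩)
      fun x ⟨h3, h4⟩ => exists_grad_two ![0, 0, 0, x 3, x 4, 0] X₁
        ((coord 3).mul_unitPow ((coord 4).neg) h3 _ fun y => by ring)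
        ((coord 0).mul (((const _).mul (((coord 3).div (coord 4) h4).arctan)).exp))
        fun _ _ => ⟨radial_ne h3 _ _, by simp⟩⟩

/-! ### The rows with nilradical `g_{4,1} + g_1` -/

theorem good_g39 (γ h : ℝ) (hγ : γ ≠ 0) : Row.Good (.g39 γ h hγ) :=
  ⟨isSolvableWithNilradical_of_coord isExtension_n41 4,
    isFundamentalSetOn_two spansOrbit_n41 genericCorank_n41₃ dense_one
      ![0, 1, 1, 0, 0, 0] (hx₀ := by simp [hγ]) fun x ⟨h1, h2⟩ => exists_grad_two X₂ X₄
        (((coord 2).rpow h2 _).mul ((coord 1).rpow h1 _))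
        ((((coord 0).pow 2).sub (((const _).mul (coord 1)).mul (coord 3))).div
          ((coord 1).mul ((coord 2).rpow h2 _)) (mul_ne_zero h1.ne' (rpow_ne_zero h2 _)))
        fun _ _ => by simp [mul_eq_zero, div_eq_zero_iff, h1.ne', rpow_ne_zero h1, rpow_ne_zero h2,
          hγ]⟩

theorem good_g40 (h : ℝ) : Row.Good (.g40 h) :=
  ⟨isSolvableWithNilradical_of_coord isExtension_n41 4,
    isFundamentalSetOn_two spansOrbit_n41 genericCorank_n41₃ dense_one
      X₂ fun x (h1 : x 1 ≠ 0) => exists_grad_two ![x 0, x 1, x 2, 0, 0, 0] X₄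
        ((coord 1).mul ((((const _).mul (coord 2)).div (coord 1) h1).exp))
        (((((coord 0).pow 2).sub (((const _).mul (coord 1)).mul (coord 3))).div (coord 1) h1).mul
          ((((const _).mul (coord 2)).div (coord 1) h1).exp))
        fun _ _ => by simp [mul_eq_zero, div_eq_zero_iff, h1]⟩

/-- The orbits are controlled by `[X_3, X_6] = h X_3`, or by `[X_2, X_6]` when `h = 0`. -/
theorem good_g41a (h : ℝ) (h_ne : h ≠ -1) : Row.Good (.g41a h h_ne) := by
  obtain ⟨R, hR, hR₀⟩ : ∃ R, GenericCorank ℝ (n41 ++ act ((1 + h) • X₁) ((2 + h) • X₂) (h • X₃)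
    (X₃ + h • X₄) X₅) 2 R ∧
      R ![0, 1, 1, 0, 0, 0] ≠ 0 := by
    by_cases hh : h = 0
    · exact ⟨_, genericCorank_n41₂, by simp [hh]⟩
    · exact ⟨_, genericCorank_n41₃, by simp [hh]⟩
  exact ⟨isSolvableWithNilradical_of_coord isExtension_n41 4,
    isFundamentalSetOn_two spansOrbit_n41 hR dense_one
      ![0, 1, 1, 0, 0, 0]
      (hx₀ := ⟨⟨one_pos, one_pos⟩, hR₀⟩)
      fun x ⟨h1, h2⟩ => exists_grad_two ![x 0, x 1, x 2, 0, 0, 0] X₄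
        (((coord 2).rpow h2 _).mul ((coord 1).rpow h1 _))
        ((((coord 1).mul (coord 2)).inv (mul_ne_zero h1.ne' h2.ne')).mul
          ((((const _).mul ((((const _).mul (coord 1)).mul (coord 3)).sub ((coord 0).pow 2))).div
          ((coord 1).mul (coord 2)) (mul_ne_zero h1.ne' h2.ne')).exp))
        fun _ _ => by
          simp [h1.ne', h2.ne', show 1 + h ≠ 0 from fun e => h_ne (by linarith), mul_eq_zero,
            div_eq_zero_iff]
          intro e
          exact mul_ne_zero (rpow_ne_zero h2 (2 + h)) (rpow_ne_zero h1 (-h))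
            (by linear_combination e / 2)⟩

theorem good_g41b (h : ℝ) (hh : h = -1) : Row.Good (.g41b h hh) := by
  subst hh
  exact ⟨isSolvableWithNilradical_of_coord isExtension_n41 4,
    isFundamentalSetOn_two spansOrbit_n41 genericCorank_n41₂ dense_one
      ![0, 1, 1, 0, 0, 0]
      (hx₀ := ⟨⟨one_ne_zero, one_ne_zero⟩, by simp; norm_num⟩)
      fun x ⟨h1, h2⟩ => exists_grad_two X₂ X₄
        ((coord 1).mul (coord 2))
        (((coord 1).div (coord 2) h2).mul (((((((const _).mul (coord 1)).mul (coord 3)).sub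
          ((coord 0).pow 2)).neg).div ((coord 1).mul (coord 2)) (mul_ne_zero h1 h2)).exp))
        fun _ _ => by simp [mul_eq_zero, div_eq_zero_iff, h1, h2]⟩

theorem good_g42 (h : ℝ) : Row.Good (.g42 h) :=
  ⟨isSolvableWithNilradical_of_coord isExtension_n41 4,
    isFundamentalSetOn_two spansOrbit_n41 genericCorank_n41₃ dense_one
      ![0, 1, 1, 0, 0, 0] fun x ⟨h1, h2⟩ => exists_grad_two X₂ X₄
        (((coord 2).rpow h2 _).div (coord 1) h1)
        (((((const _).mul (coord 1)).mul (coord 3)).sub ((coord 0).pow 2)).div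
          ((coord 1).mul ((coord 2).rpow h2 _)) (mul_ne_zero h1 (rpow_ne_zero h2 _)))
        fun _ _ => by simp [mul_eq_zero, div_eq_zero_iff, h1, rpow_ne_zero h2]⟩

theorem good_g43 : Row.Good .g43 :=
  ⟨isSolvableWithNilradical_of_coord isExtension_n41 4,
    isFundamentalSetOn_two spansOrbit_n41 genericCorank_n41₂ dense_one
      X₂ fun x (h1 : x 1 ≠ 0) => exists_grad_two X₄ X₃
        (((coord 0).pow 2).sub (((const _).mul (coord 1)).mul (coord 3)))
        ((coord 1).mul ((((coord 2).neg).div (coord 1) h1).exp))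
        fun _ _ => by simp [mul_eq_zero, div_eq_zero_iff, h1]⟩

theorem good_g44 (γ : ℝ) : Row.Good (.g44 γ) :=
  ⟨isSolvableWithNilradical_of_coord isExtension_n41 4,
    isFundamentalSetOn_two spansOrbit_n41 genericCorank_n41₂
      (G := fun x => (2 * x 1 * x 3 - x 0 ^ 2) * x 2)
      (dense_ne_zero_of_contDiff (by fun_prop) (x₀ := ![0, 1, 1, 1, 0, 0]) (by simp))
      X₂ fun x (h1 : 0 < x 1) => exists_grad_two X₃ X₄
        (((coord 2).pow 3).mul ((coord 1).rpow h1 _))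
        ((((((const _).mul (coord 1)).mul (coord 3)).sub ((coord 0).pow 2)).pow 3).div
          ((coord 1).pow 4) (pow_ne_zero _ h1.ne'))
        fun _ hG => by simp [mul_eq_zero, div_eq_zero_iff, h1.ne', rpow_ne_zero h1,
          left_ne_zero_of_mul hG, right_ne_zero_of_mul hG]⟩

theorem good_g45 : Row.Good .g45 :=
  ⟨isSolvableWithNilradical_of_coord isExtension_n41 4,
    isFundamentalSetOn_two spansOrbit_n41 genericCorank_n41₂ (G := fun x => 2 * x 1 * x 3 - x 0 ^ 2)
      (dense_ne_zero_of_contDiff (by fun_prop) (x₀ := ![0, 1, 0, 1, 0, 0]) (by simp))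
      X₂ fun x (h1 : x 1 ≠ 0) => exists_grad_two X₃ X₄
        ((coord 1).mul ((((const _).mul (coord 2)).div (coord 1) h1).exp))
        ((((((const _).mul (coord 1)).mul (coord 3)).sub ((coord 0).pow 2)).pow 3).div
          ((coord 1).pow 4) (pow_ne_zero _ h1))
        fun _ hG => by simp [mul_eq_zero, div_eq_zero_iff, h1, hG]⟩

theorem good_g46 : Row.Good .g46 :=
  ⟨isSolvableWithNilradical_of_coord isExtension_n41 4,
    isFundamentalSetOn_two spansOrbit_n41 genericCorank_n41₂ dense_one
      ![0, 1, 1, 0, 0, 0] fun x ⟨h1, h2⟩ => exists_grad_two X₄ X₂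
        ((coord 2).mul (((((coord 0).pow 2).sub (((const _).mul (coord 1)).mul (coord 3))).div
          (((const _).mul (coord 1)).mul (coord 2))
          (mul_ne_zero (mul_ne_zero two_ne_zero h1) h2)).exp))
        (((coord 2).pow 3).div (coord 1) h1)
        fun _ _ => by simp [mul_eq_zero, div_eq_zero_iff, h1, h2]⟩

theorem good_g47 (γ ε : ℝ) (hγ : γ ≠ 0) : Row.Good (.g47 γ ε hγ) :=
  ⟨isSolvableWithNilradical_of_coord isExtension_n41 3,
    isFundamentalSetOn_two spansOrbit_n41 genericCorank_n41₂ dense_one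
      X₂ fun x (h1 : 0 < x 1) => exists_grad_two X₃ X₄
        ((coord 2).mul ((coord 1).rpow h1 _))
        (((coord 1).rpow h1 _).mul (((((coord 0).pow 2).sub (((const _).mul (coord 1)).mul
          (coord 3))).div ((const _).mul ((coord 1).pow 2)) (mul_ne_zero two_ne_zero
          (pow_ne_zero _ h1.ne'))).exp))
        fun _ _ => by simp [mul_eq_zero, div_eq_zero_iff, h1.ne', rpow_ne_zero h1]⟩

theorem good_g48 : Row.Good .g48 :=
  ⟨isSolvableWithNilradical_of_coord isExtension_n41 3,
    isFundamentalSetOn_two spansOrbit_n41 genericCorank_n41₂ dense_one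
      X₂ fun x (h1 : x 1 ≠ 0) => exists_grad_two X₃ X₄
        ((coord 1).mul ((((coord 2).neg).div (coord 1) h1).exp))
        (((((const _).mul (coord 1)).mul (coord 3)).sub ((coord 0).pow 2)).div ((coord 1).pow 2)
          (pow_ne_zero _ h1))
        fun _ _ => by simp [mul_eq_zero, div_eq_zero_iff, h1]⟩

theorem good_g49 (ε : ℝ) : Row.Good (.g49 ε) :=
  ⟨isSolvableWithNilradical_of_coord isExtension_n41 3,
    isFundamentalSetOn_two spansOrbit_n41 genericCorank_n41₂ dense_one
      X₂ fun x (h1 : 0 < x 1) => exists_grad_two X₃ X₄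
        (coord 2)
        (((coord 1).rpow h1 _).mul ((((((const _).mul (coord 1)).mul (coord 3)).add
          ((coord 0).pow 2)).div ((const _).mul ((coord 1).pow 2)) (mul_ne_zero two_ne_zero
          (pow_ne_zero _ h1.ne'))).exp))
        fun _ _ => by simp [mul_eq_zero, div_eq_zero_iff, h1.ne', rpow_ne_zero h1]⟩

theorem good_g50a (ε : ℝ) (hε : ε ≠ 0) : Row.Good (.g50a ε hε) :=
  ⟨isSolvableWithNilradical_of_coord isExtension_n41 3,
    isFundamentalSetOn_two spansOrbit_n41 genericCorank_n41₂ dense_one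
      X₂ fun x (h1 : 0 < x 1) => exists_grad_two X₃ X₄
        (((coord 1).rpow h1 _).mul ((((coord 2).neg).div (coord 1) h1.ne').exp))
        ((((const _).mul (((coord 0).pow 2).sub (((const _).mul (coord 1)).mul (coord 3)))).add
          ((coord 2).pow 2)).div ((coord 1).pow 2) (pow_ne_zero _ h1.ne'))
        fun _ _ => by simp [mul_eq_zero, div_eq_zero_iff, h1.ne', rpow_ne_zero h1, hε]⟩

theorem good_g50b (ε : ℝ) (hε : ε = 0) : Row.Good (.g50b ε hε) := by
  subst hε
  exact ⟨isSolvableWithNilradical_of_coord isExtension_n41 3,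
    isFundamentalSetOn_two spansOrbit_n41 genericCorank_n41₂ dense_one
      X₂ fun x (h1 : 0 < x 1) => exists_grad_two X₃ X₄
        ((coord 2).div (coord 1) h1.ne')
        ((((coord 2).div (coord 1) h1.ne').mul ((coord 1).log h1.ne')).add
          ((((coord 0).pow 2).sub (((const _).mul (coord 1)).mul (coord 3))).div
          ((const _).mul ((coord 1).pow 2)) (mul_ne_zero two_ne_zero (pow_ne_zero _ h1.ne'))))
        fun _ _ => by simp [mul_eq_zero, div_eq_zero_iff, h1.ne']⟩

theorem good_g51 (ε : ℝ) : Row.Good (.g51 ε) :=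
  ⟨isSolvableWithNilradical_of_coord isExtension_n41 2,
    isFundamentalSetOn_two spansOrbit_n41 genericCorank_n41₃ dense_one
      ![0, 1, 1, 0, 0, 0] fun x ⟨h1, h2⟩ => exists_grad_two X₂ X₄
        (coord 1)
        (((coord 2).rpow h2 _).mul (((((coord 0).pow 2).sub (((const _).mul (coord 1)).mul
          (coord 3))).div ((const _).mul ((coord 1).pow 2)) (mul_ne_zero two_ne_zero
          (pow_ne_zero _ h1))).exp))
        fun _ _ => by simp [mul_eq_zero, div_eq_zero_iff, h1, rpow_ne_zero h2]⟩

theorem good_g52 (ε : ℝ) : Row.Good (.g52 ε) :=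
  ⟨isSolvableWithNilradical_of_coord isExtension_n41 2,
    isFundamentalSetOn_two spansOrbit_n41 genericCorank_n41₃ dense_one
      ![0, 1, 1, 0, 0, 0] fun x ⟨h1, h2⟩ => exists_grad_two X₂ X₄
        (coord 1)
        (((coord 2).rpow h2 _).mul (((((coord 0).pow 2).sub (((const _).mul (coord 1)).mul
          (coord 3))).div ((const _).mul ((coord 1).pow 2)) (mul_ne_zero two_ne_zero
          (pow_ne_zero _ h1))).exp))
        fun _ _ => by simp [mul_eq_zero, div_eq_zero_iff, h1, rpow_ne_zero h2]⟩

/-! ### The rows with nilradical `g_{5,1}` -/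

theorem good_g53 : Row.Good .g53 :=
  ⟨isSolvableWithNilradical_of_coord isExtension_n51 3,
    isFundamentalSetOn_two spansOrbit_n51 genericCorank_n51 dense_one
      ![0, 1, 1, 0, 0, 0] fun x _ => exists_grad_two X₁ X₂
        (coord 0)
        (coord 1)
        fun _ _ => by simp⟩

theorem good_g54 (lam γ : ℝ) : Row.Good (.g54 lam γ) :=
  ⟨isSolvableWithNilradical_of_center isExtension_n51 X₁ (c := 1) (by simp),
    isFundamentalSetOn_two spansOrbit_n51 genericCorank_n51₁ dense_one
      X₁ fun x (h0 : 0 < x 0) => exists_grad_two X₂ X₄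
        ((coord 1).mul ((coord 0).rpow h0 _))
        ((((coord 0).mul (coord 3)).sub ((coord 1).mul (coord 2))).mul ((coord 0).rpow h0 _))
        fun _ _ => by simp [mul_eq_zero, h0.ne', rpow_ne_zero h0]⟩

theorem good_g55 (γ : ℝ) : Row.Good (.g55 γ) :=
  ⟨isSolvableWithNilradical_of_coord isExtension_n51 3,
    isFundamentalSetOn_two spansOrbit_n51 genericCorank_n51₁ dense_one
      X₁ fun x (h0 : 0 < x 0) => exists_grad_two X₂ X₄
        ((coord 1).mul ((coord 0).rpow h0 _))
        ((coord 0).mul (((((coord 1).mul (coord 2)).sub ((coord 0).mul (coord 3))).div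
          ((coord 0).pow 2) (pow_ne_zero _ h0.ne')).exp))
        fun _ _ => by simp [mul_eq_zero, div_eq_zero_iff, h0.ne', rpow_ne_zero h0]⟩

theorem good_g56a (γ : ℝ) (h_ne : γ ≠ 1) : Row.Good (.g56a γ h_ne) :=
  ⟨isSolvableWithNilradical_of_coord isExtension_n51 2 (by simp [mul_eq_zero,
    sub_ne_zero.2 (Ne.symm h_ne)]),
    isFundamentalSetOn_two spansOrbit_n51 genericCorank_n51₁ dense_one
      ![1, 1, 0, 0, 0, 0] fun x ⟨h0, h1⟩ => exists_grad_two X₁ X₃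
        ((coord 1).mul ((coord 0).rpow h0 _))
        (((coord 0).rpow h0 _).mul ((((const _).mul (((coord 1).mul (coord 2)).sub
          ((coord 0).mul (coord 3)))).div ((coord 1).pow 2) (pow_ne_zero _ h1)).exp))
        fun _ _ => by simp [mul_eq_zero, div_eq_zero_iff, h0.ne', h1, rpow_ne_zero h0,
          sub_ne_zero.2 h_ne, sub_ne_zero.2 (Ne.symm h_ne)]⟩

theorem good_g56b (γ : ℝ) (hγ : γ = 1) : Row.Good (.g56b γ hγ) := by
  subst hγ
  exact ⟨isSolvableWithNilradical_of_coord isExtension_n51 4,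
    isFundamentalSetOn_two spansOrbit_n51 genericCorank_n51₁ dense_one
      ![1, 1, 0, 0, 0, 0] fun x ⟨h0, h1⟩ => exists_grad_two X₂ X₃
        (coord 1)
        (((coord 0).inv h0).mul (((((coord 1).mul (coord 2)).sub ((coord 0).mul (coord 3))).div
          ((coord 1).pow 2) (pow_ne_zero _ h1)).exp))
        fun _ _ => by simp [mul_eq_zero, div_eq_zero_iff, h0, h1]⟩

theorem good_g57 (γ : ℝ) : Row.Good (.g57 γ) :=
  ⟨isSolvableWithNilradical_of_center isExtension_n51 X₁ (c := 1) (by simp),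
    isFundamentalSetOn_two spansOrbit_n51 genericCorank_n51₁ dense_one
      X₁ fun x (h0 : 0 < x 0) => exists_grad_two X₂ X₄
        ((coord 1).mul ((coord 0).rpow h0 _))
        ((((coord 0).mul (coord 3)).sub ((coord 1).mul (coord 2))).div ((coord 0).rpow h0 _)
          (rpow_ne_zero h0 _))
        fun _ _ => by simp [mul_eq_zero, div_eq_zero_iff, h0.ne', rpow_ne_zero h0]⟩

/-- The function is not analytic where `x_1 = 0`, so density is shown by moving in the direction
of `x_4`, in which the function is affine with slope `x_1 x_2`. -/
theorem dense_ne_zero_log : Dense {x : Fin 6 → ℝ | (fun x : Fin 6 → ℝ =>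
    (x 0 * x 3 - x 1 * x 2 + 3⁻¹ * x 1 ^ 2 * Real.log (x 0)) * x 1) x ≠ 0} := by
  rw [dense_iff_inter_open]
  intro V hV hne
  obtain ⟨y, hyV, hy⟩ := (dense_ne_zero_of_contDiff (G := fun x => x 0 * x 1) (by fun_prop)
    (x₀ := fun _ => 1) (by simp)).inter_open_nonempty V hV hne
  by_contra! h
  have h0 : ∀ z ∈ V, (z 0 * z 3 - z 1 * z 2 + 3⁻¹ * z 1 ^ 2 * Real.log (z 0)) * z 1 = 0 := by
    intro z hz
    by_contra hne
    exact Set.notMem_empty z (h ▸ ⟨hz, hne⟩)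
  have hc : Filter.Tendsto (fun t : ℝ => y + t • X₄) (nhds 0) (nhds y) := by
    have : Continuous fun t : ℝ => y + t • X₄ := by fun_prop
    simpa using this.tendsto 0
  have hV' : ∀ᶠ t in nhdsWithin (0 : ℝ) {0}ᶜ, y + t • X₄ ∈ V :=
    (hc.eventually (hV.mem_nhds hyV)).filter_mono nhdsWithin_le_nhds
  obtain ⟨t, ht, ht0⟩ := (hV'.and self_mem_nhdsWithin).exists
  have h1 := h0 y hyV
  have h2 := h0 _ ht
  simp at h2
  have h3 : t * (y 0 * y 1) = 0 := by linear_combination h2 - h1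
  exact (mul_ne_zero ht0 hy) h3

theorem good_g58 (ω : ℝ) (hyp : ω = 0 ∨ ω = 1) : Row.Good (.g58 ω hyp) :=
  ⟨isSolvableWithNilradical_of_coord isExtension_n51 4,
    isFundamentalSetOn_two spansOrbit_n51 genericCorank_n51₁ dense_ne_zero_log
      ![1, 1, 0, 0, 0, 0] fun x (h0 : 0 < x 0) => exists_grad_two X₂ X₄
        (((coord 1).pow 3).div ((coord 0).pow 2) (pow_ne_zero _ h0.ne'))
        ((((((coord 0).mul (coord 3)).sub ((coord 1).mul (coord 2))).add
          (((const _).mul ((coord 1).pow 2)).mul ((coord 0).log h0.ne'))).pow 3).div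
          ((coord 0).pow 4) (pow_ne_zero _ h0.ne'))
        fun _ hG => by simp [mul_eq_zero, div_eq_zero_iff, h0.ne', left_ne_zero_of_mul hG,
          right_ne_zero_of_mul hG]⟩

theorem good_g59 (h : ℝ) : Row.Good (.g59 h) :=
  ⟨isSolvableWithNilradical_of_coord isExtension_n51 2,
    isFundamentalSetOn_two spansOrbit_n51 genericCorank_n51₁ dense_one
      ![1, 1, 0, 0, 0, 0] fun x ⟨h0, h1⟩ => exists_grad_two X₂ X₃
        (coord 1)
        ((coord 0).mul ((((((coord 0).neg).mul (coord 3)).add ((coord 1).mul (coord 2))).div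
          ((coord 0).mul (coord 1)) (mul_ne_zero h0 h1)).exp))
        fun _ _ => by simp [mul_eq_zero, div_eq_zero_iff, h0, h1]⟩

theorem good_g60 (ω : ℝ) (hyp : ω = 0 ∨ ω = 1) : Row.Good (.g60 ω hyp) :=
  ⟨isSolvableWithNilradical_of_coord isExtension_n51 4,
    isFundamentalSetOn_two spansOrbit_n51 genericCorank_n51₁ dense_one
      X₁ fun x (h0 : x 0 ≠ 0) => exists_grad_two X₂ X₄
        ((coord 1).div ((coord 0).pow 2) (pow_ne_zero _ h0))
        ((coord 0).mul ((((((coord 0).neg).mul (coord 3)).add ((coord 1).mul (coord 2))).div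
          ((coord 0).pow 2) (pow_ne_zero _ h0)).exp))
        fun _ _ => by simp [mul_eq_zero, div_eq_zero_iff, h0]⟩

theorem good_g61 (lam : ℝ) : Row.Good (.g61 lam) :=
  ⟨isSolvableWithNilradical_of_coord isExtension_n51 4,
    isFundamentalSetOn_two spansOrbit_n51 genericCorank_n51₁ dense_one
      ![1, 1, 0, 0, 0, 0] fun x ⟨h0, h1⟩ => exists_grad_two X₂ X₃
        ((coord 1).mul ((coord 0).rpow h0 _))
        ((((coord 0).mul (coord 3)).sub ((coord 1).mul (coord 2))).div
          ((coord 1).mul ((coord 0).sqrt h0)) (mul_ne_zero h1 ((Real.sqrt_pos.2 h0).ne')))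
        (hE0 := by
          intro a b c d
          have h := Real.sq_sqrt h0.le
          simp
          field_simp
          -- the square root is cleared by its defining equation
          rw [h]
          ring)
        fun _ _ => by simp [mul_eq_zero, div_eq_zero_iff, h1, rpow_ne_zero h0,
          (Real.sqrt_pos.2 h0).ne']⟩

theorem good_g62 (ω : ℝ) (hyp : ω = 0 ∨ ω = 1) : Row.Good (.g62 ω hyp) :=
  ⟨isSolvableWithNilradical_of_coord isExtension_n51 4,
    isFundamentalSetOn_two spansOrbit_n51 genericCorank_n51₁ dense_one
      ![1, 1, 0, 0, 0, 0] fun x ⟨h0, h1⟩ => exists_grad_two X₁ X₃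
        (((coord 1).pow 2).div (coord 0) h0)
        ((coord 0).mul ((((const _).mul (((coord 0).mul (coord 3)).sub
          ((coord 1).mul (coord 2)))).div ((coord 1).pow 2) (pow_ne_zero _ h1)).exp))
        fun _ _ => by simp [mul_eq_zero, div_eq_zero_iff, h0, h1]⟩

theorem good_g63 (lam : ℝ) : Row.Good (.g63 lam) :=
  ⟨isSolvableWithNilradical_of_coord isExtension_n51 2,
    isFundamentalSetOn_two spansOrbit_n51 genericCorank_n51₁ dense_one
      ![1, 1, 0, 0, 0, 0] fun x ⟨h0, h1⟩ => exists_grad_two X₂ X₃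
        ((coord 1).mul ((coord 0).rpow h0 _))
        ((coord 0).mul ((((((coord 0).neg).mul (coord 3)).add ((coord 1).mul (coord 2))).div
          ((coord 0).mul (coord 1)) (mul_ne_zero h0.ne' h1)).exp))
        fun _ _ => by simp [mul_eq_zero, div_eq_zero_iff, h0.ne', h1, rpow_ne_zero h0]⟩

theorem good_g64 (h : ℝ) : Row.Good (.g64 h) :=
  ⟨isSolvableWithNilradical_of_coord isExtension_n51 3,
    isFundamentalSetOn_two spansOrbit_n51 genericCorank_n51₁ dense_one
      X₁ fun x (h0 : 0 < x 0) => exists_grad_two X₂ X₄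
        ((coord 1).div (coord 0) h0.ne')
        (((((coord 1).mul (coord 2)).sub ((coord 0).mul (coord 3))).add
          ((((coord 0).pow 2).sub ((const _).mul ((coord 1).pow 2))).mul
          ((coord 0).log h0.ne'))).div ((coord 0).pow 2) (pow_ne_zero _ h0.ne'))
        fun _ _ => by simp [mul_eq_zero, div_eq_zero_iff, h0.ne']⟩

theorem good_g65 (lam γ : ℝ) (hyp : lam ≠ 0 ∨ γ ≠ 0) : Row.Good (.g65 lam γ hyp) :=
  ⟨(hyp.elim
    (fun h => isSolvableWithNilradical_of_center isExtension_n51 X₂ (c := lam) h)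
    (fun h => isSolvableWithNilradical_of_coord isExtension_n51 4 (by simp [h, mul_eq_zero]))),
    isFundamentalSetOn_two spansOrbit_n51 genericCorank_n51₁' dense_one
      X₂ fun x (h1 : x 1 ≠ 0) => exists_grad_two ![x 0, x 1, 0, 0, 0, 0] X₃
        ((coord 1).mul ((((const _).mul (coord 0)).div (coord 1) h1).exp))
        ((((coord 0).mul (coord 3)).sub ((coord 1).mul (coord 2))).mul
          ((((const _).mul (coord 0)).div (coord 1) h1).exp))
        fun _ _ => by simp [mul_eq_zero, h1]⟩

theorem good_g66 : Row.Good .g66 :=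
  ⟨isSolvableWithNilradical_of_coord isExtension_n51 4,
    isFundamentalSetOn_two spansOrbit_n51 genericCorank_n51₁ dense_one
      ![1, 1, 0, 0, 0, 0]
      (hx₀ := by simp; norm_num)
      fun x (h1 : x 1 ≠ 0) => exists_grad_two X₁ X₃
        ((coord 1).mul ((((const _).mul (coord 0)).div (coord 1) h1).exp))
        ((((coord 0).mul (coord 3)).sub ((coord 1).mul (coord 2))).mul
          ((((const _).mul (coord 0)).div (coord 1) h1).exp))
        fun _ _ => by simp [mul_eq_zero, div_eq_zero_iff, h1]⟩

theorem good_g67 (h : ℝ) : Row.Good (.g67 h) :=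
  ⟨isSolvableWithNilradical_of_coord isExtension_n51 4,
    isFundamentalSetOn_two spansOrbit_n51 genericCorank_n51₁ dense_one
      ![1, 1, 0, 0, 0, 0]
      (hx₀ := by simp; norm_num)
      fun x (h1 : x 1 ≠ 0) => exists_grad_two X₁ X₃
        ((coord 1).mul ((((const _).mul (coord 0)).div (coord 1) h1).exp))
        ((((coord 0).mul (coord 3)).sub ((coord 1).mul (coord 2))).mul
          ((((const _).mul (coord 0)).div (coord 1) h1).exp))
        fun _ _ => by simp [mul_eq_zero, div_eq_zero_iff, h1]⟩

theorem good_g68 (γ : ℝ) : Row.Good (.g68 γ) :=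
  ⟨isSolvableWithNilradical_of_coord isExtension_n51 2,
    isFundamentalSetOn_two spansOrbit_n51 genericCorank_n51₁ dense_one
      ![1, 1, 0, 0, 0, 0] fun x (h1 : x 1 ≠ 0) => exists_grad_two X₁ X₃
        ((coord 1).mul ((((coord 0).neg).div (coord 1) h1).exp))
        (((((const _).mul (((coord 0).mul (coord 3)).sub ((coord 1).mul (coord 2)))).mul
          (coord 1)).sub ((const _).mul ((coord 0).pow 3))).div ((coord 1).pow 3)
          (pow_ne_zero _ h1))
        fun _ _ => by simp [mul_eq_zero, div_eq_zero_iff, h1]⟩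

theorem good_g69 : Row.Good .g69 :=
  ⟨isSolvableWithNilradical_of_coord isExtension_n51 2,
    isFundamentalSetOn_two spansOrbit_n51 genericCorank_n51₁ dense_one
      ![1, 1, 0, 0, 0, 0] fun x (h1 : x 1 ≠ 0) => exists_grad_two X₁ X₃
        ((coord 1).mul ((((coord 0).neg).div (coord 1) h1).exp))
        ((((((((const _).mul (coord 0)).mul (coord 3)).sub (((const _).mul (coord 1)).mul
          (coord 2))).sub ((coord 0).pow 2)).sub ((coord 1).pow 2)).div (const _) two_ne_zero).mul
          ((((const _).mul (coord 0)).div (coord 1) h1).exp))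
        fun _ _ => by simp [mul_eq_zero, div_eq_zero_iff, h1]⟩

theorem good_g70 (γ p : ℝ) : Row.Good (.g70 γ p) :=
  ⟨isSolvableWithNilradical_of_pair isExtension_n51 2 3 (p - γ) (-1) 1 (p - γ)
    (by nlinarith [sq_nonneg (p - γ)]),
    isFundamentalSetOn_two spansOrbit_n51 genericCorank_n51₁' dense_one
      X₂ fun x (h1 : x 1 ≠ 0) => exists_grad_two ![x 0, x 1, 0, 0, 0, 0] X₃
        ((coord 1).mul_unitPow (coord 0) h1 _ fun y => by ring)
        (((((coord 0).mul (coord 3)).sub ((coord 1).mul (coord 2))).div (const _) two_ne_zero).mul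
          (((const _).mul (((coord 0).div (coord 1) h1).arctan)).exp))
        fun _ _ => ⟨radial_ne h1 _ _, by simp [h1, mul_eq_zero, div_eq_zero_iff]⟩⟩

/-! ### The rows with nilradical `g_{5,2}` -/

/-- Positivity of `2 x_3 - x_2 ^ 2 / x_1`, which the second function needs, follows from the first
two inequalities defining the domain. -/
theorem good_g71a (h : ℝ) (h_ne : h ≠ -1) : Row.Good (.g71a h h_ne) :=
  ⟨isSolvableWithNilradical_of_coord isExtension_n52 4,
    isFundamentalSetOn_two spansOrbit_n52 genericCorank_n52 dense_one
      ![1, 0, 1, 1, 0, 0]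
      (hx₀ := ⟨by simp, by simpa using fun e => h_ne (by linarith)⟩)
      fun x ⟨h0, hu, hw⟩ => exists_grad_two X₄ ![x 0, x 1, x 2, 0, 0, 0]
        (((((((const _).mul ((coord 0).pow 2)).mul (coord 3)).add ((coord 1).pow 3)).sub
          ((((const _).mul (coord 0)).mul (coord 1)).mul (coord 2))).rpow hw _).div
          (((coord 0).rpow h0 _).mul (((((const _).mul (coord 0)).mul (coord 2)).sub
          ((coord 1).pow 2)).rpow hu _)) (mul_ne_zero (rpow_ne_zero h0 _) (rpow_ne_zero hu _)))
        ((((const 2).mul (coord 2)).sub (((coord 1).pow 2).div (coord 0) h0.ne')).rpow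
          (by have hb := div_pos hu h0; rwa [sub_div, mul_right_comm,
            mul_div_cancel_right₀ _ h0.ne'] at hb) _ |>.mul ((coord 0).rpow h0 _))
        (hD0 := by
          intro a b c d
          simp
          -- the powers become opaque factors, leaving a rational identity
          generalize hC : 3 * x 0 ^ 2 * x 3 + x 1 ^ 3 - 3 * x 0 * x 1 * x 2 = C at hw ⊢
          generalize hB : 2 * x 0 * x 2 - x 1 ^ 2 = B at hu ⊢
          have hS := rpow_ne_zero h0 (h + 2)
          have hQ := rpow_ne_zero hu h
          generalize C ^ (h + 1) = P
          generalize x 0 ^ (h + 2) = S at *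
          generalize B ^ h = Q at *
          field_simp
          rw [← hC, ← hB]
          ring)
        (hE0 := by
          intro a b c d
          have hb := div_pos hu h0
          rw [sub_div, mul_right_comm, mul_div_cancel_right₀ _ h0.ne'] at hb
          simp
          generalize hB : 2 * x 2 - x 1 ^ 2 / x 0 = B at hb ⊢
          generalize B ^ (h + 3) = P
          generalize x 0 ^ (-(h + 1)) = S
          field_simp
          rw [← hB]
          field_simp
          ring)
        fun _ _ => by
          have hb := div_pos hu h0
          rw [sub_div, mul_right_comm, mul_div_cancel_right₀ _ h0.ne'] at hb
          simp [h0.ne', hw.ne', rpow_ne_zero h0, rpow_ne_zero hu, rpow_ne_zero hw,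
            show h + 1 ≠ 0 from fun e => h_ne (by linarith), mul_eq_zero, div_eq_zero_iff]
          intro e
          rw [show (2 * x 1 * x 1 * x 0 - x 1 ^ 2 * x 0) / x 0 ^ 2 = x 1 ^ 2 / x 0 by
            field_simp; ring, div_mul_cancel₀ _ hb.ne'] at e
          exact mul_ne_zero (rpow_ne_zero hb (h + 3)) (rpow_ne_zero h0 (-(h + 1)))
            (by linear_combination e / 2)⟩

theorem good_g71b (h : ℝ) (hh : h = -1) : Row.Good (.g71b h hh) := by
  subst hh
  exact ⟨isSolvableWithNilradical_of_coord isExtension_n52 4,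
    isFundamentalSetOn_two spansOrbit_n52 genericCorank_n52₁
      (G := fun x => (3 * x 0 ^ 2 * x 3 + x 1 ^ 3 - 3 * x 0 * x 1 * x 2))
      (dense_ne_zero_of_contDiff (by fun_prop) (x₀ := ![1, 0, 0, 1, 0, 0]) (by simp))
      X₁ (hx₀ := by simp; norm_num) fun x (h0 : x 0 ≠ 0) => exists_grad_two X₄ X₃
        (((((((const _).mul ((coord 0).pow 2)).mul (coord 3)).add ((coord 1).pow 3)).sub
          ((((const _).mul (coord 0)).mul (coord 1)).mul (coord 2))).pow 2).div ((coord 0).pow 3)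
          (pow_ne_zero _ h0))
        (((const _).mul (coord 2)).sub (((coord 1).pow 2).div (coord 0) h0))
        fun _ hG => by simp [mul_eq_zero, div_eq_zero_iff, h0, hG]⟩

theorem good_g72 : Row.Good .g72 :=
  ⟨isSolvableWithNilradical_of_coord isExtension_n52 4,
    isFundamentalSetOn_two spansOrbit_n52 genericCorank_n52₁
      (G := fun x => (3 * x 0 ^ 2 * x 3 + x 1 ^ 3 - 3 * x 0 * x 1 * x 2) *
      (-(2 * x 0 * x 2) + x 1 ^ 2))
      (dense_ne_zero_of_contDiff (by fun_prop) (x₀ := ![1, 0, 1, 1, 0, 0]) (by simp; norm_num))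
      X₁ fun x (h0 : x 0 ≠ 0) => exists_grad_two X₄ X₃
        (((((((const _).mul ((coord 0).pow 2)).mul (coord 3)).add ((coord 1).pow 3)).sub
          ((((const _).mul (coord 0)).mul (coord 1)).mul (coord 2))).pow 4).div ((coord 0).pow 9)
          (pow_ne_zero _ h0))
        ((((((const _).mul (coord 0)).mul (coord 2)).add ((coord 1).pow 2)).pow 2).div
          ((coord 0).pow 3) (pow_ne_zero _ h0))
        fun _ hG => by simp [mul_eq_zero, div_eq_zero_iff, h0, left_ne_zero_of_mul hG,
          right_ne_zero_of_mul hG]⟩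

theorem good_g73 (ε : ℝ) (hyp : ε = 1 ∨ ε = -1) : Row.Good (.g73 ε hyp) :=
  ⟨isSolvableWithNilradical_of_coord isExtension_n52 3,
    isFundamentalSetOn_two spansOrbit_n52 genericCorank_n52₁ dense_one
      X₁ fun x (h0 : 0 < x 0) => exists_grad_two X₄ X₃
        ((((((const _).mul ((coord 0).pow 2)).mul (coord 3)).add ((coord 1).pow 3)).sub
          ((((const _).mul (coord 0)).mul (coord 1)).mul (coord 2))).div ((coord 0).pow 3)
          (pow_ne_zero _ h0.ne'))
        (((coord 0).rpow h0 _).mul ((((((const _).mul (coord 0)).mul (coord 2)).add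
          ((coord 1).pow 2)).div ((const _).mul ((coord 0).pow 2)) (mul_ne_zero two_ne_zero
          (pow_ne_zero _ h0.ne'))).exp))
        fun _ _ => by simp [mul_eq_zero, div_eq_zero_iff, h0.ne', rpow_ne_zero h0]⟩

theorem good_g74 : Row.Good .g74 :=
  ⟨isSolvableWithNilradical_of_coord isExtension_n52 3,
    isFundamentalSetOn_two spansOrbit_n52 genericCorank_n52₁ dense_one
      X₁ fun x (h0 : x 0 ≠ 0) => exists_grad_two X₄ X₃
        ((((((const _).mul ((coord 0).pow 2)).mul (coord 3)).add ((coord 1).pow 3)).sub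
          ((((const _).mul (coord 0)).mul (coord 1)).mul (coord 2))).div ((coord 0).pow 3)
          (pow_ne_zero _ h0))
        (((((const _).mul (coord 0)).mul (coord 2)).sub ((coord 1).pow 2)).div ((coord 0).pow 2)
          (pow_ne_zero _ h0))
        fun _ _ => by simp [mul_eq_zero, div_eq_zero_iff, h0]⟩

theorem good_g75 : Row.Good .g75 :=
  ⟨isSolvableWithNilradical_of_coord isExtension_n52 3,
    isFundamentalSetOn_two spansOrbit_n52 genericCorank_n52₁ dense_one
      X₁ fun x (h0 : x 0 ≠ 0) => exists_grad_two X₄ X₃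
        ((coord 0).mul (((((((const _).mul ((coord 0).pow 2)).mul (coord 3)).sub
          ((coord 1).pow 3)).add ((((const _).mul (coord 0)).mul (coord 1)).mul (coord 2))).div
          ((const _).mul ((coord 0).pow 3)) (mul_ne_zero three_ne_zero (pow_ne_zero _ h0))).exp))
        (((((const _).mul (coord 0)).mul (coord 2)).sub ((coord 1).pow 2)).div ((coord 0).pow 2)
          (pow_ne_zero _ h0))
        fun _ _ => by simp [mul_eq_zero, div_eq_zero_iff, h0]⟩

/-! ### The rows with nilradical `g_{5,3}` -/

theorem good_g76a (h : ℝ) (hh : 2 * h + 1 ≠ 0) : Row.Good (.g76a h hh) :=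
  ⟨isSolvableWithNilradical_of_coord isExtension_n53 3,
    isFundamentalSetOn_two spansOrbit_n53 genericCorank_n53₁ dense_one
      ![1, 0, 1, 0, 0, 0] (hx₀ := by simp [hh]) fun x ⟨h0, h2⟩ => exists_grad_two X₃ X₄
        (((coord 2).rpow h2 _).mul ((coord 0).rpow h0 _))
        ((((((const _).mul (coord 2)).mul (coord 4)).add ((coord 1).pow 2)).sub
          (((const _).mul (coord 0)).mul (coord 3))).div ((coord 2).mul ((coord 0).rpow h0 _))
          (mul_ne_zero h2.ne' (rpow_ne_zero h0 _)))
        fun _ _ => by simp [mul_eq_zero, div_eq_zero_iff, h0.ne', h2.ne', rpow_ne_zero h0,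
          rpow_ne_zero h2, hh]⟩

theorem good_g76b (h : ℝ) (hyp : 2 * h + 1 = 0) : Row.Good (.g76b h hyp) := by
  obtain rfl : h = -1 / 2 := by linarith
  exact ⟨isSolvableWithNilradical_of_coord isExtension_n53 3,
    isFundamentalSetOn_two spansOrbit_n53 genericCorank_n53₃
      (G := fun x => (2 * x 2 * x 4 + x 1 ^ 2 - 2 * x 0 * x 3) * x 1)
      (dense_ne_zero_of_contDiff (by fun_prop) (x₀ := X₂) (by simp))
      ![1, 0, 1, 0, 0, 0]
      (hx₀ := by simp; norm_num)
      fun x (h2 : x 2 ≠ 0) => exists_grad_two X₁ X₂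
        (coord 0)
        (((((((const _).mul (coord 2)).mul (coord 4)).add ((coord 1).pow 2)).sub
          (((const _).mul (coord 0)).mul (coord 3))).pow 3).div ((coord 2).pow 2)
          (pow_ne_zero _ h2))
        fun _ hG => by simp [mul_eq_zero, div_eq_zero_iff, h2, left_ne_zero_of_mul hG,
          right_ne_zero_of_mul hG]⟩

theorem good_g77 (ε : ℝ) (hyp : ε = 1 ∨ ε = -1) : Row.Good (.g77 ε hyp) :=
  ⟨isSolvableWithNilradical_of_coord isExtension_n53 3,
    isFundamentalSetOn_two spansOrbit_n53 genericCorank_n53₁ dense_one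
      X₁ fun x (h0 : 0 < x 0) => exists_grad_two X₄ X₃
        (((coord 0).rpow h0 _).mul (((((((const _).mul (coord 2)).mul (coord 4)).add
          ((coord 1).pow 2)).sub (((const _).mul (coord 0)).mul (coord 3))).div
          ((const _).mul ((coord 0).pow 2)) (mul_ne_zero two_ne_zero (pow_ne_zero _ h0.ne'))).exp))
        ((coord 2).div ((coord 0).pow 2) (pow_ne_zero _ h0.ne'))
        fun _ _ => by simp [mul_eq_zero, div_eq_zero_iff, h0.ne', rpow_ne_zero h0]⟩

theorem good_g78 : Row.Good .g78 :=
  ⟨isSolvableWithNilradical_of_coord isExtension_n53 3,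
    isFundamentalSetOn_two spansOrbit_n53 genericCorank_n53₁ dense_one
      ![1, 0, 1, 0, 0, 0] fun x ⟨h0, h2⟩ => exists_grad_two X₄ X₁
        ((coord 0).mul (((((const _).mul (((coord 0).mul (coord 3)).sub
          ((coord 2).mul (coord 4)))).sub ((coord 1).pow 2)).div (((const _).mul (coord 0)).mul
          (coord 2)) (mul_ne_zero (mul_ne_zero two_ne_zero h0) h2)).exp))
        ((coord 0).mul (coord 2))
        fun _ _ => by simp [mul_eq_zero, div_eq_zero_iff, h0, h2]⟩

theorem good_g79 : Row.Good .g79 :=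
  ⟨isSolvableWithNilradical_of_coord isExtension_n53 3,
    isFundamentalSetOn_two spansOrbit_n53 genericCorank_n53₁
      (G := fun x => (2 * (x 0 * x 3 - x 2 * x 4) - x 1 ^ 2) * x 1)
      (dense_ne_zero_of_contDiff (by fun_prop) (x₀ := X₂) (by simp))
      X₁ fun x (h0 : x 0 ≠ 0) => exists_grad_two X₃ X₂
        ((coord 0).mul ((((const _).mul (coord 2)).div (coord 0) h0).exp))
        (((((const _).mul (((coord 0).mul (coord 3)).sub ((coord 2).mul (coord 4)))).sub
          ((coord 1).pow 2)).pow 3).div ((coord 0).pow 4) (pow_ne_zero _ h0))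
        fun _ hG => by simp [mul_eq_zero, div_eq_zero_iff, h0, left_ne_zero_of_mul hG,
          right_ne_zero_of_mul hG]⟩

theorem good_g80 : Row.Good .g80 :=
  ⟨isSolvableWithNilradical_of_coord isExtension_n53 4,
    isFundamentalSetOn_two spansOrbit_n53 genericCorank_n53₁ (dense_apply 2)
      X₁ fun x (h0 : x 0 ≠ 0) => exists_grad_two X₁ X₄
        (((coord 2).pow 2).div (coord 0) h0)
        ((((((const _).mul (coord 2)).mul (coord 4)).add ((coord 1).pow 2)).sub
          (((const _).mul (coord 0)).mul (coord 3))).div (coord 0) h0)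
        fun _ hG => by simp [mul_eq_zero, div_eq_zero_iff, h0, hG]⟩

theorem good_g81 (ε : ℝ) (hyp : ε = 1 ∨ ε = -1) : Row.Good (.g81 ε hyp) :=
  ⟨isSolvableWithNilradical_of_coord isExtension_n53 4,
    isFundamentalSetOn_two spansOrbit_n53 genericCorank_n53₁ dense_one
      ![1, 0, 1, 0, 0, 0] fun x ⟨h0, h2⟩ => exists_grad_two X₁ X₄
        (((coord 2).pow 2).div (coord 0) h0.ne')
        (((coord 0).rpow h0 _).mul (((((((const _).mul (coord 0)).mul (coord 3)).sub
          (((const _).mul (coord 2)).mul (coord 4))).sub ((coord 1).pow 2)).div ((coord 2).pow 2)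
          (pow_ne_zero _ h2)).exp))
        fun _ _ => by simp [mul_eq_zero, div_eq_zero_iff, h0.ne', h2, rpow_ne_zero h0]⟩

/-! ### The rows with nilradical `g_{5,4}` -/

theorem good_g82a (lam lam₁ : ℝ) : Row.Good (.g82a lam lam₁) :=
  ⟨isSolvableWithNilradical_of_center isExtension_n54 X₁ (c := 2) (by simp),
  isFundamentalSetOn_zero genericCorank_n54_zero X₁ (by simp) _⟩

theorem good_g82b (lam lam₁ : ℝ) (hyp : lam ≠ 0 ∨ lam₁ ≠ 0) : Row.Good (.g82b lam lam₁ hyp) :=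
  ⟨(hyp.elim
    (fun h => isSolvableWithNilradical_of_coord isExtension_n54 1 (by simp [h, mul_eq_zero]))
    (fun h => isSolvableWithNilradical_of_coord isExtension_n54 2 (by simp [h, mul_eq_zero]))),
    isFundamentalSetOn_two spansOrbit_n54 genericCorank_n54_two (dense_apply 0)
      X₁ fun x _ => exists_grad_two X₁ ![0, 0, 0, 0, 0, 1]
        (coord 0)
        (((((const _).mul (coord 1)).mul (coord 3)).add (((const _).mul (coord 2)).mul
          (coord 4))).sub ((coord 0).mul (coord 5)))
        fun _ hG => by simp [hG]⟩

theorem good_g83a (α lam : ℝ) (hα : α ≠ 0) : Row.Good (.g83a α lam hα) :=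
  ⟨isSolvableWithNilradical_of_center isExtension_n54 X₁ (c := α) hα,
  isFundamentalSetOn_zero genericCorank_n54_zero X₁ (by simp [hα]) _⟩

theorem good_g83b (lam : ℝ) (hlam : lam ≠ 0) : Row.Good (.g83b lam hlam) :=
  ⟨isSolvableWithNilradical_of_coord isExtension_n54 4 (by simp [mul_eq_zero, hlam]),
    isFundamentalSetOn_two spansOrbit_n54 genericCorank_n54_two (dense_apply 0)
      X₁ fun x _ => exists_grad_two X₁ ![0, 0, 0, 0, 0, 1]
        (coord 0)
        ((((const _).mul (((coord 1).mul (coord 3)).add ((coord 2).mul (coord 4)))).add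
          ((coord 2).mul (coord 3))).sub ((coord 0).mul (coord 5)))
        fun _ hG => by simp [hG]⟩

theorem good_g84 : Row.Good .g84 :=
  ⟨isSolvableWithNilradical_of_coord isExtension_n54 1,
    isFundamentalSetOn_two spansOrbit_n54 genericCorank_n54_two (dense_apply 0)
      X₁ fun x _ => exists_grad_two X₁ ![0, 0, 0, 0, 0, 1]
        (coord 0)
        (((((const _).mul (coord 0)).mul (coord 5)).add ((coord 2).pow 2)).sub
          (((const _).mul (coord 1)).mul (coord 3)))
        fun _ hG => by simp [mul_eq_zero, hG]⟩

theorem good_g85 (lam : ℝ) : Row.Good (.g85 lam) :=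
  ⟨isSolvableWithNilradical_of_coord isExtension_n54 4,
  isFundamentalSetOn_zero genericCorank_n54_zero X₁ (by simp) _⟩

theorem good_g86 : Row.Good .g86 :=
  ⟨isSolvableWithNilradical_of_coord isExtension_n54 4,
  isFundamentalSetOn_zero genericCorank_n54_zero X₁ (by simp) _⟩

theorem good_g87 : Row.Good .g87 :=
  ⟨isSolvableWithNilradical_of_coord isExtension_n54 1,
  isFundamentalSetOn_zero genericCorank_n54_zero X₁ (by simp) _⟩

theorem good_g88a (α μ₀ ν₀ : ℝ) (hα : α ≠ 0) : Row.Good (.g88a α μ₀ ν₀ hα) :=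
  ⟨isSolvableWithNilradical_of_center isExtension_n54 X₁ (c := α) hα,
  isFundamentalSetOn_zero genericCorank_n54_zero X₁ (by simp [hα]) _⟩

theorem good_g88b (μ₀ ν₀ : ℝ) (hyp : μ₀ ≠ 0 ∨ ν₀ ≠ 0) : Row.Good (.g88b μ₀ ν₀ hyp) :=
  ⟨isSolvableWithNilradical_of_pair isExtension_n54 1 2 μ₀ (-ν₀) ν₀ μ₀ (by
      rcases hyp with h | h
      · nlinarith [sq_nonneg ν₀, pow_pos (abs_pos.2 h) 2, sq_abs μ₀]
      · nlinarith [sq_nonneg μ₀, pow_pos (abs_pos.2 h) 2, sq_abs ν₀]),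
    isFundamentalSetOn_two spansOrbit_n54 genericCorank_n54_two (dense_apply 0)
      X₁ fun x _ => exists_grad_two X₁ ![0, 0, 0, 0, 0, 1]
        (coord 0)
        ((((const _).mul (((coord 1).mul (coord 3)).add ((coord 2).mul (coord 4)))).add
          ((const _).mul (((coord 2).mul (coord 3)).sub ((coord 1).mul (coord 4))))).sub
          ((coord 0).mul (coord 5)))
        fun _ hG => by simp [hG]⟩

theorem good_g89a (α ν₀ s : ℝ) (hα : α ≠ 0) : Row.Good (.g89a α ν₀ s hα) :=
  ⟨isSolvableWithNilradical_of_center isExtension_n54 X₁ (c := α) hα,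
  isFundamentalSetOn_zero genericCorank_n54_zero X₁ (by simp [hα]) _⟩

theorem good_g89b (ν₀ s : ℝ) (hyp : ν₀ ≠ 0 ∨ s ≠ 0) : Row.Good (.g89b ν₀ s hyp) :=
  ⟨(hyp.elim
    (fun h => isSolvableWithNilradical_of_pair isExtension_n54 2 4 0 (-ν₀) ν₀ 0 (by simp [h,
      mul_eq_zero]))
    (fun h => isSolvableWithNilradical_of_coord isExtension_n54 1 (by simp [h, mul_eq_zero]))),
    isFundamentalSetOn_two spansOrbit_n54 genericCorank_n54_two (dense_apply 0)
      X₁ fun x _ => exists_grad_two X₁ ![0, 0, 0, 0, 0, 1]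
        (coord 0)
        ((((((const _).mul (coord 0)).mul (coord 5)).sub (((const _).mul (coord 1)).mul
          (coord 3))).sub ((const _).mul (((coord 2).pow 2).add ((coord 4).pow 2)))).div
          (const _) two_ne_zero)
        fun _ hG => by simp [mul_eq_zero, div_eq_zero_iff, hG]⟩

theorem good_g90a (α ν₀ : ℝ) (hα : α ≠ 0) : Row.Good (.g90a α ν₀ hα) :=
  ⟨isSolvableWithNilradical_of_center isExtension_n54 X₁ (c := α) hα,
  isFundamentalSetOn_zero genericCorank_n54_zero X₁ (by simp [hα]) _⟩

theorem good_g90b (ν₀ : ℝ) (h_ne : ν₀ ≠ 1) : Row.Good (.g90b ν₀ h_ne) :=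
  ⟨isSolvableWithNilradical_of_pair isExtension_n54 1 3 0 1 1 0 (by norm_num),
    isFundamentalSetOn_two spansOrbit_n54 genericCorank_n54_two (dense_apply 0)
      X₁ fun x _ => exists_grad_two X₁ ![0, 0, 0, 0, 0, 1]
        (coord 0)
        (((((((const _).mul (coord 0)).mul (coord 5)).add ((coord 1).pow 2)).sub
          ((coord 3).pow 2)).sub ((const _).mul (((coord 2).pow 2).add ((coord 4).pow 2)))).div
          (const _) two_ne_zero)
        fun _ hG => by simp [mul_eq_zero, div_eq_zero_iff, hG]⟩

theorem good_g91 : Row.Good .g91 :=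
  ⟨isSolvableWithNilradical_of_pair isExtension_n54 1 3 0 1 1 0 (by norm_num),
    isFundamentalSetOn_two spansOrbit_n54 genericCorank_n54_two (dense_apply 0)
      X₁ fun x _ => exists_grad_two X₁ ![0, 0, 0, 0, 0, 1]
        (coord 0)
        (((((((const _).mul (coord 0)).mul (coord 5)).add ((coord 1).pow 2)).sub
          ((coord 3).pow 2)).sub (((coord 2).pow 2).add ((coord 4).pow 2))).div
          (const _) two_ne_zero)
        fun _ hG => by simp [mul_eq_zero, div_eq_zero_iff, hG]⟩

theorem good_g92a (α μ₀ ν₀ : ℝ) (hα : α ≠ 0) : Row.Good (.g92a α μ₀ ν₀ hα) :=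
  ⟨isSolvableWithNilradical_of_center isExtension_n54 X₁ (c := α) hα,
  isFundamentalSetOn_zero genericCorank_n54_zero X₁ (by simp [hα]) _⟩

theorem good_g92b (μ₀ ν₀ : ℝ) (hμν : μ₀ * ν₀ ≠ 0) : Row.Good (.g92b μ₀ ν₀ hμν) :=
  ⟨isSolvableWithNilradical_of_pair isExtension_n54 1 2 0 (-μ₀) ν₀ 0 (by simpa using hμν),
    isFundamentalSetOn_two spansOrbit_n54 genericCorank_n54_two (dense_apply 0)
      X₁ fun x _ => exists_grad_two X₁ ![0, 0, 0, 0, 0, 1]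
        (coord 0)
        (((((coord 0).neg).mul (coord 5)).sub (((const _).mul (coord 1)).mul (coord 4))).add
          (((const _).mul (coord 2)).mul (coord 3)))
        fun _ hG => by simp [hG]⟩

theorem good_g92star_a (p : ℝ) (hp : p ≠ 0) : Row.Good (.g92star_a p hp) :=
  ⟨isSolvableWithNilradical_of_center isExtension_n54' X₅ (c := 2 * p) (by simp [hp, mul_eq_zero]),
  isFundamentalSetOn_zero genericCorank_n54'_zero X₅ (by simp [hp, mul_eq_zero]) _⟩

theorem good_g92star_b : Row.Good .g92star_b :=
  ⟨isSolvableWithNilradical_of_pair isExtension_n54' 0 2 0 (-1) 1 0 (by norm_num),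
    isFundamentalSetOn_two spansOrbit_n54' genericCorank_n54'_two (dense_apply 0)
      ![1, 0, 0, 0, 1, 0] fun x _ => exists_grad_two X₅ X₁
        (coord 4)
        ((((((coord 0).pow 2).add ((coord 1).pow 2)).add ((coord 2).pow 2)).add
          ((coord 3).pow 2)).sub (((const _).mul (coord 4)).mul (coord 5)))
        fun _ hG => by simp [mul_eq_zero, hG]⟩

theorem good_g93a (α ν₀ : ℝ) (hα : α ≠ 0) : Row.Good (.g93a α ν₀ hα) :=
  ⟨isSolvableWithNilradical_of_center isExtension_n54 X₁ (c := α) hα,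
  isFundamentalSetOn_zero genericCorank_n54_zero X₁ (by simp [hα]) _⟩

/-- The derivation acts on `𝔫 / [𝔫, 𝔫]` invertibly when `ν₀ ≠ 0`; otherwise the functional
`x_2 + x_4` is an eigenvector of its transpose. -/
theorem good_g93b (ν₀ : ℝ) : Row.Good (.g93b ν₀) :=
  ⟨(by
    refine isSolvableWithNilradical_of_isExtension isExtension_n54 ?_
    by_cases hν : ν₀ = 0
    · refine not_isNilpotent_of_quotient
        ((LinearMap.proj 1 : (Fin 6 → ℝ) →ₗ[ℝ] ℝ) + LinearMap.proj 3 : (Fin 6 → ℝ) →ₗ[ℝ] ℝ) ?_ ?_ ?_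
      · simp [brk_n54]
      · intro v hv
        simpa [hν, add_comm] using hv
      · exact fun h => by simpa using LinearMap.congr_fun h X₂
    · refine not_isNilpotent_of_quotient
        (LinearMap.funLeft ℝ ℝ (![1, 2, 3, 4] : Fin 4 → Fin 6) :
          (Fin 6 → ℝ) →ₗ[ℝ] Fin 4 → ℝ) ?_ ?_ ?_
      · intro x y
        ext i
        fin_cases i <;> simp [brk_n54, LinearMap.funLeft_apply]
      · intro v hv
        have h1 := congrFun hv 0
        have h2 := congrFun hv 1
        have h3 := congrFun hv 2
        have h4 := congrFun hv 3
        simp [LinearMap.funLeft_apply, hν, mul_eq_zero] at h1 h2 h3 h4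
        ext i
        fin_cases i <;> simp_all [LinearMap.funLeft_apply, mul_eq_zero]
      · intro h
        simpa [LinearMap.funLeft_apply] using congrFun (LinearMap.congr_fun h X₂) 0),
    isFundamentalSetOn_two spansOrbit_n54 genericCorank_n54_two (dense_apply 0)
      X₁ fun x _ => exists_grad_two X₁ ![0, 0, 0, 0, 0, 1]
        (coord 0)
        (((((((const _).mul (coord 0)).mul (coord 5)).add
          ((const _).mul (((coord 1).mul (coord 2)).add ((coord 3).mul (coord 4))))).sub
          ((coord 1).pow 2)).add ((coord 3).pow 2)).div (const _) two_ne_zero)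
        fun _ hG => by simp [mul_eq_zero, div_eq_zero_iff, hG]⟩

/-! ### The rows with nilradical `g_{5,5}` or `g_{5,6}` -/

theorem good_g94a (lam : ℝ) (hne : lam + 2 ≠ 0) : Row.Good (.g94a lam hne) :=
  ⟨isSolvableWithNilradical_of_coord isExtension_n55 4,
  isFundamentalSetOn_zero genericCorank_n55_zero X₁ (by simp [hne]) _⟩

theorem good_g94b : Row.Good .g94b :=
  ⟨isSolvableWithNilradical_of_coord isExtension_n55 4,
    isFundamentalSetOn_two spansOrbit_n55 genericCorank_n55_two (dense_apply 0)
      X₁ fun x _ => exists_grad_two X₁ ![0, 0, 0, 0, 0, 1]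
        (coord 0)
        (((((((coord 0).pow 2).mul (coord 5)).add (((coord 0).mul (coord 1)).mul (coord 4))).add
          ((((const _).mul (coord 0)).mul (coord 2)).mul (coord 3))).sub (((coord 1).pow 2).mul
          (coord 3))).div (const _) two_ne_zero)
        fun _ hG => by simp [mul_eq_zero, div_eq_zero_iff, hG]⟩

theorem good_g95 : Row.Good .g95 :=
  ⟨isSolvableWithNilradical_of_coord isExtension_n55 4,
  isFundamentalSetOn_zero genericCorank_n55_zero X₁ (by simp) _⟩

theorem good_g96 : Row.Good .g96 :=
  ⟨isSolvableWithNilradical_of_coord isExtension_n55 4,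
  isFundamentalSetOn_zero genericCorank_n55_zero X₁ (by simp) _⟩

theorem good_g97 : Row.Good .g97 :=
  ⟨isSolvableWithNilradical_of_coord isExtension_n55 4,
  isFundamentalSetOn_zero genericCorank_n55_zero X₁ (by simp) _⟩

theorem good_g98 (h : ℝ) : Row.Good (.g98 h) :=
  ⟨isSolvableWithNilradical_of_coord isExtension_n55 2,
  isFundamentalSetOn_zero genericCorank_n55_zero X₁ (by simp) _⟩

theorem good_g99 : Row.Good .g99 :=
  ⟨isSolvableWithNilradical_of_coord isExtension_n56 4,
  isFundamentalSetOn_zero genericCorank_n56_zero X₁ (by simp) _⟩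

end

end Coadjoint

namespace Coadjoint

/-! ### The tables as a whole -/

theorem Row.good {b : List Bracket} {r : ℕ} {f : Functions ℝ r} : ∀ h : Row b r f, h.Good
  | .g1 α β γ δ ⟨h₁, h₂, h₃, h₄, h₅⟩ => good_g1 α β γ δ h₁ h₂ h₃ h₄ h₅
  | .g2 α γ δ ⟨h₁, h₂, h₃⟩ => good_g2 α γ δ h₁ h₂ h₃
  | .g3 α δ ⟨h₁, h₂⟩ => good_g3 α δ h₁ h₂
  | .g4 α => good_g4 α
  | .g5 => good_g5
  | .g6 α β hyp => good_g6 α β hyp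
  | .g7 α β hyp => good_g7 α β hyp
  | .g8 α β γ p ⟨h₁, h₂, h₃⟩ => good_g8 α β γ p h₁ h₂ h₃
  | .g9 α β p hyp => good_g9 α β p hyp
  | .g10 α p => good_g10 α p
  | .g11a α p q s ⟨h₁, h₂⟩ => good_g11a α p q s h₁ h₂
  | .g11b α p q s ⟨h₁, h₂⟩ => good_g11b α p q s h₁ h₂
  | .g13 α β h hyp => good_g13 α β h hyp
  | .g14a α β hyp => good_g14a α β hyp
  | .g14b α β hyp => good_g14b α β hyp
  | .g15 h => good_g15 h
  | .g16 => good_g16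
  | .g17a α ε ⟨h₁, h₂⟩ => good_g17a α ε h₁ h₂
  | .g17b α ε ⟨h₁, h₂⟩ => good_g17b α ε h₁ h₂
  | .g18 α β hyp => good_g18 α β hyp
  | .g19 α => good_g19 α
  | .g20 β hyp => good_g20 β hyp
  | .g21 α h hyp => good_g21 α h hyp
  | .g22 α => good_g22 α
  | .g23a α ε h ⟨h₁, h₂⟩ => good_g23a α ε h h₁ h₂
  | .g23b α ε h ⟨h₁, h₂⟩ => good_g23b α ε h h₁ h₂
  | .g24 h => good_g24 h
  | .g25a β h hyp => good_g25a β h hyp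
  | .g25b β h hyp => good_g25b β h hyp
  | .g26 h => good_g26 h
  | .g27a α β ε ⟨h₁, h₂⟩ => good_g27a α β ε h₁ h₂
  | .g27b α β ε ⟨h₁, h₂⟩ => good_g27b α β ε h₁ h₂
  | .g27c α β ε ⟨h₁, h₂, h₃⟩ => good_g27c α β ε h₁ h₂ h₃
  | .g29 α β ε ⟨h₁, h₂, h₃⟩ => good_g29 α β ε h₁ h₂ h₃
  | .g28 β => good_g28 β
  | .g30 => good_g30
  | .g31 => good_g31
  | .g32a α γ ε h ⟨h₁, h₂, h₃, h₄⟩ => good_g32a α γ ε h h₁ h₂ h₃ h₄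
  | .g32b α γ ε h ⟨h₁, h₂, h₃, h₄⟩ => good_g32b α γ ε h h₁ h₂ h₃ h₄
  | .g32c α γ ε h ⟨h₁, h₂, h₃⟩ => good_g32c α γ ε h h₁ h₂ h₃
  | .g32d α γ ε h ⟨h₁, h₂, h₃⟩ => good_g32d α γ ε h h₁ h₂ h₃
  | .g33a α β ⟨h₁, h₂⟩ => good_g33a α β h₁ h₂
  | .g33b α β ⟨h₁, h₂⟩ => good_g33b α β h₁ h₂
  | .g34a α ε h ⟨h₁, h₂⟩ => good_g34a α ε h h₁ h₂
  | .g34b α ε h ⟨h₁, h₂⟩ => good_g34b α ε h h₁ h₂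
  | .g34c α ε h ⟨h₁, h₂⟩ => good_g34c α ε h h₁ h₂
  | .g35 α β γ hyp => good_g35 α β γ hyp
  | .g36 α γ => good_g36 α γ
  | .g37 α β s hyp => good_g37 α β s hyp
  | .g38 α => good_g38 α
  | .g39 γ h hyp => good_g39 γ h hyp
  | .g40 h => good_g40 h
  | .g41a h hyp => good_g41a h hyp
  | .g41b h hyp => good_g41b h hyp
  | .g42 h => good_g42 h
  | .g43 => good_g43
  | .g44 γ => good_g44 γ
  | .g45 => good_g45
  | .g46 => good_g46
  | .g47 γ ε hyp => good_g47 γ ε hyp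
  | .g48 => good_g48
  | .g49 ε => good_g49 ε
  | .g50a ε hyp => good_g50a ε hyp
  | .g50b ε hyp => good_g50b ε hyp
  | .g51 ε => good_g51 ε
  | .g52 ε => good_g52 ε
  | .g53 => good_g53
  | .g54 lam γ => good_g54 lam γ
  | .g55 γ => good_g55 γ
  | .g56a γ hyp => good_g56a γ hyp
  | .g56b γ hyp => good_g56b γ hyp
  | .g57 γ => good_g57 γ
  | .g58 ω hyp => good_g58 ω hyp
  | .g59 h => good_g59 h
  | .g60 ω hyp => good_g60 ω hyp
  | .g61 lam => good_g61 lam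
  | .g62 ω hyp => good_g62 ω hyp
  | .g63 lam => good_g63 lam
  | .g64 h => good_g64 h
  | .g65 lam γ hyp => good_g65 lam γ hyp
  | .g66 => good_g66
  | .g67 h => good_g67 h
  | .g68 γ => good_g68 γ
  | .g69 => good_g69
  | .g70 γ p => good_g70 γ p
  | .g71a h hyp => good_g71a h hyp
  | .g71b h hyp => good_g71b h hyp
  | .g72 => good_g72
  | .g73 ε hyp => good_g73 ε hyp
  | .g74 => good_g74
  | .g75 => good_g75
  | .g76a h hyp => good_g76a h hyp
  | .g76b h hyp => good_g76b h hyp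
  | .g77 ε hyp => good_g77 ε hyp
  | .g78 => good_g78
  | .g79 => good_g79
  | .g80 => good_g80
  | .g81 ε hyp => good_g81 ε hyp
  | .g82a lam lam₁ => good_g82a lam lam₁
  | .g82b lam lam₁ hyp => good_g82b lam lam₁ hyp
  | .g83a α lam hyp => good_g83a α lam hyp
  | .g83b lam hyp => good_g83b lam hyp
  | .g84 => good_g84
  | .g85 lam => good_g85 lam
  | .g86 => good_g86
  | .g87 => good_g87
  | .g88a α μ₀ ν₀ hyp => good_g88a α μ₀ ν₀ hyp
  | .g88b μ₀ ν₀ hyp => good_g88b μ₀ ν₀ hyp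
  | .g89a α ν₀ s hyp => good_g89a α ν₀ s hyp
  | .g89b ν₀ s hyp => good_g89b ν₀ s hyp
  | .g90a α ν₀ hyp => good_g90a α ν₀ hyp
  | .g90b ν₀ hyp => good_g90b ν₀ hyp
  | .g91 => good_g91
  | .g92a α μ₀ ν₀ hyp => good_g92a α μ₀ ν₀ hyp
  | .g92b μ₀ ν₀ hyp => good_g92b μ₀ ν₀ hyp
  | .g92star_a p hyp => good_g92star_a p hyp
  | .g92star_b => good_g92star_b
  | .g93a α ν₀ hyp => good_g93a α ν₀ hyp
  | .g93b ν₀ => good_g93b ν₀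
  | .g94a lam hyp => good_g94a lam hyp
  | .g94b => good_g94b
  | .g95 => good_g95
  | .g96 => good_g96
  | .g97 => good_g97
  | .g98 h => good_g98 h
  | .g99 => good_g99

theorem Row.dom_eq_univ {b : List Bracket} {f : Functions ℝ 0} (h : Row b 0 f) :
    f.dom = Set.univ := by
  cases h <;> exact Set.eq_univ_of_forall fun _ => trivial

end Coadjoint

theorem mainTheorem1 :
    (∀ (b : List Coadjoint.Bracket) (r : ℕ) (f : Coadjoint.Functions ℝ r),
      Coadjoint.Row b r f →
        Coadjoint.IsSolvableWithNilradical b ∧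
        Coadjoint.IsFundamentalSetOn (Coadjoint.structConst b) f.dom f.fn) ∧
    (∀ (b : List Coadjoint.Bracket) (r : ℕ) (f : Coadjoint.Functions ℂ r),
      Coadjoint.ComplexRow b r f →
        Coadjoint.IsSolvableWithNilradical b ∧
        Coadjoint.IsFundamentalSetOn (Coadjoint.structConst b) f.dom f.fn) ∧
    (∀ (b : List Coadjoint.Bracket) (f : Coadjoint.Functions ℝ 0), Coadjoint.Row b 0 f →
      ∀ V : Set (Fin 6 → ℝ), IsOpen V → IsPreconnected V →
        ∀ F : (Fin 6 → ℝ) → ℝ, Coadjoint.IsInvariantOn (Coadjoint.structConst b) V F →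
          ∃ a : ℝ, ∀ x ∈ V, F x = a) := by
  refine ⟨fun b r f h => h.good, fun b r f h => ?_, fun b f h V hV hVc F hF => ?_⟩
  · obtain ⟨α, p, hyp⟩ := h
    exact Coadjoint.good_g12 α p hyp
  · have hf := h.good.2
    rw [h.dom_eq_univ] at hf
    exact Coadjoint.exists_eq_const_of_isFundamentalSetOn hf hV hVc hF
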